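/- **Theorem** ($Qm|rej|C_{\max}$ can be solved in $\widetilde{O}((p_{\max}+w_{\max})^{(m+2)(m+3)}\cdot n)$ time). Fix a number $m\ge 1$ of related machines. An instance of $Qm|rej|C_{\max}$ consists of $n\ge 1$ jobs with processing requirements $p_1,\dots,p_n\in\mathbb{N}$ and weights $w_1,\dots,w_n\in\mathbb{N}$, positive rational machine speeds $q_1,\dots,q_m$ (job $j$ takes time $p_j/q_i$ on machine $M_i$), and a bound $W\in\mathbb{N}$ (here $0\in\mathbb{N}$). A feasible schedule assigns each job to one of the machines or rejects it, such that the rejected jobs have total weight at most $W$; its makespan is $\max_{i}\sum_{j \text{ assigned to } M_i} p_j/q_i$. Let $p_{\max}=\max_j p_j$ and $w_{\max}=\max_j w_j$, and suppose that $p_{\max}+w_{\max}\ge 1$. There is an algorithm that computes, for every such instance, a feasible schedule of minimum makespan in time $$\widetilde{O}\big((p_{\max}+w_{\max})^{(m+2)(m+3)}\cdot n\big).$$ Precisely, for every $m\ge 1$ there are a word-RAM program and constants $\kappa,c,k\in\mathbb{N}$, depending only on $m$, such that on every such instance the program halts with an optimal schedule after at most $$c\,(p_{\max}+w_{\max})^{(m+2)(m+3)}\,n\,\lfloor\log_2(n+p_{\max}+w_{\max})\rfloor^{k}$$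 steps, where all computed words are smaller than $N^{\kappa}$ (i.e. have $O(\log N)$ bits) for $N=2+n+p_{\max}+w_{\max}+W+\sum_i(a_i+b_i)$, with $q_i=a_i/b_i$ in lowest terms. One step is one word operation (addition, truncated subtraction, multiplication, integer division, memory access, or control operation). -/

import Mathlib

namespace SchedRej

/-! ### The problem: makespan minimization on `m` related machines with job rejection -/

/-- An instance with `m` related machines: `n` jobs with processing requirements `p j` and weights
`w j`, a bound `W` on the total weight of the rejected jobs, and positive rational machine speeds
`q i`. Job `j` takes time `p j / q i` on machine `i`. -/
structure Instance (m : ℕ) where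
  n : ℕ
  p : Fin n → ℕ
  w : Fin n → ℕ
  W : ℕ
  q : Fin m → ℚ≥0
  q_pos : ∀ i, 0 < q i

namespace Instance

variable {m : ℕ}

/-- The largest processing requirement. -/
def pmax (I : Instance m) : ℕ := Finset.univ.sup I.p

/-- The largest weight. -/
def wmax (I : Instance m) : ℕ := Finset.univ.sup I.w

/-- A schedule of a subset of the jobs: `σ j = some i` if job `j` runs on machine `i`, and
`σ j = none` if job `j` is rejected. -/
abbrev Schedule (I : Instance m) : Type := Fin I.n → Option (Fin m)

/-- Total processing time on machine `i`. -/
def machineLoad (I : Instance m) (σ : I.Schedule) (i : Fin m) : ℚ≥0 :=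
  ∑ j ∈ Finset.univ.filter (fun j => σ j = some i), (I.p j : ℚ≥0) / I.q i

/-- The makespan `max_i M_i(σ)`. -/
def makespan (I : Instance m) (σ : I.Schedule) : ℚ≥0 :=
  Finset.univ.sup (I.machineLoad σ)

/-- Total weight of the rejected jobs. -/
def rejectedWeight (I : Instance m) (σ : I.Schedule) : ℕ :=
  ∑ j ∈ Finset.univ.filter (fun j => σ j = none), I.w j

/-- The rejected jobs have total weight at most `W`. -/
def Feasible (I : Instance m) (σ : I.Schedule) : Prop := I.rejectedWeight σ ≤ I.W

/-- A feasible schedule of minimum makespan. -/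
def IsOptimal (I : Instance m) (σ : I.Schedule) : Prop :=
  I.Feasible σ ∧ ∀ τ : I.Schedule, I.Feasible τ → I.makespan σ ≤ I.makespan τ

/-- An integer, at least `2`, that bounds the number of jobs and all numbers in the input. -/
def magnitude (I : Instance m) : ℕ :=
  2 + I.n + I.pmax + I.wmax + I.W + ∑ i, ((I.q i).num + (I.q i).den)

end Instance

/-! ### The machine model: a word RAM with structured control flow

Memory consists of variables and of arrays, named by natural numbers; a program is a finite term and
mentions only finitely many of them, while array positions are computed at run time. A word is a
natural number below `B`. Every operation, memory access and command takes one step. A run is stuck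
as soon as a number that is not a word would be computed, accessed or used as an array position. -/

structure State where
  var : ℕ → ℕ
  arr : ℕ → ℕ → ℕ

namespace State

def setVar (s : State) (x v : ℕ) : State :=
  { s with var := Function.update s.var x v }

def setArr (s : State) (a i v : ℕ) : State :=
  { s with arr := Function.update s.arr a (Function.update (s.arr a) i v) }

end State

inductive Expr : Type
  | const (v : ℕ)
  | var (x : ℕ)
  | get (a : ℕ) (i : Expr)
  | add (e f : Expr)
  | sub (e f : Expr)
  | mul (e f : Expr)
  | div (e f : Expr)

namespace Expr

/-- Value in a state: subtraction is truncated at `0`, division rounds down, `x / 0 = 0`. -/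
def val (s : State) : Expr → ℕ
  | const v => v
  | var x => s.var x
  | get a i => s.arr a (i.val s)
  | add e f => e.val s + f.val s
  | sub e f => e.val s - f.val s
  | mul e f => e.val s * f.val s
  | div e f => e.val s / f.val s

/-- All values that occur in the evaluation are words. -/
def Fits (B : ℕ) (s : State) : Expr → Prop
  | const v => v < B
  | var x => s.var x < B
  | get a i => i.Fits B s ∧ s.arr a (i.val s) < B
  | add e f => e.Fits B s ∧ f.Fits B s ∧ e.val s + f.val s < B
  | sub e f => e.Fits B s ∧ f.Fits B s
  | mul e f => e.Fits B s ∧ f.Fits B s ∧ e.val s * f.val s < B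
  | div e f => e.Fits B s ∧ f.Fits B s

/-- Number of steps of an evaluation. -/
def cost : Expr → ℕ
  | const _ => 1
  | var _ => 1
  | get _ i => i.cost + 1
  | add e f => e.cost + f.cost + 1
  | sub e f => e.cost + f.cost + 1
  | mul e f => e.cost + f.cost + 1
  | div e f => e.cost + f.cost + 1

end Expr

inductive Program : Type
  | skip
  | assign (x : ℕ) (e : Expr)
  | store (a : ℕ) (i e : Expr)
  | seq (P Q : Program)
  | ite (e : Expr) (P Q : Program)
  | loop (e : Expr) (P : Program)

/-- `Run B P s t s'`: with words below `B`, program `P` started in state `s` halts after exactly `t`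
steps in state `s'`. A test succeeds if its value is nonzero; `loop e P` repeats `P` as long as the
test `e` succeeds. -/
inductive Run (B : ℕ) : Program → State → ℕ → State → Prop
  | skip (s : State) : Run B .skip s 1 s
  | assign (x : ℕ) (e : Expr) (s : State) (he : e.Fits B s) :
      Run B (.assign x e) s (e.cost + 1) (s.setVar x (e.val s))
  | store (a : ℕ) (i e : Expr) (s : State) (hi : i.Fits B s) (he : e.Fits B s) :
      Run B (.store a i e) s (i.cost + e.cost + 1) (s.setArr a (i.val s) (e.val s))
  | seq {P Q : Program} {s s' s'' : State} {t t' : ℕ} (hP : Run B P s t s')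
      (hQ : Run B Q s' t' s'') : Run B (.seq P Q) s (t + t' + 1) s''
  | ite_true {e : Expr} {P Q : Program} {s s' : State} {t : ℕ} (he : e.Fits B s)
      (h : e.val s ≠ 0) (hP : Run B P s t s') : Run B (.ite e P Q) s (e.cost + t + 1) s'
  | ite_false {e : Expr} {P Q : Program} {s s' : State} {t : ℕ} (he : e.Fits B s)
      (h : e.val s = 0) (hQ : Run B Q s t s') : Run B (.ite e P Q) s (e.cost + t + 1) s'
  | loop_done {e : Expr} {P : Program} {s : State} (he : e.Fits B s) (h : e.val s = 0) :
      Run B (.loop e P) s (e.cost + 1) s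
  | loop_step {e : Expr} {P : Program} {s s' s'' : State} {t t' : ℕ} (he : e.Fits B s)
      (h : e.val s ≠ 0) (hP : Run B P s t s') (hL : Run B (.loop e P) s' t' s'') :
      Run B (.loop e P) s (e.cost + t + t' + 1) s''

/-! ### Input and output -/

/-- A finite sequence as the contents of an array, padded with zeros. -/
def toArr {k : ℕ} (f : Fin k → ℕ) (j : ℕ) : ℕ := if h : j < k then f ⟨j, h⟩ else 0

/-- The input: variables `0` and `1` hold `n` and `W`; arrays `0`, `1`, `2`, `3` hold the processing
requirements, the weights, and the numerators and denominators of the speeds. Everything else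
is `0`. -/
def Instance.init {m : ℕ} (I : Instance m) : State where
  var x := match x with
    | 0 => I.n
    | 1 => I.W
    | _ => 0
  arr a := match a with
    | 0 => toArr I.p
    | 1 => toArr I.w
    | 2 => toArr (fun i => (I.q i).num)
    | 3 => toArr (fun i => (I.q i).den)
    | _ => fun _ => 0

/-- The output: array `4` holds, at position `j`, the number `0` if job `j` is rejected and `i + 1`
if it runs on machine `i`, where `i = 0, ..., m - 1`. -/
def Instance.Outputs {m : ℕ} (I : Instance m) (s : State) (σ : I.Schedule) : Prop :=
  ∀ j : Fin I.n, s.arr 4 j = (σ j).elim 0 (fun i => (i : ℕ) + 1)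

/-- `P` solves `I` in at most `T` steps on words below `B`: it halts within `T` steps and outputs
an optimal schedule. -/
def Solves {m : ℕ} (P : Program) (I : Instance m) (B T : ℕ) : Prop :=
  ∃ (t : ℕ) (s : State) (σ : I.Schedule),
    Run B P I.init t s ∧ t ≤ T ∧ I.Outputs s σ ∧ I.IsOptimal σ

end SchedRej

set_option linter.unusedSectionVars false

namespace SchedRej

/-! The algorithm is a dynamic program in a narrow window around a greedy schedule. Let M be the
maximum of p_j + w_j. The guide G rejects jobs in order of increasing ratio w_j / p_j while the
budget W allows, always keeps jobs of size zero, and puts each accepted job on the machine where it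
completes first. Hence its scaled loads are balanced up to one job (`IsGuide`).

Proximity (`exists_near_guide`): a feasible schedule whose loads exceed those of G by at most M can
be replaced, without raising a load, by a feasible one that differs from G on jobs of total size at
most 180 m^5 M^(m+4). Take the replacement s that disagrees with G on the fewest jobs. If many jobs
were newly accepted and many newly rejected, two groups of equal weight could be swapped back,
because G rejects by ratio (`IsNearest.exchange`). So one group is small, and budget or load
conservation then bounds the other (`IsNearest.rejected_le`). Between machines, call a flow big if
it contains M^m jobs of one size. Big flows have no cycle, since common multiples of the sizes would
allow a cyclic exchange of equal volumes (`IsNearest.no_bigFlow_cycle`). A flow that is not big has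
bounded volume. A big flow from u to v enters the set of machines reachable from v by big flows, and
conservation across this cut bounds it by flows that are not big, new rejections and the slack mM
(`IsNearest.flow_le_of_rejected`).

An optimal schedule is either no better than G, or has scaled loads at most the makespan of G and
so, by balance, loads at most M above those of G (`IsTable.optimal`). In both cases some optimal
schedule stays near G after every prefix of the jobs. The dynamic program processes the jobs in the
input order; a state records, for each machine and for rejection, the difference between the
assigned volume and that of G, confined to a window of width b = 2h + 1 with h = 181 m^5 M^(m+4). An
entry stores the largest remaining rejection budget. `IsTable.complete` says that schedules near G
are seen, and `IsTable.sound` that traced-back entries are real schedules.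

There are b^(m+1) states per layer and m + 1 choices per state. The exponent of M is (m+4)(m+1),
which is at most (m+2)(m+3), so the time bound holds even without a logarithm. Each piece of the
word RAM program is verified by a weakest-precondition calculus with explicit step counts. -/

/-! ### Weakest preconditions for the word RAM. -/

/-- `P` halts from `s`, after `t` steps in a state `s'` such that `Q t s'`. -/
def WP (B : ℕ) (P : Program) (s : State) (Q : ℕ → State → Prop) : Prop :=
  ∃ t s', Run B P s t s' ∧ Q t s'

namespace State

@[simp] theorem var_setVar (s : State) (x v y : ℕ) :
    (s.setVar x v).var y = if y = x then v else s.var y := by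
  simp [setVar, Function.update_apply]

@[simp] theorem arr_setVar (s : State) (x v a : ℕ) : (s.setVar x v).arr a = s.arr a := rfl

@[simp] theorem var_setArr (s : State) (a i v y : ℕ) : (s.setArr a i v).var y = s.var y := rfl

theorem arr_setArr (s : State) (a i v c : ℕ) :
    (s.setArr a i v).arr c = if c = a then Function.update (s.arr a) i v else s.arr c := by
  simp only [setArr, Function.update_apply]

theorem arr_setArr_same (s : State) (a i v : ℕ) :
    (s.setArr a i v).arr a = Function.update (s.arr a) i v := by
  simp [arr_setArr]

theorem arr_setArr_of_ne (s : State) {a c : ℕ} (i v : ℕ) (h : c ≠ a) :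
    (s.setArr a i v).arr c = s.arr c := by
  simp [arr_setArr, h]

end State

theorem WP.mono {B : ℕ} {P : Program} {s : State} {Q R : ℕ → State → Prop}
    (h : WP B P s Q) (hQR : ∀ t s', Q t s' → R t s') : WP B P s R := by
  obtain ⟨t, s', hr, hq⟩ := h
  exact ⟨t, s', hr, hQR _ _ hq⟩

theorem wp_skip {B : ℕ} {s : State} {Q : ℕ → State → Prop} :
    WP B .skip s Q ↔ Q 1 s := by
  constructor
  · rintro ⟨t, s', hr, hq⟩
    cases hr
    exact hq
  · exact fun h => ⟨_, _, .skip s, h⟩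

theorem wp_assign {B x : ℕ} {e : Expr} {s : State} {Q : ℕ → State → Prop} :
    WP B (.assign x e) s Q ↔ e.Fits B s ∧ Q (e.cost + 1) (s.setVar x (e.val s)) := by
  constructor
  · rintro ⟨t, s', hr, hq⟩
    cases hr with
    | assign _ _ _ he => exact ⟨he, hq⟩
  · exact fun h => ⟨_, _, .assign x e s h.1, h.2⟩

theorem wp_store {B a : ℕ} {i e : Expr} {s : State} {Q : ℕ → State → Prop} :
    WP B (.store a i e) s Q ↔
      i.Fits B s ∧ e.Fits B s ∧ Q (i.cost + e.cost + 1) (s.setArr a (i.val s) (e.val s)) := by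
  constructor
  · rintro ⟨t, s', hr, hq⟩
    cases hr with
    | store _ _ _ _ hi he => exact ⟨hi, he, hq⟩
  · exact fun h => ⟨_, _, .store a i e s h.1 h.2.1, h.2.2⟩

theorem wp_seq {B : ℕ} {P P' : Program} {s : State} {Q : ℕ → State → Prop} :
    WP B (.seq P P') s Q ↔
      WP B P s (fun t s' => WP B P' s' (fun t' s'' => Q (t + t' + 1) s'')) := by
  constructor
  · rintro ⟨t, s', hr, hq⟩
    cases hr with
    | seq h1 h2 => exact ⟨_, _, h1, _, _, h2, hq⟩
  · rintro ⟨t, s', h1, t', s'', h2, hq⟩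
    exact ⟨_, _, .seq h1 h2, hq⟩

theorem wp_ite {B : ℕ} {e : Expr} {P P' : Program} {s : State} {Q : ℕ → State → Prop} :
    WP B (.ite e P P') s Q ↔
      e.Fits B s ∧ (e.val s ≠ 0 → WP B P s (fun t s' => Q (e.cost + t + 1) s')) ∧
        (e.val s = 0 → WP B P' s (fun t s' => Q (e.cost + t + 1) s')) := by
  constructor
  · rintro ⟨t, s', hr, hq⟩
    cases hr with
    | ite_true he h h1 => exact ⟨he, fun _ => ⟨_, _, h1, hq⟩, fun h' => absurd h' h⟩
    | ite_false he h h1 => exact ⟨he, fun h' => absurd h h', fun _ => ⟨_, _, h1, hq⟩⟩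
  · rintro ⟨he, h1, h2⟩
    by_cases h : e.val s = 0
    · obtain ⟨t, s', hr, hq⟩ := h2 h
      exact ⟨_, _, .ite_false he h hr, hq⟩
    · obtain ⟨t, s', hr, hq⟩ := h1 h
      exact ⟨_, _, .ite_true he h hr, hq⟩

/-! ### Frames -/

/-- The variables a program may write. -/
def Program.wv : Program → List ℕ
  | skip => []
  | assign x _ => [x]
  | store _ _ _ => []
  | seq P Q => P.wv ++ Q.wv
  | ite _ P Q => P.wv ++ Q.wv
  | loop _ P => P.wv

/-- The arrays a program may write. -/
def Program.wa : Program → List ℕ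
  | skip => []
  | assign _ _ => []
  | store a _ _ => [a]
  | seq P Q => P.wa ++ Q.wa
  | ite _ P Q => P.wa ++ Q.wa
  | loop _ P => P.wa

/-- The states agree except on the variables in `V` and the arrays in `A`. -/
structure Frame (V A : List ℕ) (s s' : State) : Prop where
  var : ∀ x, x ∉ V → s'.var x = s.var x
  arr : ∀ a, a ∉ A → s'.arr a = s.arr a

theorem Frame.refl (V A : List ℕ) (s : State) : Frame V A s s := ⟨fun _ _ => rfl, fun _ _ => rfl⟩

theorem Frame.trans {V A : List ℕ} {s s' s'' : State} (h : Frame V A s s') (h' : Frame V A s' s'') :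
    Frame V A s s'' :=
  ⟨fun x hx => (h'.var x hx).trans (h.var x hx), fun a ha => (h'.arr a ha).trans (h.arr a ha)⟩

theorem Frame.mono {V A V' A' : List ℕ} {s s' : State} (h : Frame V A s s') (hV : V ⊆ V')
    (hA : A ⊆ A') : Frame V' A' s s' :=
  ⟨fun x hx => h.var x fun h' => hx (hV h'), fun a ha => h.arr a fun h' => ha (hA h')⟩

theorem Run.frame {B : ℕ} {P : Program} {s s' : State} {t : ℕ} (h : Run B P s t s') :
    Frame P.wv P.wa s s' := by
  induction h with
  | skip s => exact .refl _ _ _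
  | assign x e s he =>
    exact ⟨fun y hy => by
      have : y ≠ x := by simpa [Program.wv] using hy
      simp [this], fun a _ => rfl⟩
  | store a i e s hi he =>
    exact ⟨fun y _ => rfl, fun c hc => by
      have : c ≠ a := by simpa [Program.wa] using hc
      exact State.arr_setArr_of_ne _ _ _ this⟩
  | seq _ _ h1 h2 =>
    exact (h1.mono (by simp [Program.wv]) (by simp [Program.wa])).trans
      (h2.mono (by simp [Program.wv]) (by simp [Program.wa]))
  | ite_true _ _ _ h1 => exact h1.mono (by simp [Program.wv]) (by simp [Program.wa])
  | ite_false _ _ _ h1 => exact h1.mono (by simp [Program.wv]) (by simp [Program.wa])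
  | loop_done _ _ => exact .refl _ _ _
  | loop_step _ _ _ _ h1 h2 => exact h1.trans h2

theorem WP.frame {B : ℕ} {P : Program} {s : State} {Q : ℕ → State → Prop} (h : WP B P s Q) :
    WP B P s (fun t s' => Q t s' ∧ Frame P.wv P.wa s s') := by
  obtain ⟨t, s', hr, hq⟩ := h
  exact ⟨t, s', hr, hq, hr.frame⟩

/-! ### Counting loops -/

/-- Run `P` for `x = 0, ..., e - 1`. -/
def forLoop (x : ℕ) (e : Expr) (P : Program) : Program :=
  .seq (.assign x (.const 0))
    (.loop (.sub e (.var x)) (.seq P (.assign x (.add (.var x) (.const 1)))))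

/-- Frames are taken against the fixed state `s₀`, so whatever the body does not write keeps its
initial value in every round, in particular the bound `e`. The body must establish the invariant for
the state in which the counter is already increased, since that is where the next round starts. -/
theorem wp_loop_count {B x N T : ℕ} {e : Expr} {P : Program} {s₀ : State}
    (I : ℕ → State → Prop) (hN : N < B)
    (hx : x ∉ P.wv)
    (he : ∀ s', Frame (x :: P.wv) P.wa s₀ s' → e.val s' = N ∧ e.Fits B s')
    (body : ∀ i < N, ∀ s', Frame (x :: P.wv) P.wa s₀ s' → s'.var x = i → I i s' →
      WP B P s' (fun t s'' => t ≤ T ∧ I (i + 1) (s''.setVar x (i + 1))))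
    (d : ℕ) : ∀ i s, i + d = N → Frame (x :: P.wv) P.wa s₀ s → s.var x = i → I i s →
      WP B (.loop (.sub e (.var x)) (.seq P (.assign x (.add (.var x) (.const 1))))) s
        (fun t s' => t ≤ d * (T + e.cost + 9) + e.cost + 4 ∧ I N s' ∧
          Frame (x :: P.wv) P.wa s₀ s') := by
  induction d with
  | zero =>
    intro i s hi hF hxi hI
    obtain rfl : i = N := by omega
    refine ⟨_, s, .loop_done ⟨(he s hF).2, by simpa [Expr.Fits, hxi]⟩ ?_, ?_, hI, hF⟩
    · simp [Expr.val, (he s hF).1, hxi]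
    · simp [Expr.cost]
  | succ d ih =>
    intro i s hi hF hxi hI
    obtain ⟨t, s', hr, ⟨ht, hI'⟩, hF'⟩ := (body i (by omega) s hF hxi hI).frame
    have hx' : s'.var x = i := by rw [hF'.var x hx, hxi]
    have hF1 : Frame (x :: P.wv) P.wa s₀ s' := hF.trans (hF'.mono (by simp) (by simp))
    have hF2 : Frame (x :: P.wv) P.wa s₀ (s'.setVar x (i + 1)) :=
      hF1.trans ⟨fun y hy => by
        have : y ≠ x := by simp at hy; exact hy.1
        simp [this], fun a _ => rfl⟩
    obtain ⟨t2, s2, hr2, ht2, hI2, hFF⟩ := ih (i + 1) (s'.setVar x (i + 1)) (by omega) hF2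
      (by simp) hI'
    have h1 : Run B (.assign x (.add (.var x) (.const 1))) s' 4 (s'.setVar x (i + 1)) := by
      have := Run.assign (B := B) x (.add (.var x) (.const 1)) s'
        (by simp only [Expr.Fits, Expr.val, hx']; omega)
      simpa [Expr.val, hx', Expr.cost] using this
    refine ⟨_, s2, .loop_step ⟨(he s hF).2, ?_⟩ ?_ (.seq hr h1) hr2, ?_, hI2, hFF⟩
    · simp only [Expr.Fits, hxi]; omega
    · simp only [Expr.val, (he s hF).1, hxi]; omega
    · simp only [Expr.cost]
      rw [Nat.succ_mul]
      omega

theorem wp_forLoop {B x T : ℕ} (N : ℕ) {e : Expr} {P : Program} {s : State}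
    (I : ℕ → State → Prop) (hN : N < B)
    (hx : x ∉ P.wv)
    (he : ∀ s', Frame (x :: P.wv) P.wa s s' → e.val s' = N ∧ e.Fits B s')
    (h0 : I 0 (s.setVar x 0))
    (body : ∀ i < N, ∀ s', Frame (x :: P.wv) P.wa s s' → s'.var x = i → I i s' →
      WP B P s' (fun t s'' => t ≤ T ∧ I (i + 1) (s''.setVar x (i + 1)))) :
    WP B (forLoop x e P) s (fun t s' => t ≤ N * (T + e.cost + 9) + e.cost + 7 ∧ I N s' ∧
      Frame (x :: P.wv) P.wa s s') := by
  rw [forLoop, wp_seq, wp_assign]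
  refine ⟨by simp only [Expr.Fits]; omega, ?_⟩
  have hF : Frame (x :: P.wv) P.wa s (s.setVar x 0) := ⟨fun y hy => by
        have : y ≠ x := by simp at hy; exact hy.1
        simp [this], fun a _ => rfl⟩
  refine (wp_loop_count (T := T) I hN hx he body N 0 (s.setVar x 0) (by omega) hF
    (by simp) h0).mono ?_
  rintro t s' ⟨ht, hI, hF⟩
  exact ⟨by simp only [Expr.cost]; omega, hI, hF⟩

open Finset

/-! ### Optimal schedules near a balanced greedy schedule -/

section Proximity

/-- A closed walk may repeat points, so genuine cycles have to be extracted from it. Choose a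
successor for every point that lies on a path from `v` to `u`, closing up at `u`. The resulting
self-map permutes its periodic points there, and `π` is this permutation extended by the identity.
-/
theorem exists_perm_of_cycle {α : Type*} [Finite α] {R : α → α → Prop} (hR : ∀ x, ¬ R x x)
    {u v : α} (huv : R u v) (hvu : Relation.ReflTransGen R v u) :
    ∃ π : Equiv.Perm α, (∃ x, π x ≠ x) ∧ ∀ x, π x ≠ x → R x (π x) := by
  classical
  let S : Set α := {x | Relation.ReflTransGen R v x ∧ Relation.ReflTransGen R x u}
  have hS : ∀ x : α, ∃ y, x ∈ S → R x y ∧ y ∈ S := by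
    intro x
    by_cases hx : x ∈ S
    · rcases Relation.ReflTransGen.cases_head hx.2 with h | ⟨y, hxy, hyu⟩
      · subst h
        exact ⟨v, fun _ => ⟨huv, .refl, hvu⟩⟩
      · exact ⟨y, fun _ => ⟨hxy, hx.1.tail hxy, hyu⟩⟩
    · exact ⟨x, fun h => absurd h hx⟩
  choose f hf using hS
  have hfS : ∀ k, f^[k] v ∈ S := by
    intro k
    induction k with
    | zero => exact ⟨.refl, hvu⟩
    | succ k ih => rw [Function.iterate_succ_apply']; exact (hf _ ih).2
  let C : Set α := S ∩ Function.periodicPts f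
  have hC : ∀ x ∈ C, f x ∈ C := fun x hx =>
    ⟨(hf x hx.1).2, (Function.bijOn_periodicPts f).mapsTo hx.2⟩
  have hinj : Function.Injective (fun x => if x ∈ C then f x else x) := by
    intro x y hxy
    by_cases hx : x ∈ C <;> by_cases hy : y ∈ C <;> simp only [hx, hy, if_true, if_false] at hxy
    · exact (Function.bijOn_periodicPts f).injOn hx.2 hy.2 hxy
    · exact absurd (hxy ▸ hC x hx) hy
    · exact absurd (hxy ▸ hC y hy) hx
    · exact hxy
  refine ⟨Equiv.ofBijective _ (Finite.injective_iff_bijective.1 hinj), ?_, ?_⟩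
  -- By finiteness two iterates of `v` coincide, so the earlier one is periodic; it is moved because
  -- `R` is irreflexive.
  · obtain ⟨a, b, hab, h⟩ := Finite.exists_ne_map_eq_of_infinite (fun k : ℕ => f^[k] v)
    wlog hlt : a < b generalizing a b
    · exact this b a hab.symm h.symm (by omega)
    refine ⟨f^[a] v, ?_⟩
    have hmem : f^[a] v ∈ C := by
      refine ⟨hfS a, Function.mk_mem_periodicPts (n := b - a) (by omega) ?_⟩
      rw [Function.IsPeriodicPt, Function.IsFixedPt, ← Function.iterate_add_apply,
        Nat.sub_add_cancel hlt.le]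
      exact h.symm
    simp only [Equiv.ofBijective_apply, hmem, if_true]
    intro h
    have := (hf _ hmem.1).1
    rw [h] at this
    exact hR _ this
  · intro x hx
    simp only [Equiv.ofBijective_apply] at hx ⊢
    by_cases h : x ∈ C
    · simp only [h, if_true]
      exact (hf _ h.1).1
    · simp [h] at hx

/-! ### Exchange arguments for schedules nearest to the guide. -/

variable {ι α : Type*} [Fintype ι] [DecidableEq ι] [DecidableEq α]

/-- The total of `q` over the jobs that `σ` maps to `o`. -/
def tot (q : ι → ℕ) (σ : ι → Option α) (o : Option α) : ℕ := ∑ j with σ j = o, q j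

/-- Only the jobs of `U` can change a total. The relation is written additively because subtraction
of natural numbers truncates. -/
theorem tot_patch (q : ι → ℕ) {σ τ : ι → Option α} (U : Finset ι) (h : ∀ j ∉ U, τ j = σ j)
    (o : Option α) :
    tot q τ o + ∑ j ∈ U with σ j = o, q j = tot q σ o + ∑ j ∈ U with τ j = o, q j := by
  have key : ∀ ρ : ι → Option α, tot q ρ o =
      ∑ j ∈ U with ρ j = o, q j + ∑ j ∈ Uᶜ with ρ j = o, q j := by
    intro ρ
    rw [tot, ← sum_union]
    · congr 1
      ext j
      simp only [mem_filter, mem_univ, true_and, mem_union, mem_compl]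
      tauto
    · rw [disjoint_left]
      intro j h1 h2
      simp only [mem_filter, mem_compl] at h1 h2
      exact h2.1 h1.1
  have : ∑ j ∈ Uᶜ with σ j = o, q j = ∑ j ∈ Uᶜ with τ j = o, q j := by
    congr 1
    ext j
    simp only [mem_filter, mem_compl]
    constructor
    · rintro ⟨h1, h2⟩; exact ⟨h1, (h j h1).trans h2⟩
    · rintro ⟨h1, h2⟩; exact ⟨h1, (h j h1).symm.trans h2⟩
  rw [key τ, key σ]
  omega

/-- A schedule that rejects jobs greedily by the ratio of size and weight and balances the
loads of the machines up to the size of one job. -/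
structure IsGuide (p w : ι → ℕ) (W M : ℕ) (c : α → ℕ) (G : ι → Option α) : Prop where
  zero : ∀ j, p j = 0 → G j ≠ none
  pos : ∀ j, G j ≠ none → 0 < p j → 0 < w j
  ratio : ∀ j k, G j = none → G k ≠ none → 0 < p k → p k * w j ≤ p j * w k
  feasible : tot w G none ≤ W
  full : ∀ j, G j ≠ none → 0 < p j → W ≤ tot w G none + M
  balanced : ∀ i k, c k * tot p G (some k) ≤ c i * (tot p G (some i) + M)

/-- Among the feasible schedules with no larger loads, `s` is nearest to `G`. -/
def IsNearest (p w : ι → ℕ) (W : ℕ) (G s : ι → Option α) : Prop :=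
  ∀ τ : ι → Option α, tot w τ none ≤ W → (∀ i, tot p τ (some i) ≤ tot p s (some i)) →
    #{j | s j ≠ G j} ≤ #{j | τ j ≠ G j}

variable {p w : ι → ℕ} {W M : ℕ} {c : α → ℕ} {G s : ι → Option α}

/-- The descent principle behind every exchange: an admissible schedule whose set of disagreements
with `G` is strictly smaller cannot exist. -/
theorem IsNearest.false_of_nearer (hs : IsNearest p w W G s) (τ : ι → Option α)
    (h1 : tot w τ none ≤ W) (h2 : ∀ i, tot p τ (some i) ≤ tot p s (some i))
    (h3 : ∀ j, τ j ≠ G j → s j ≠ G j) (h4 : ∃ j, s j ≠ G j ∧ τ j = G j) : False := by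
  refine absurd (hs τ h1 h2) (not_le.2 (card_lt_card ?_))
  rw [ssubset_iff_of_subset (fun j hj => by simpa using h3 j (by simpa using hj))]
  obtain ⟨j, hj, hj'⟩ := h4
  exact ⟨j, by simpa using hj, by simpa using hj'⟩

/-- The guide runs every job of size zero, so giving such a job the choice of the guide changes no
load and adds no rejected weight. Disagreements therefore only involve jobs of positive size. -/
theorem IsNearest.pos (hs : IsNearest p w W G s) (hG : ∀ j, p j = 0 → G j ≠ none)
    (hW : tot w s none ≤ W) {j : ι} (hj : s j ≠ G j) : 0 < p j := by
  by_contra h0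
  have h0 : p j = 0 := by omega
  have hpatch : ∀ k ∉ ({j} : Finset ι), Function.update s j (G j) k = s k := fun k hk =>
    Function.update_of_ne (by simpa using hk) _ _
  refine hs.false_of_nearer (Function.update s j (G j)) ?_ ?_ ?_ ⟨j, hj, by simp⟩
  · have := tot_patch w _ hpatch none
    have h1 : ∑ k ∈ ({j} : Finset ι) with Function.update s j (G j) k = none, w k = 0 := by
      apply sum_eq_zero
      intro k hk
      simp only [mem_filter, mem_singleton] at hk
      obtain ⟨rfl, hk⟩ := hk
      simp [hG _ h0] at hk
    omega
  · intro i
    have := tot_patch p _ hpatch (some i)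
    have h1 : ∑ k ∈ ({j} : Finset ι) with Function.update s j (G j) k = some i, p k = 0 := by
      apply sum_eq_zero
      intro k hk
      simp only [mem_filter, mem_singleton] at hk
      rw [hk.1, h0]
    omega
  · intro k hk
    by_cases hkj : k = j
    · subst hkj; exact hj
    · simpa [hkj] using hk

/-- Reject `A` and let `B` take its place on machine `i`. The weight inequality preserves
feasibility and the size inequality the load of `i`. The jobs of `A` now agree with `G`; those of
`B` disagreed before, so nothing is lost wherever the guide wants them. -/
theorem IsNearest.no_swap (hs : IsNearest p w W G s) (hW : tot w s none ≤ W) {i : α}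
    {A B : Finset ι} (hA : ∀ j ∈ A, G j = none ∧ s j = some i)
    (hB : ∀ j ∈ B, G j ≠ none ∧ s j = none) (hne : A.Nonempty)
    (hw : ∑ j ∈ A, w j ≤ ∑ j ∈ B, w j) (hp : ∑ j ∈ B, p j ≤ ∑ j ∈ A, p j) : False := by
  have hAB : ∀ j, j ∈ B → j ∉ A := fun j hj hj' => (hB j hj).1 (hA j hj').1
  let τ : ι → Option α := fun j => if j ∈ A then none else if j ∈ B then some i else s j
  have hpatch : ∀ k ∉ A ∪ B, τ k = s k := fun k hk => by
    simp only [mem_union, not_or] at hk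
    simp [τ, hk.1, hk.2]
  have e1 : ∀ q : ι → ℕ, ∑ j ∈ A ∪ B with τ j = none, q j = ∑ j ∈ A, q j := by
    intro q
    congr 1
    ext j
    simp only [mem_filter, mem_union, τ]
    by_cases h1 : j ∈ A <;> by_cases h2 : j ∈ B <;> simp [h1, h2]
  have e2 : ∀ q : ι → ℕ, ∑ j ∈ A ∪ B with s j = none, q j = ∑ j ∈ B, q j := by
    intro q
    congr 1
    ext j
    simp only [mem_filter, mem_union]
    constructor
    · rintro ⟨h | h, h'⟩
      · simp [(hA j h).2] at h'
      · exact h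
    · exact fun h => ⟨.inr h, (hB j h).2⟩
  refine hs.false_of_nearer τ ?_ ?_ ?_ ?_
  · have := tot_patch w _ hpatch none
    rw [e1, e2] at this
    omega
  · intro k
    have := tot_patch p _ hpatch (some k)
    by_cases hk : k = i
    · subst hk
      have e3 : ∑ j ∈ A ∪ B with τ j = some k, p j = ∑ j ∈ B, p j := by
        congr 1
        ext j
        simp only [mem_filter, mem_union, τ]
        by_cases h1 : j ∈ A <;> by_cases h2 : j ∈ B <;> simp [h1, h2]
        exact hAB j h2 h1
      have e4 : ∑ j ∈ A ∪ B with s j = some k, p j = ∑ j ∈ A, p j := by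
        congr 1
        ext j
        simp only [mem_filter, mem_union]
        constructor
        · rintro ⟨h | h, h'⟩
          · exact h
          · simp [(hB j h).2] at h'
        · exact fun h => ⟨.inl h, (hA j h).2⟩
      rw [e3, e4] at this
      omega
    · have e3 : ∑ j ∈ A ∪ B with τ j = some k, p j = 0 := by
        apply sum_eq_zero
        intro j hj
        simp only [mem_filter, mem_union, τ] at hj
        exfalso
        by_cases h1 : j ∈ A <;> by_cases h2 : j ∈ B <;> simp [h1, h2] at hj
        exact hk hj.symm
      omega
  · intro j hj
    by_cases h1 : j ∈ A
    · simp [(hA j h1).1, (hA j h1).2]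
    · by_cases h2 : j ∈ B
      · rw [(hB j h2).2]; exact (hB j h2).1.symm
      · simpa [τ, h1, h2] using hj
  · obtain ⟨j, hj⟩ := hne
    exact ⟨j, by simp [(hA j hj).1, (hA j hj).2], by simp [τ, hj, (hA j hj).1]⟩

variable [Fintype α]

/-- No cyclic exchange of equal volumes brings a nearest schedule closer. -/
theorem IsNearest.no_cycle (hs : IsNearest p w W G s) (hW : tot w s none ≤ W)
    (π : Equiv.Perm α) (hπ : ∃ x, π x ≠ x) (J : α → Finset ι) (V : ℕ) (hV : 0 < V)
    (hJ : ∀ u, ∀ j ∈ J u, G j = some u ∧ s j = some (π u))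
    (hvol : ∀ u, π u ≠ u → ∑ j ∈ J u, p j = V) : False := by
  let U : Finset ι := univ.biUnion J
  let τ : ι → Option α := fun j => if j ∈ U then G j else s j
  have hpatch : ∀ k ∉ U, τ k = s k := fun k hk => by simp [τ, hk]
  have hU : ∀ j, j ∈ U ↔ ∃ u, j ∈ J u := fun j => by simp [U]
  have e1 : ∀ i, ∑ j ∈ U with τ j = some i, p j = ∑ j ∈ J i, p j := by
    intro i
    congr 1
    ext j
    simp only [mem_filter, τ]
    constructor
    · rintro ⟨h, h'⟩
      obtain ⟨u, hu⟩ := (hU j).1 h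
      rw [if_pos h, (hJ u j hu).1] at h'
      obtain rfl := Option.some_inj.1 h'
      exact hu
    · intro h
      have := (hU j).2 ⟨i, h⟩
      exact ⟨this, by rw [if_pos this, (hJ i j h).1]⟩
  -- Machine `i` gives up the jobs that came from its predecessor under `π` and gets back those in
  -- `J i`, of the same volume unless `i` is fixed, when both sets coincide.
  have e2 : ∀ i, ∑ j ∈ U with s j = some i, p j = ∑ j ∈ J (π.symm i), p j := by
    intro i
    congr 1
    ext j
    simp only [mem_filter]
    constructor
    · rintro ⟨h, h'⟩
      obtain ⟨u, hu⟩ := (hU j).1 h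
      rw [(hJ u j hu).2] at h'
      obtain rfl := Option.some_inj.1 h'
      simpa using hu
    · intro h
      exact ⟨(hU j).2 ⟨_, h⟩, by rw [(hJ _ j h).2]; simp⟩
  have e3 : ∀ q : ι → ℕ, ∑ j ∈ U with τ j = none, q j = 0 := by
    intro q
    apply sum_eq_zero
    intro j hj
    simp only [mem_filter, τ] at hj
    obtain ⟨u, hu⟩ := (hU j).1 hj.1
    simp [hj.1, (hJ u j hu).1] at hj
  refine hs.false_of_nearer τ ?_ ?_ ?_ ?_
  · have := tot_patch w _ hpatch none
    rw [e3] at this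
    omega
  · intro i
    have := tot_patch p _ hpatch (some i)
    rw [e1, e2] at this
    by_cases hi : π i = i
    · have h2 : π.symm i = i := by rw [Equiv.symm_apply_eq, hi]
      rw [h2] at this
      omega
    · have h2 : π (π.symm i) ≠ π.symm i := by
        rw [Equiv.apply_symm_apply]
        intro h
        apply hi
        rw [Equiv.eq_symm_apply] at h
        exact h
      rw [hvol i hi, hvol _ h2] at this
      omega
  · intro j hj
    by_cases h : j ∈ U
    · simp [τ, h] at hj
    · simpa [τ, h] using hj
  · obtain ⟨u, hu⟩ := hπ
    have : (J u).Nonempty := by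
      by_contra h
      rw [not_nonempty_iff_eq_empty] at h
      have := hvol u hu
      rw [h] at this
      simp at this
      omega
    obtain ⟨j, hj⟩ := this
    refine ⟨j, ?_, ?_⟩
    · rw [(hJ u j hj).1, (hJ u j hj).2]
      simpa using hu
    · simp [τ, (hU j).2 ⟨u, hj⟩]

/-- Many jobs of one positive size that `G` runs on `u` are run on `v` by `s`. -/
def BigFlow (p : ι → ℕ) (M : ℕ) (G s : ι → Option α) (u v : α) : Prop :=
  u ≠ v ∧ ∃ x, 0 < x ∧ x ≤ M ∧
    M ^ Fintype.card α ≤ #{j | (G j = some u ∧ s j = some v) ∧ p j = x}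

/-- Let `x u` be the size that is frequent on the edge leaving `u`. The product V of all `x k` is a
common multiple of these sizes, and V / `x u` is at most M^m, the number of jobs that `BigFlow`
guarantees. So each edge of the cycle can send back exactly the volume V. -/
theorem IsNearest.no_bigFlow_cycle (hs : IsNearest p w W G s) (hW : tot w s none ≤ W)
    (hM : 0 < M) {u v : α} (huv : BigFlow p M G s u v)
    (hvu : Relation.ReflTransGen (BigFlow p M G s) v u) : False := by
  obtain ⟨π, hπ, hR⟩ := exists_perm_of_cycle (fun x h => h.1 rfl) huv hvu
  have hx : ∀ u, ∃ x, 0 < x ∧ x ≤ M ∧ (π u ≠ u →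
      M ^ Fintype.card α ≤ #{j | (G j = some u ∧ s j = some (π u)) ∧ p j = x}) := by
    intro u
    by_cases h : π u = u
    -- Fixed points of `π` get a dummy size, so that the product can run over all machines.
    · exact ⟨M, hM, le_rfl, fun h' => absurd h h'⟩
    · obtain ⟨-, x, h1, h2, h3⟩ := hR u h
      exact ⟨x, h1, h2, fun _ => h3⟩
  choose x hx0 hxM hxc using hx
  have hV : ∀ u, x u * ∏ k ∈ univ.erase u, x k = ∏ k, x k :=
    fun u => mul_prod_erase _ _ (mem_univ u)
  have hle : ∀ u, ∏ k ∈ univ.erase u, x k ≤ M ^ Fintype.card α := by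
    intro u
    calc ∏ k ∈ univ.erase u, x k ≤ ∏ k ∈ univ.erase u, M := prod_le_prod' fun k _ => hxM k
      _ = M ^ #(univ.erase u) := by simp
      _ ≤ M ^ Fintype.card α := Nat.pow_le_pow_right hM (card_le_univ _)
  have hJ : ∀ u, ∃ J : Finset ι, (∀ j ∈ J, G j = some u ∧ s j = some (π u)) ∧
      (π u ≠ u → ∑ j ∈ J, p j = ∏ k, x k) := by
    intro u
    by_cases h : π u = u
    · exact ⟨∅, by simp, fun h' => absurd h h'⟩
    · obtain ⟨J, hJ, hc⟩ := exists_subset_card_eq ((hle u).trans (hxc u h))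
      refine ⟨J, fun j hj => (by simpa using hJ hj : _ ∧ _).1, fun _ => ?_⟩
      rw [sum_congr rfl (fun j hj => (by simpa using hJ hj : _ ∧ p j = x u).2), sum_const, hc,
        smul_eq_mul, mul_comm, hV]
  choose J hJ1 hJ2 using hJ
  exact hs.no_cycle hW π hπ J _ (prod_pos fun k _ => hx0 k) hJ1 hJ2

/-! ### Volume bounds for the disagreements with the guide. -/

theorem sum_le_of_fibers (q : ι → ℕ) (D : Finset ι) (G s : ι → Option α) (K : ℕ)
    (h : ∀ o o', ∑ j ∈ D with G j = o ∧ s j = o', q j ≤ K) :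
    ∑ j ∈ D, q j ≤ (Fintype.card α + 1) ^ 2 * K := by
  rw [← sum_fiberwise_of_maps_to (t := (univ : Finset (Option α × Option α)))
    (g := fun j => (G j, s j)) (fun _ _ => mem_univ _)]
  refine (sum_le_card_nsmul _ _ K fun o _ => ?_).trans ?_
  · simpa only [Prod.ext_iff] using h o.1 o.2
  · simp [card_univ, sq]

/-- If both sets were large, the pigeonhole principle would give more than M newly accepted jobs of
one type (a, a') on one machine and more than M newly rejected jobs of one type (b, b'), where a
type consists of size and weight. Taking b' of the former and a' of the latter equalizes the
weights, and the ratio rule of the guide makes the volumes comparable in the direction that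
`no_swap` needs. -/
theorem IsNearest.exchange (hG : IsGuide p w W M c G) (hs : IsNearest p w W G s)
    (hW : tot w s none ≤ W) (hp : ∀ j, p j ≤ M) (hw : ∀ j, w j ≤ M) :
    #{j | G j = none ∧ s j ≠ none} ≤ (M + 1) ^ 2 * (Fintype.card α + 1) * M ∨
      #{j | G j ≠ none ∧ s j = none} ≤ (M + 1) ^ 2 * M := by
  by_contra! hcon
  obtain ⟨hA, hB⟩ := hcon
  have hcard : #(range (M + 1) ×ˢ range (M + 1)) = (M + 1) ^ 2 := by simp [sq]
  obtain ⟨⟨⟨a, a'⟩, o⟩, -, ha⟩ := exists_lt_card_fiber_of_mul_lt_card_of_maps_to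
    (s := {j | G j = none ∧ s j ≠ none})
    (t := (range (M + 1) ×ˢ range (M + 1)) ×ˢ (univ : Finset (Option α)))
    (f := fun j => ((p j, w j), s j)) (n := M)
    (fun j _ => by simp [Nat.lt_succ_of_le (hp j), Nat.lt_succ_of_le (hw j)])
    (by rw [card_product, hcard]; simpa [card_univ] using hA)
  obtain ⟨⟨b, b'⟩, -, hb⟩ := exists_lt_card_fiber_of_mul_lt_card_of_maps_to
    (s := {j | G j ≠ none ∧ s j = none})
    (t := (range (M + 1) ×ˢ range (M + 1)))
    (f := fun j => (p j, w j)) (n := M)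
    (fun j _ => by simp [Nat.lt_succ_of_le (hp j), Nat.lt_succ_of_le (hw j)])
    (by rw [hcard]; exact hB)
  simp only [filter_filter, Prod.mk.injEq] at ha hb
  obtain ⟨ja, hja⟩ : Finset.Nonempty _ := card_pos.1 (lt_of_le_of_lt (Nat.zero_le _) ha)
  obtain ⟨jb, hjb⟩ : Finset.Nonempty _ := card_pos.1 (lt_of_le_of_lt (Nat.zero_le _) hb)
  simp only [mem_filter, mem_univ, true_and] at hja hjb
  obtain ⟨⟨hja1, hja2⟩, ⟨rfl, rfl⟩, rfl⟩ := hja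
  obtain ⟨⟨hjb1, hjb2⟩, rfl, rfl⟩ := hjb
  obtain ⟨i, hi⟩ := Option.ne_none_iff_exists'.1 hja2
  have hpb : 0 < p jb := hs.pos hG.zero hW (by rw [hjb2]; exact hjb1.symm)
  have hwb : 0 < w jb := hG.pos jb hjb1 hpb
  have hr := hG.ratio ja jb hja1 hjb1 hpb
  -- Both groups have total weight `w ja * w jb`; weights are at most M, which is why classes of
  -- more than M jobs suffice.
  obtain ⟨A, hA1, hA2⟩ := exists_subset_card_eq ((hw jb).trans ha.le)
  obtain ⟨B, hB1, hB2⟩ := exists_subset_card_eq ((hw ja).trans hb.le)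
  have hA3 : ∀ j ∈ A, (G j = none ∧ s j = some i) ∧ p j = p ja ∧ w j = w ja := by
    intro j hj
    have := hA1 hj
    simp only [mem_filter, mem_univ, true_and, hi] at this
    tauto
  have hB3 : ∀ j ∈ B, (G j ≠ none ∧ s j = none) ∧ p j = p jb ∧ w j = w jb := by
    intro j hj
    have := hB1 hj
    simp only [mem_filter, mem_univ, true_and] at this
    tauto
  refine hs.no_swap hW (fun j hj => (hA3 j hj).1) (fun j hj => (hB3 j hj).1)
    (card_pos.1 (by omega)) ?_ ?_
  · rw [sum_congr rfl (fun j hj => (hA3 j hj).2.2), sum_congr rfl (fun j hj => (hB3 j hj).2.2),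
      sum_const, sum_const, hA2, hB2, smul_eq_mul, smul_eq_mul, mul_comm]
  · rw [sum_congr rfl (fun j hj => (hA3 j hj).2.1), sum_congr rfl (fun j hj => (hB3 j hj).2.1),
      sum_const, sum_const, hA2, hB2, smul_eq_mul, smul_eq_mul]
    linarith [mul_comm (w ja) (p jb), mul_comm (w jb) (p ja)]

/-- Conservation across a cut: jobs that both schedules place in `S` cancel, and only the flows out
of `S` and into `S` remain. -/
theorem tot_compare (q : ι → ℕ) (G s : ι → Option α) (S : Finset (Option α)) :
    ∑ o ∈ S, tot q s o + ∑ j with G j ∈ S ∧ s j ∉ S, q j =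
      ∑ o ∈ S, tot q G o + ∑ j with s j ∈ S ∧ G j ∉ S, q j := by
  have h : ∀ ρ : ι → Option α, ∑ o ∈ S, tot q ρ o = ∑ j with ρ j ∈ S, q j := by
    intro ρ
    rw [← sum_fiberwise_of_maps_to (s := {j | ρ j ∈ S}) (t := S) (g := ρ)
      (fun j hj => by simpa using hj)]
    refine sum_congr rfl fun o ho => ?_
    rw [tot]
    congr 1
    ext j
    simp only [mem_filter, mem_univ, true_and]
    exact ⟨fun h => ⟨h ▸ ho, h⟩, fun h => h.2⟩
  rw [h, h]
  have key : ∀ ρ τ : ι → Option α, ∑ j with ρ j ∈ S, q j =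
      ∑ j with ρ j ∈ S ∧ τ j ∈ S, q j + ∑ j with ρ j ∈ S ∧ τ j ∉ S, q j := by
    intro ρ τ
    rw [← sum_filter_add_sum_filter_not _ (fun j => τ j ∈ S), filter_filter, filter_filter]
  rw [key s G, key G s]
  have : ∑ j with s j ∈ S ∧ G j ∈ S, q j = ∑ j with G j ∈ S ∧ s j ∈ S, q j := by
    simp only [and_comm]
  omega

/-- If no positive size occurs M^m times on the edge from `u` to `v`, at most (M + 1) M^m jobs move
along it, by the pigeonhole principle over the possible sizes. Size zero is excluded by
`IsNearest.pos`. -/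
theorem IsNearest.flow_le (hG : ∀ j, p j = 0 → G j ≠ none) (hs : IsNearest p w W G s)
    (hW : tot w s none ≤ W) (hM : 0 < M) (hp : ∀ j, p j ≤ M) {u v : α} (huv : u ≠ v)
    (h : ¬ BigFlow p M G s u v) :
    ∑ j with G j = some u ∧ s j = some v, p j ≤ 2 * M ^ (Fintype.card α + 2) := by
  have hc : #{j | G j = some u ∧ s j = some v} ≤ (M + 1) * M ^ Fintype.card α := by
    by_contra! hc
    obtain ⟨x, hx, hxc⟩ := exists_lt_card_fiber_of_mul_lt_card_of_maps_to
      (s := {j | G j = some u ∧ s j = some v}) (t := range (M + 1)) (f := p)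
      (fun j _ => by simp [Nat.lt_succ_of_le (hp j)]) (by simpa using hc)
    rw [filter_filter] at hxc
    obtain ⟨j, hj⟩ : Finset.Nonempty _ := card_pos.1 (lt_of_le_of_lt (Nat.zero_le _) hxc)
    simp only [mem_filter, mem_univ, true_and] at hj
    refine h ⟨huv, x, ?_, Nat.lt_succ_iff.1 (mem_range.1 hx), hxc.le⟩
    rw [← hj.2]
    exact hs.pos hG hW (by simpa [hj.1.1, hj.1.2] using huv.symm)
  calc ∑ j with G j = some u ∧ s j = some v, p j
      ≤ #{j | G j = some u ∧ s j = some v} * M := sum_le_card_nsmul _ _ _ fun j _ => hp j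
    _ ≤ (M + 1) * M ^ Fintype.card α * M := by gcongr
    _ ≤ (M + M) * M ^ Fintype.card α * M := by gcongr; omega
    _ = 2 * M ^ (Fintype.card α + 2) := by ring

/-- A flow that is not big is bounded by `flow_le`. A big one enters a set of machines that no big
flow leaves, and the load of this set may exceed that in the guide by at most M per machine, so the
inflow is bounded by the outflow up to this slack. -/
theorem IsNearest.flow_le_of_rejected (hG : ∀ j, p j = 0 → G j ≠ none)
    (hs : IsNearest p w W G s) (hW : tot w s none ≤ W) (hM : 0 < M) (hp : ∀ j, p j ≤ M)
    (hL : ∀ i, tot p s (some i) ≤ tot p G (some i) + M) {u v : α} (huv : u ≠ v) :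
    ∑ j with G j = some u ∧ s j = some v, p j ≤
      (Fintype.card α + 1) ^ 2 * (2 * M ^ (Fintype.card α + 2) +
        ∑ j with G j ≠ none ∧ s j = none, p j) + Fintype.card α * M := by
  classical
  by_cases hbig : BigFlow p M G s u v
  swap
  · refine (hs.flow_le hG hW hM hp huv hbig).trans ?_
    nlinarith [Nat.zero_le (∑ j with G j ≠ none ∧ s j = none, p j),
      Nat.zero_le (Fintype.card α * M), Nat.zero_le (M ^ (Fintype.card α + 2)),
      Nat.zero_le (((Fintype.card α) ^ 2 + 2 * Fintype.card α) * (2 * M ^ (Fintype.card α + 2) +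
        ∑ j with G j ≠ none ∧ s j = none, p j))]
  -- The cut consists of the machines reachable from `v` by big flows. It misses `u`, since
  -- otherwise big flows would form a cycle.
  let S : Finset α := {x | Relation.ReflTransGen (BigFlow p M G s) v x}
  have hvS : v ∈ S := by simp [S, Relation.ReflTransGen.refl]
  have huS : u ∉ S := fun h => hs.no_bigFlow_cycle hW hM hbig (by simpa [S] using h)
  let S' : Finset (Option α) := S.map Function.Embedding.some
  have hS' : ∀ x, some x ∈ S' ↔ x ∈ S := fun x => by simp [S']
  have hnone : (none : Option α) ∉ S' := by simp [S']
  have hcmp := tot_compare p G s S'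
  have h1 : ∑ o ∈ S', tot p s o ≤ ∑ o ∈ S', tot p G o + Fintype.card α * M := by
    simp only [S', sum_map]
    calc ∑ x ∈ S, tot p s (some x) ≤ ∑ x ∈ S, (tot p G (some x) + M) :=
          sum_le_sum fun x _ => hL x
      _ = ∑ x ∈ S, tot p G (some x) + #S * M := by rw [sum_add_distrib]; simp
      _ ≤ _ := Nat.add_le_add_left (Nat.mul_le_mul_right _ (card_le_univ S)) _
  have h2 : ∑ j with G j ∈ S' ∧ s j ∉ S', p j ≤ (Fintype.card α + 1) ^ 2 *
      (2 * M ^ (Fintype.card α + 2) + ∑ j with G j ≠ none ∧ s j = none, p j) := by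
    refine sum_le_of_fibers p _ G s _ fun o o' => ?_
    rw [filter_filter]
    by_cases ho : o ∈ S' ∧ o' ∉ S'
    · obtain ⟨ho, ho'⟩ := ho
      obtain ⟨x, rfl⟩ : ∃ x, o = some x :=
        Option.ne_none_iff_exists'.1 fun h => hnone (h ▸ ho)
      cases o' with
      | none =>
        refine le_add_left (sum_le_sum_of_subset fun j hj => ?_)
        simp only [mem_filter, mem_univ, true_and] at hj ⊢
        exact ⟨by simp [hj.2.1], hj.2.2⟩
      | some y =>
        rw [hS'] at ho ho'
        have hxy : ¬ BigFlow p M G s x y := fun h => ho' (by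
          simp only [S, mem_filter, mem_univ, true_and] at ho ⊢
          exact ho.tail h)
        refine le_add_right (le_trans (sum_le_sum_of_subset fun j hj => ?_)
          (hs.flow_le hG hW hM hp (fun h : x = y => ho' (by rw [← h]; exact ho)) hxy))
        simp only [mem_filter, mem_univ, true_and] at hj ⊢
        exact hj.2
    · refine le_trans (le_of_eq (sum_eq_zero fun j hj => ?_)) (Nat.zero_le _)
      simp only [mem_filter, mem_univ, true_and] at hj
      obtain ⟨hj, rfl, rfl⟩ := hj
      exact absurd hj ho
  have h3 : ∑ j with G j = some u ∧ s j = some v, p j ≤ ∑ j with s j ∈ S' ∧ G j ∉ S', p j := by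
    refine sum_le_sum_of_subset fun j hj => ?_
    simp only [mem_filter, mem_univ, true_and] at hj ⊢
    rw [hj.1, hj.2, hS', hS']
    exact ⟨hvS, huS⟩
  omega

/-- By `exchange` one of the two sets is small. If few jobs are newly accepted, their weight is
small, and the newly rejected weight exceeds it by at most M because the guide nearly exhausts its
budget; weights there are at least 1, so few jobs are newly rejected. If few jobs are newly
rejected, conservation of the volume on all machines bounds the newly accepted volume. -/
theorem IsNearest.rejected_le (hG : IsGuide p w W M c G) (hs : IsNearest p w W G s)
    (hW : tot w s none ≤ W) (hM : 0 < M) (hα : 0 < Fintype.card α) (hp : ∀ j, p j ≤ M)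
    (hw : ∀ j, w j ≤ M) (hL : ∀ i, tot p s (some i) ≤ tot p G (some i) + M) :
    ∑ j with G j = none ∧ s j ≠ none, p j ≤ 9 * Fintype.card α * M ^ 5 ∧
      ∑ j with G j ≠ none ∧ s j = none, p j ≤ 9 * Fintype.card α * M ^ 5 := by
  set m := Fintype.card α
  set A : Finset ι := {j | G j = none ∧ s j ≠ none} with hA
  set B : Finset ι := {j | G j ≠ none ∧ s j = none} with hB
  have hpA : ∑ j ∈ A, p j ≤ #A * M := sum_le_card_nsmul _ _ _ fun j _ => hp j
  have hpB : ∑ j ∈ B, p j ≤ #B * M := sum_le_card_nsmul _ _ _ fun j _ => hp j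
  have hwA : ∑ j ∈ A, w j ≤ #A * M := sum_le_card_nsmul _ _ _ fun j _ => hw j
  have posA : ∀ j ∈ A, 1 ≤ p j := fun j hj => by
    simp only [hA, mem_filter, mem_univ, true_and] at hj
    exact hs.pos hG.zero hW (by rw [hj.1]; exact hj.2)
  have posB : ∀ j ∈ B, 1 ≤ p j := fun j hj => by
    simp only [hB, mem_filter, mem_univ, true_and] at hj
    exact hs.pos hG.zero hW (by rw [hj.2]; exact hj.1.symm)
  have hcA : #A ≤ ∑ j ∈ A, p j := by simpa using card_nsmul_le_sum _ _ 1 posA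
  have hcB : #B ≤ ∑ j ∈ B, w j := by
    have := card_nsmul_le_sum B w 1 fun j hj => by
      have h := posB j hj
      simp only [hB, mem_filter, mem_univ, true_and] at hj
      exact hG.pos j hj.1 h
    simpa using this
  have hM1 : (M + 1) ^ 2 ≤ 4 * M ^ 2 := by nlinarith
  have hpow : ∀ a ≤ 5, M ^ a ≤ M ^ 5 := fun a ha => Nat.pow_le_pow_right hM ha
  have hmM : ∀ a ≤ 5, M ^ a ≤ m * M ^ 5 := fun a ha => (hpow a ha).trans (Nat.le_mul_of_pos_left _ hα)
  have hmM' : ∀ a ≤ 5, m * M ^ a ≤ m * M ^ 5 := fun a ha => Nat.mul_le_mul_left _ (hpow a ha)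
  rcases hs.exchange hG hW hp hw with h | h
  · have h1 : #A ≤ 8 * (m * M ^ 3) :=
      calc #A ≤ (M + 1) ^ 2 * (m + 1) * M := h
        _ ≤ 4 * M ^ 2 * (m + m) * M := by gcongr; omega
        _ = _ := by ring
    have h2 : #A * M ≤ 8 * (m * M ^ 4) :=
      calc #A * M ≤ 8 * (m * M ^ 3) * M := by gcongr
        _ = _ := by ring
    have h3 : ∑ j ∈ B, w j ≤ 8 * (m * M ^ 4) + M := by
      rcases B.eq_empty_or_nonempty with hB0 | ⟨j, hj⟩
      · simp [hB0]
      -- A job of `B` is an accepted job of positive size, which is what the guide needs to certify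
      -- a nearly full budget.
      have hfull : W ≤ tot w G none + M := by
        have h := posB j hj
        simp only [hB, mem_filter, mem_univ, true_and] at hj
        exact hG.full j hj.1 h
      have := tot_compare w G s {none}
      simp only [sum_singleton, mem_singleton] at this
      have e : ∑ j with s j = none ∧ ¬ G j = none, w j = ∑ j ∈ B, w j := by
        rw [hB]; congr 1; ext j; simp [and_comm]
      rw [e] at this
      change tot w s none + ∑ j ∈ A, w j = _ at this
      omega
    have h4 : #B * M ≤ 8 * (m * M ^ 5) + m * M ^ 5 :=
      calc #B * M ≤ (8 * (m * M ^ 4) + M) * M := by gcongr; omega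
        _ = 8 * (m * M ^ 5) + M ^ 2 := by ring
        _ ≤ _ := by gcongr; exact hmM 2 (by norm_num)
    have := hmM' 4 (by norm_num)
    constructor <;> rw [mul_assoc] <;> omega
  · have h1 : #B * M ≤ 4 * M ^ 4 :=
      calc #B * M ≤ (M + 1) ^ 2 * M * M := by gcongr
        _ ≤ 4 * M ^ 2 * M * M := by gcongr
        _ = _ := by ring
    -- The total load of `s` exceeds that of the guide by at most `m * M`, so further accepted
    -- volume is paid for by newly rejected volume.
    have h2 : ∑ j ∈ A, p j ≤ ∑ j ∈ B, p j + m * M := by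
      have := tot_compare p G s (univ.map Function.Embedding.some)
      have e : ∑ o ∈ univ.map Function.Embedding.some, tot p s o ≤
          ∑ o ∈ univ.map Function.Embedding.some, tot p G o + m * M := by
        simp only [sum_map]
        calc ∑ x, tot p s (some x) ≤ ∑ x, (tot p G (some x) + M) := sum_le_sum fun x _ => hL x
          _ = _ := by rw [sum_add_distrib]; simp [m]
      have hmem : ∀ o : Option α, o ∈ univ.map Function.Embedding.some ↔ o ≠ none := by
        intro o; cases o <;> simp
      simp only [hmem, not_not] at this
      rw [show ∑ j with s j ≠ none ∧ G j = none, p j = ∑ j ∈ A, p j by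
        rw [hA]; simp only [and_comm]] at this
      change _ + ∑ j ∈ B, p j = _ at this
      omega
    have h3 := hmM 4 (by norm_num)
    have h4 := hmM' 1 (by norm_num)
    rw [pow_one] at h4
    constructor <;> rw [mul_assoc] <;> omega

/-- A feasible schedule with loads not much above those of the guide can be moved near the guide
without increasing any load. -/
theorem exists_near_guide (hG : IsGuide p w W M c G) (hM : 0 < M) (hα : 0 < Fintype.card α)
    (hp : ∀ j, p j ≤ M) (hw : ∀ j, w j ≤ M) (σ : ι → Option α) (hσ : tot w σ none ≤ W)
    (hL : ∀ i, tot p σ (some i) ≤ tot p G (some i) + M) :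
    ∃ s : ι → Option α, tot w s none ≤ W ∧ (∀ i, tot p s (some i) ≤ tot p σ (some i)) ∧
      ∑ j with s j ≠ G j, p j ≤ 180 * Fintype.card α ^ 5 * M ^ (Fintype.card α + 4) := by
  classical
  obtain ⟨s, hs, hmin⟩ := exists_min_image
    {s : ι → Option α | tot w s none ≤ W ∧ ∀ i, tot p s (some i) ≤ tot p σ (some i)}
    (fun s => #{j | s j ≠ G j}) ⟨σ, by simp [hσ]⟩
  simp only [mem_filter, mem_univ, true_and] at hs hmin
  refine ⟨s, hs.1, hs.2, ?_⟩
  have hnear : IsNearest p w W G s := fun τ h1 h2 => hmin τ ⟨h1, fun i => (h2 i).trans (hs.2 i)⟩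
  have hL' : ∀ i, tot p s (some i) ≤ tot p G (some i) + M := fun i => (hs.2 i).trans (hL i)
  obtain ⟨hA, hB⟩ := hnear.rejected_le hG hs.1 hM hα hp hw hL'
  set m := Fintype.card α
  have hpow : ∀ a ≤ m + 4, M ^ a ≤ M ^ (m + 4) := fun a ha => Nat.pow_le_pow_right hM ha
  have hm2 : (m + 1) ^ 2 ≤ 4 * m ^ 2 := by nlinarith
  have hX : 9 * m * M ^ 5 ≤ 9 * m * M ^ (m + 4) := Nat.mul_le_mul_left _ (hpow 5 (by omega))
  -- Since (m + 1)^2 is at most 4 m^2, the constant is 4 (2 + 9) + 1 = 45. Summing over pairs of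
  -- positions costs another 4 m^2, hence 180 m^5.
  have hK : (m + 1) ^ 2 * (2 * M ^ (m + 2) + 9 * m * M ^ 5) + m * M ≤
      45 * m ^ 3 * M ^ (m + 4) := by
    have h1 : m ≤ m ^ 3 := Nat.le_self_pow (by norm_num) m
    calc (m + 1) ^ 2 * (2 * M ^ (m + 2) + 9 * m * M ^ 5) + m * M
        ≤ 4 * m ^ 2 * (2 * m * M ^ (m + 4) + 9 * m * M ^ (m + 4)) + m ^ 3 * M ^ (m + 4) := by
          gcongr
          · exact Nat.le_mul_of_pos_right 2 hα
          · omega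
          · exact Nat.le_self_pow (by omega) M
      _ = _ := by ring
  have hfib : ∀ o o', ∑ j ∈ ({j | s j ≠ G j} : Finset ι) with G j = o ∧ s j = o', p j ≤
      45 * m ^ 3 * M ^ (m + 4) := by
    intro o o'
    rw [filter_filter]
    by_cases hoo : o = o'
    · refine le_trans (le_of_eq (sum_eq_zero fun j hj => ?_)) (Nat.zero_le _)
      simp only [mem_filter, mem_univ, true_and] at hj
      exact absurd (hj.2.2.trans (hoo.symm.trans hj.2.1.symm)) hj.1
    have hX2 : 9 * m * M ^ 5 ≤ 45 * m ^ 3 * M ^ (m + 4) := by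
      refine hX.trans (Nat.mul_le_mul_right _ ?_)
      have h1 : m ≤ m ^ 3 := Nat.le_self_pow (by norm_num) m
      omega
    cases o with
    | none =>
      refine le_trans (sum_le_sum_of_subset fun j hj => ?_) (hA.trans hX2)
      simp only [mem_filter, mem_univ, true_and] at hj ⊢
      exact ⟨hj.2.1, hj.2.1 ▸ hj.1⟩
    | some u =>
      cases o' with
      | none =>
        refine le_trans (sum_le_sum_of_subset fun j hj => ?_) (hB.trans hX2)
        simp only [mem_filter, mem_univ, true_and] at hj ⊢
        exact ⟨by simp [hj.2.1], hj.2.2⟩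
      | some v =>
        have huv : u ≠ v := fun h => hoo (by rw [h])
        refine le_trans (sum_le_sum_of_subset fun j hj => ?_)
          ((hnear.flow_le_of_rejected hG.zero hs.1 hM hp hL' huv).trans (le_trans ?_ hK))
        · simp only [mem_filter, mem_univ, true_and] at hj ⊢
          exact hj.2
        · gcongr
  calc ∑ j with s j ≠ G j, p j ≤ (m + 1) ^ 2 * (45 * m ^ 3 * M ^ (m + 4)) :=
        sum_le_of_fibers p _ G s _ hfib
    _ ≤ 4 * m ^ 2 * (45 * m ^ 3 * M ^ (m + 4)) := by gcongr
    _ = _ := by ring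

end Proximity

/-! ### Positional encoding of vectors of loads -/

/-- The number with the digits `d 0, ..., d (K - 1)` in base `b`. -/
def enc (b K : ℕ) (d : ℕ → ℕ) : ℕ := ∑ i ∈ range K, d i * b ^ i

theorem enc_lt {b K : ℕ} {d : ℕ → ℕ} (hd : ∀ i < K, d i < b) : enc b K d < b ^ K := by
  induction K with
  | zero => simp [enc]
  | succ K ih =>
    have h1 := ih fun i hi => hd i (by omega)
    have h2 : (d K + 1) * b ^ K ≤ b * b ^ K := Nat.mul_le_mul_right _ (hd K (by omega))
    rw [enc, sum_range_succ, ← enc, pow_succ]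
    linarith

theorem digit_enc {b K : ℕ} {d : ℕ → ℕ} (hd : ∀ i < K, d i < b) {i : ℕ} (hi : i < K) :
    enc b K d / b ^ i % b = d i := by
  induction K with
  | zero => omega
  | succ K ih =>
    have hb : 0 < b := lt_of_le_of_lt (Nat.zero_le _) (hd i hi)
    have hdK : ∀ i < K, d i < b := fun i hi => hd i (by omega)
    rw [enc, sum_range_succ, ← enc]
    rcases Nat.lt_succ_iff_lt_or_eq.1 hi with h | rfl
    · obtain ⟨e, rfl⟩ : ∃ e, K = i + 1 + e := ⟨K - i - 1, by omega⟩
      have : d (i + 1 + e) * b ^ (i + 1 + e) = b ^ i * (b * (d (i + 1 + e) * b ^ e)) := by ring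
      rw [this, Nat.add_mul_div_left _ _ (pow_pos hb i), Nat.add_mul_mod_self_left]
      exact ih hdK h
    · rw [Nat.add_mul_div_right _ _ (pow_pos hb i), Nat.div_eq_of_lt (enc_lt hdK), zero_add,
        Nat.mod_eq_of_lt (hd i (by omega))]

theorem enc_digit {b K x : ℕ} (hx : x < b ^ K) : enc b K (fun i => x / b ^ i % b) = x := by
  induction K generalizing x with
  | zero => simp at hx; simp [enc, hx]
  | succ K ih =>
    have hb : 0 < b := by
      rcases Nat.eq_zero_or_pos b with rfl | h
      · simp at hx
      · exact h
    have hmod : ∀ i < K, x / b ^ i % b = (x % b ^ K) / b ^ i % b := by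
      intro i hi
      obtain ⟨e, rfl⟩ : ∃ e, K = i + (e + 1) := ⟨K - i - 1, by omega⟩
      rw [pow_add, Nat.mod_mul_right_div_self, pow_succ, Nat.mod_mul_left_mod]
    rw [enc, sum_range_succ, sum_congr rfl fun i hi => by rw [hmod i (mem_range.1 hi)]]
    have := ih (Nat.mod_lt x (pow_pos hb K))
    rw [enc] at this
    rw [this, Nat.mod_eq_of_lt (a := x / b ^ K)
      (Nat.div_lt_of_lt_mul (by rw [← pow_succ]; exact hx)), mul_comm]
    exact Nat.mod_add_div x (b ^ K)

/-- The hypotheses exclude a borrow at `c` and a carry at `g`, so arithmetic on the number acts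
digit by digit. Adding before subtracting avoids truncation, and the statement also covers `c = g`.
-/
theorem digit_step {b K v c g x : ℕ} (hx : x < b ^ K) (hb : 0 < b) (hc : c < K) (hg : g < K)
    (h1 : v ≤ x / b ^ c % b) (h2 : x / b ^ g % b + v < b) :
    x + v * b ^ g - v * b ^ c < b ^ K ∧ v * b ^ c ≤ x + v * b ^ g ∧
      ∀ i < K, (x + v * b ^ g - v * b ^ c) / b ^ i % b =
        x / b ^ i % b + (if i = g then v else 0) - (if i = c then v else 0) := by
  set d' : ℕ → ℕ := fun i => x / b ^ i % b + (if i = g then v else 0) - (if i = c then v else 0)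
    with hd'
  have hlt : ∀ i < K, d' i < b := by
    intro i _
    have := Nat.mod_lt (x / b ^ i) hb
    simp only [hd']
    split_ifs with h h' <;> subst_vars <;> omega
  have hsingle : ∀ k < K, ∑ i ∈ range K, (if i = k then v else 0) * b ^ i = v * b ^ k := by
    intro k hk
    rw [sum_eq_single k (fun i _ hi => by simp [hi]) (fun h => absurd (mem_range.2 hk) h)]
    simp
  have key : enc b K d' + v * b ^ c = x + v * b ^ g := by
    conv_rhs => rw [← enc_digit hx]
    rw [enc, enc, ← hsingle c hc, ← hsingle g hg, ← sum_add_distrib, ← sum_add_distrib]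
    refine sum_congr rfl fun i _ => ?_
    rw [← add_mul, ← add_mul]
    congr 1
    simp only [hd']
    by_cases hic : i = c
    · subst hic
      split_ifs <;> omega
    · simp [hic]
  have e : x + v * b ^ g - v * b ^ c = enc b K d' := by omega
  rw [e]
  exact ⟨enc_lt hlt, by omega, fun i hi => digit_enc hlt hi⟩

/-! ### The dynamic program -/

/-- The total of `q` over the jobs before `j` that `f` maps to `c`. -/
def pre (q f : ℕ → ℕ) (c j : ℕ) : ℕ := ∑ k ∈ range j, if f k = c then q k else 0

@[simp] theorem pre_zero (q f : ℕ → ℕ) (c : ℕ) : pre q f c 0 = 0 := by simp [pre]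

theorem pre_succ (q f : ℕ → ℕ) (c j : ℕ) :
    pre q f c (j + 1) = pre q f c j + if f j = c then q j else 0 := by
  rw [pre, sum_range_succ, ← pre]

/-- The table of the dynamic program: `val j x` is one more than the largest budget that can be
left after the first `j` jobs, when the loads differ from those of the guide `g` by the digits of
`x` minus `h`; it is `0` if this is impossible. -/
structure IsTable (n K b h W : ℕ) (p w g : ℕ → ℕ) (val ch : ℕ → ℕ → ℕ) : Prop where
  init : ∀ x < b ^ K, val 0 x = if x = enc b K (fun _ => h) then W + 1 else 0
  le : ∀ l < n, ∀ x < b ^ K, ∀ c < K, p l ≤ x / b ^ c % b → x / b ^ g l % b + p l < b →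
    val l (x + p l * b ^ g l - p l * b ^ c) - (1 - c) * w l ≤ val (l + 1) x
  eq : ∀ l < n, ∀ x < b ^ K, val (l + 1) x ≠ 0 → ch (l + 1) x < K ∧
    p l ≤ x / b ^ ch (l + 1) x % b ∧ x / b ^ g l % b + p l < b ∧
    val (l + 1) x = val l (x + p l * b ^ g l - p l * b ^ ch (l + 1) x) - (1 - ch (l + 1) x) * w l

variable {n K b h W M : ℕ} {p w g : ℕ → ℕ} {val ch : ℕ → ℕ → ℕ}

/-- A schedule `f` near the guide traces a path through the window: job `j` raises the difference at
`f j` and lowers it at `g j`. The margin `M` in the prefix bounds is needed because the step to the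
previous state adds the size at the coordinate of the guide before it subtracts. The truncated
factor `1 - c` in the table charges the weight exactly when `c = 0`, that is, for a rejection. -/
theorem IsTable.complete (hT : IsTable n K b h W p w g val ch) (hb : b = 2 * h + 1)
    (hg : ∀ l < n, g l < K) (hp : ∀ l < n, p l ≤ M) {f : ℕ → ℕ} (hf : ∀ l < n, f l < K)
    (h1 : ∀ j ≤ n, ∀ i < K, pre p g i j + M ≤ h + pre p f i j)
    (h2 : ∀ j ≤ n, ∀ i < K, pre p f i j + M ≤ h + pre p g i j) {j : ℕ} (hj : j ≤ n) :
    W + 1 ≤ val j (enc b K fun i => h + pre p f i j - pre p g i j) + pre w f 0 j := by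
  have hlt : ∀ j ≤ n, ∀ i < K, h + pre p f i j - pre p g i j < b := by
    intro j hj i hi
    have := h1 j hj i hi
    have := h2 j hj i hi
    omega
  induction j with
  | zero =>
    rw [hT.init _ (enc_lt (hlt 0 hj))]
    simp
  | succ j ih =>
    set x := enc b K fun i => h + pre p f i (j + 1) - pre p g i (j + 1) with hx
    have hxlt : x < b ^ K := enc_lt (hlt _ hj)
    have hdig : ∀ i < K, x / b ^ i % b = h + pre p f i (j + 1) - pre p g i (j + 1) :=
      fun i hi => digit_enc (hlt _ hj) hi
    have hfj := hf j (by omega)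
    have hgj := hg j (by omega)
    have hpj := hp j (by omega)
    have hc1 : p j ≤ x / b ^ f j % b := by
      rw [hdig _ hfj]
      have := h1 _ hj _ hfj
      omega
    have hc2 : x / b ^ g j % b + p j < b := by
      rw [hdig _ hgj]
      have := h1 _ hj _ hgj
      have := h2 _ hj _ hgj
      omega
    obtain ⟨s1, s2, s3⟩ := digit_step hxlt (by omega) hfj hgj hc1 hc2
    have hstep : x + p j * b ^ g j - p j * b ^ f j =
        enc b K fun i => h + pre p f i j - pre p g i j := by
      rw [← enc_digit s1]
      refine sum_congr rfl fun i hi => ?_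
      have hi := mem_range.1 hi
      congr 1
      beta_reduce
      rw [s3 i hi, hdig i hi, pre_succ, pre_succ]
      have a1 := h1 _ hj _ hi
      have a2 := h1 j (by omega) _ hi
      rw [pre_succ, pre_succ] at a1
      simp only [eq_comm (a := i)]
      split_ifs at * <;> omega
    have hle := hT.le j (by omega) x hxlt _ hfj hc1 hc2
    rw [hstep] at hle
    have ih := ih (by omega)
    rw [pre_succ]
    rcases Nat.eq_zero_or_pos (f j) with h0 | h0
    · simp only [h0, if_true, Nat.sub_zero, one_mul] at hle ⊢
      omega
    · have h0' : f j ≠ 0 := by omega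
      have e : 1 - f j = 0 := by omega
      rw [e, zero_mul] at hle
      simp only [h0', if_false]
      omega

/-- Going down from the last layer, every visited entry is nonzero, so none of the truncated
subtractions has truncated. Going up again, budgets and digits therefore add up exactly. As entries
are budgets plus one, a nonzero final entry means that the rejected weight is at most `W`. -/
theorem IsTable.sound (hT : IsTable n K b h W p w g val ch) (hb : b = 2 * h + 1)
    (hg : ∀ l < n, g l < K) {X f : ℕ → ℕ}
    (hX : ∀ l < n, X l = X (l + 1) + p l * b ^ g l - p l * b ^ f l)
    (hf : ∀ l < n, f l = ch (l + 1) (X (l + 1))) (hn : X n < b ^ K) (hv : val n (X n) ≠ 0) :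
    (∀ l < n, f l < K) ∧ val n (X n) + pre w f 0 n = W + 1 ∧
      ∀ i < K, X n / b ^ i % b + pre p g i n = h + pre p f i n := by
  have down : ∀ d l, l + d = n → X l < b ^ K ∧ val l (X l) ≠ 0 := by
    intro d
    induction d with
    | zero => rintro l rfl; exact ⟨hn, hv⟩
    | succ d ih =>
      intro l hl
      obtain ⟨i1, i2⟩ := ih (l + 1) (by omega)
      obtain ⟨e1, e2, e3, e4⟩ := hT.eq l (by omega) _ i1 i2
      rw [← hf l (by omega)] at e1 e2 e4
      rw [← hX l (by omega)] at e4
      refine ⟨?_, by omega⟩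
      rw [hX l (by omega)]
      exact (digit_step i1 (by omega) e1 (hg l (by omega)) e2 e3).1
  have hlt : ∀ l ≤ n, X l < b ^ K ∧ val l (X l) ≠ 0 := fun l hl => down (n - l) l (by omega)
  refine ⟨fun l hl => ?_, ?_⟩
  · rw [hf l hl]
    exact (hT.eq l hl _ (hlt _ (by omega)).1 (hlt _ (by omega)).2).1
  have up : ∀ l ≤ n, val l (X l) + pre w f 0 l = W + 1 ∧
      ∀ i < K, X l / b ^ i % b + pre p g i l = h + pre p f i l := by
    intro l
    induction l with
    | zero =>
      intro hl
      obtain ⟨h1, h2⟩ := hlt 0 hl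
      have h3 := hT.init _ h1
      have h4 : X 0 = enc b K fun _ => h := by
        by_contra hne
        rw [if_neg hne] at h3
        exact h2 h3
      rw [if_pos h4] at h3
      refine ⟨by simp [h3], fun i hi => ?_⟩
      rw [h4, digit_enc (fun _ _ => by omega) hi]
      simp
    | succ l ih =>
      intro hl
      obtain ⟨i1, i2⟩ := ih (by omega)
      obtain ⟨h1, h2⟩ := hlt _ hl
      obtain ⟨e1, e2, e3, e4⟩ := hT.eq l (by omega) _ h1 h2
      rw [← hf l (by omega)] at e1 e2 e4
      rw [← hX l (by omega)] at e4
      obtain ⟨-, -, s3⟩ := digit_step h1 (by omega) e1 (hg l (by omega)) e2 e3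
      rw [← hX l (by omega)] at s3
      constructor
      · rw [pre_succ]
        rcases Nat.eq_zero_or_pos (f l) with h0 | h0
        · simp only [h0, if_true, Nat.sub_zero, one_mul] at e4 ⊢
          omega
        · have h0' : f l ≠ 0 := by omega
          have e : 1 - f l = 0 := by omega
          rw [e, zero_mul] at e4
          simp only [h0', if_false]
          omega
      · intro i hi
        have := s3 i hi
        have := i2 i hi
        rw [pre_succ, pre_succ]
        simp only [eq_comm (a := i)] at *
        by_cases hic : f l = i
        · subst hic
          split_ifs at * <;> omega
        · simp only [hic, if_false] at *
          omega
  exact up n le_rfl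

/-! ### The largest sum of size and weight -/

/-- The result in variable `2` serves all later programs as the common bound M on sizes and weights.
-/
def maxProg : Program :=
  forLoop 3 (.var 0)
    (.ite (.sub (.add (.get 0 (.var 3)) (.get 1 (.var 3))) (.var 2))
      (.assign 2 (.add (.get 0 (.var 3)) (.get 1 (.var 3)))) .skip)

theorem maxProg_spec {B n : ℕ} {s : State} (h0 : s.var 0 = n) (h2 : s.var 2 = 0) (hn : n < B)
    (hB : ∀ j < n, s.arr 0 j + s.arr 1 j < B) :
    WP B maxProg s (fun t s' => t ≤ 30 * n + 10 ∧
      s'.var 2 = (range n).sup (fun j => s.arr 0 j + s.arr 1 j) ∧ Frame [3, 2] [] s s') := by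
  refine (wp_forLoop (T := 15) n
    (fun i s' => s'.var 2 = (range i).sup (fun j => s.arr 0 j + s.arr 1 j))
    hn (by decide) ?_ ?_ ?_).mono ?_
  · intro s' hF
    have := hF.var 0 (by decide)
    simp only [Expr.val, Expr.Fits]
    omega
  · simpa using h2
  · intro i hi s' hF hx hI
    have e0 := hF.arr 0 (by decide)
    have e1 := hF.arr 1 (by decide)
    have hlt := hB i hi
    have hsup : (range i).sup (fun j => s.arr 0 j + s.arr 1 j) < B :=
      (Finset.sup_lt_iff (by simp; omega)).2 fun j hj => hB j (by simp at hj; omega)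
    simp only [wp_ite, wp_assign, wp_skip, Expr.val, Expr.Fits, Expr.cost, State.var_setVar, hx, hI,
      e0, e1, range_add_one, sup_insert, if_true]
    refine ⟨by omega, ?_, ?_⟩
    · intro h
      refine ⟨by omega, by omega, ?_⟩
      simp only [Nat.reduceEqDiff, if_false]
      exact (max_eq_left (by omega)).symm
    · intro h
      refine ⟨by omega, ?_⟩
      simp only [Nat.reduceEqDiff, if_false]
      exact (max_eq_right (by omega)).symm
  · rintro t s' ⟨ht, hI, hF⟩
    simp only [Expr.cost] at ht
    exact ⟨by omega, hI, hF⟩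

/-! ### Integral slownesses of the machines -/

/-- Multiplying the inverse speeds by the product of all numerators makes them integers and rescales
every makespan by the same factor. Positions are shifted by one, because index `0` stands for
rejection. -/
def slowProg (m : ℕ) : Program :=
  .seq (.assign 5 (.const 1)) (.seq
    (forLoop 4 (.const m) (.assign 5 (.mul (.var 5) (.get 2 (.var 4)))))
    (forLoop 4 (.const m) (.store 10 (.add (.var 4) (.const 1))
      (.mul (.div (.var 5) (.get 2 (.var 4))) (.get 3 (.var 4))))))

theorem slowProg_spec {B m N : ℕ} {s : State} (hN : 0 < N) (hB : N ^ (m + 1) < B) (hm : m + 1 < B)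
    (h2 : ∀ i < m, s.arr 2 i ≤ N) (h3 : ∀ i < m, s.arr 3 i ≤ N) :
    WP B (slowProg m) s (fun t s' => t ≤ 50 * m + 50 ∧
      (∀ i < m, s'.arr 10 (i + 1) = (∏ k ∈ range m, s.arr 2 k) / s.arr 2 i * s.arr 3 i) ∧
      Frame [5, 4] [10] s s') := by
  have hpow : ∀ a ≤ m + 1, N ^ a < B := fun a ha => (Nat.pow_le_pow_right hN ha).trans_lt hB
  have hNB : N < B := by simpa using hpow 1 (by omega)
  have hprod : ∀ i ≤ m, ∏ k ∈ range i, s.arr 2 k ≤ N ^ i := fun i hi =>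
    calc ∏ k ∈ range i, s.arr 2 k ≤ ∏ k ∈ range i, N :=
          prod_le_prod' fun k hk => h2 k (by simp at hk; omega)
      _ = N ^ i := by simp
  rw [slowProg, wp_seq, wp_assign]
  refine ⟨by simp only [Expr.Fits]; omega, ?_⟩
  rw [wp_seq]
  refine (wp_forLoop (T := 5) m (fun i s' => s'.var 5 = ∏ k ∈ range i, s.arr 2 k)
    (by omega) (by decide) ?_ ?_ ?_).mono ?_
  · intro s' hF
    simp only [Expr.val, Expr.Fits, true_and]
    omega
  · simp [Expr.val]
  · intro i hi s' hF hx hI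
    have e2 := hF.arr 2 (by decide)
    have := h2 i hi
    have l1 := (hprod i hi.le).trans_lt (hpow i (by omega))
    have l2 := (hprod (i + 1) hi).trans_lt (hpow (i + 1) (by omega))
    rw [prod_range_succ] at l2
    simp only [wp_assign, Expr.val, Expr.Fits, Expr.cost, State.var_setVar, hx, hI,
      e2, prod_range_succ, if_true, State.arr_setVar, Nat.reduceEqDiff, if_false, and_true]
    omega
  · rintro t s1 ⟨ht, hI, hF1⟩
    have f2 : s1.arr 2 = s.arr 2 := hF1.arr 2 (by decide)
    have f3 : s1.arr 3 = s.arr 3 := hF1.arr 3 (by decide)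
    refine (wp_forLoop (T := 12) m (fun i s' => ∀ k < i, s'.arr 10 (k + 1) =
      (∏ k ∈ range m, s.arr 2 k) / s.arr 2 k * s.arr 3 k) (by omega) (by decide) ?_ ?_ ?_).mono ?_
    · intro s' hF
      simp only [Expr.val, Expr.Fits, true_and]
      omega
    · intro k hk; omega
    · intro i hi s' hF hx hI2
      have e5 : s'.var 5 = _ := (hF.var 5 (by decide)).trans hI
      have e2 : s'.arr 2 = s.arr 2 := (hF.arr 2 (by decide)).trans f2
      have e3 : s'.arr 3 = s.arr 3 := (hF.arr 3 (by decide)).trans f3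
      have := h2 i hi
      have := h3 i hi
      have l1 := (hprod m le_rfl).trans_lt (hpow m (by omega))
      have l2 : (∏ k ∈ range m, s.arr 2 k) / s.arr 2 i * s.arr 3 i < B := by
        refine lt_of_le_of_lt ?_ hB
        rw [pow_succ]
        exact Nat.mul_le_mul ((Nat.div_le_self _ _).trans (hprod m le_rfl)) this
      simp only [wp_store, Expr.val, Expr.Fits, Expr.cost, hx, e2, e3, e5]
      refine ⟨by omega, by omega, by omega, ?_⟩
      intro k hk
      simp only [State.arr_setVar, State.arr_setArr_same, Function.update_apply]
      by_cases hki : k = i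
      · simp [hki]
      · rw [if_neg (by omega), hI2 k (by omega)]
    · rintro t' s' ⟨ht', hI', hF'⟩
      simp only [Expr.cost] at ht ht' ⊢
      refine ⟨by omega, hI', ?_⟩
      refine Frame.trans (Frame.trans ?_ (hF1.mono ?_ ?_)) (hF'.mono ?_ ?_)
      · exact ⟨fun y hy => by simp at hy ⊢; omega, fun a _ => rfl⟩
      all_goals decide

/-! ### The threshold ratio for the rejection -/

/-- Total weight of the jobs of positive size whose ratio of weight and size is below `u / v`. -/
def strictWeight (p w : ℕ → ℕ) (n v u : ℕ) : ℕ :=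
  ∑ j ∈ range n, if 0 < p j ∧ v * w j < p j * u then w j else 0

/-- Total weight of the jobs of positive size whose ratio of weight and size is `u / v`. -/
def equalWeight (p w : ℕ → ℕ) (n v u : ℕ) : ℕ :=
  ∑ j ∈ range n, if 0 < p j ∧ p j * u = v * w j then w j else 0

/-- The ratio is read from variables `11` over `10` and compared by cross multiplication. A
truncated difference tests strict inequality; if it vanishes in both directions, the ratios are
equal. -/
def ratioProg : Program :=
  .seq (.assign 8 (.const 0)) (.seq (.assign 9 (.const 0))
    (forLoop 3 (.var 0) (.ite (.get 0 (.var 3))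
      (.ite (.sub (.mul (.get 0 (.var 3)) (.var 11)) (.mul (.var 10) (.get 1 (.var 3))))
        (.assign 8 (.add (.var 8) (.get 1 (.var 3))))
        (.ite (.sub (.mul (.var 10) (.get 1 (.var 3))) (.mul (.get 0 (.var 3)) (.var 11)))
          .skip (.assign 9 (.add (.var 9) (.get 1 (.var 3))))))
      .skip)))

theorem ratioProg_spec {B n v u : ℕ} {s : State} (h0 : s.var 0 = n) (hv : s.var 10 = v)
    (hu : s.var 11 = u) (hn : n < B) (hvB : v < B) (huB : u < B) (hp : ∀ j < n, s.arr 0 j < B)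
    (hpu : ∀ j < n, s.arr 0 j * u < B) (hvw : ∀ j < n, v * s.arr 1 j < B)
    (hw : ∑ j ∈ range n, s.arr 1 j < B) :
    WP B ratioProg s (fun t s' => t ≤ 60 * n + 20 ∧
      s'.var 8 = strictWeight (s.arr 0) (s.arr 1) n v u ∧
      s'.var 9 = equalWeight (s.arr 0) (s.arr 1) n v u ∧ Frame [8, 9, 3] [] s s') := by
  have hwle : ∀ i ≤ n, ∑ j ∈ range i, s.arr 1 j ≤ ∑ j ∈ range n, s.arr 1 j := fun i hi =>
    sum_le_sum_of_subset (by simpa using hi)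
  have hS : ∀ i, strictWeight (s.arr 0) (s.arr 1) i v u ≤ ∑ j ∈ range i, s.arr 1 j := fun i =>
    sum_le_sum fun j _ => by split_ifs <;> omega
  have hE : ∀ i, equalWeight (s.arr 0) (s.arr 1) i v u ≤ ∑ j ∈ range i, s.arr 1 j := fun i =>
    sum_le_sum fun j _ => by split_ifs <;> omega
  rw [ratioProg, wp_seq, wp_assign]
  refine ⟨by simp only [Expr.Fits]; omega, ?_⟩
  rw [wp_seq, wp_assign]
  refine ⟨by simp only [Expr.Fits]; omega, ?_⟩
  refine (wp_forLoop (T := 35) n (fun i s' =>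
    s'.var 8 = strictWeight (s.arr 0) (s.arr 1) i v u ∧
    s'.var 9 = equalWeight (s.arr 0) (s.arr 1) i v u) hn (by decide) ?_ ?_ ?_).mono ?_
  · intro s' hF
    have := hF.var 0 (by decide)
    simp at this
    simp only [Expr.val, Expr.Fits]
    omega
  · simp [strictWeight, equalWeight, Expr.val]
  · rintro i hi s' hF hx ⟨hI8, hI9⟩
    have e0 : s'.arr 0 = s.arr 0 := hF.arr 0 (by decide)
    have e1 : s'.arr 1 = s.arr 1 := hF.arr 1 (by decide)
    have e10 : s'.var 10 = v := (hF.var 10 (by decide)).trans (by simpa using hv)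
    have e11 : s'.var 11 = u := (hF.var 11 (by decide)).trans (by simpa using hu)
    have b1 := hp i hi
    have b2 := hpu i hi
    have b3 := hvw i hi
    have b4 := hwle (i + 1) hi
    have b5 := hS i
    have b6 := hE i
    have s8 : strictWeight (s.arr 0) (s.arr 1) (i + 1) v u =
      strictWeight (s.arr 0) (s.arr 1) i v u +
        if 0 < s.arr 0 i ∧ v * s.arr 1 i < s.arr 0 i * u then s.arr 1 i else 0 := by
      rw [strictWeight, sum_range_succ, ← strictWeight]
    have s9 : equalWeight (s.arr 0) (s.arr 1) (i + 1) v u =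
      equalWeight (s.arr 0) (s.arr 1) i v u +
        if 0 < s.arr 0 i ∧ s.arr 0 i * u = v * s.arr 1 i then s.arr 1 i else 0 := by
      rw [equalWeight, sum_range_succ, ← equalWeight]
    rw [sum_range_succ] at b4
    simp only [wp_ite, wp_assign, wp_skip, Expr.val, Expr.Fits, Expr.cost, State.var_setVar, hx, hI8,
      hI9, e0, e1, e10, e11, s8, s9, if_true, Nat.reduceEqDiff, if_false]
    refine ⟨by omega, fun hp0 => ⟨by omega, fun h => ⟨by omega, by omega, ?_, ?_⟩,
      fun h => ⟨by omega, fun h' => ⟨by omega, ?_, ?_⟩, fun h' => ⟨by omega, by omega, ?_, ?_⟩⟩⟩,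
      fun hp0 => ⟨by omega, ?_, ?_⟩⟩
    all_goals split_ifs <;> omega
  · rintro t s' ⟨ht, ⟨hI8, hI9⟩, hF⟩
    simp only [Expr.cost] at ht ⊢
    refine ⟨by omega, hI8, hI9, ?_⟩
    refine Frame.trans ?_ (hF.mono (by decide) (by decide))
    exact ⟨fun y hy => by simp at hy ⊢; simp [hy], fun a _ => rfl⟩

/-- The jobs with ratio below `u / v` can be rejected, but not also all those with ratio `u / v`. -/
def IsThreshold (p w : ℕ → ℕ) (n W v u : ℕ) : Prop :=
  0 < v ∧ strictWeight p w n v u ≤ W ∧ W < strictWeight p w n v u + equalWeight p w n v u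

/-- Ratios of jobs of positive size have a denominator in 1, ..., M and a numerator in 0, ..., M, so
all such pairs are tried. The default pair with denominator `0` and numerator `1` acts as an
infinite ratio, below which every job of positive size lies. The last call recomputes the weight
below the chosen ratio. -/
def thresholdProg : Program :=
  .seq (.assign 6 (.const 0)) (.seq (.assign 7 (.const 1)) (.seq
    (forLoop 12 (.var 2) (.seq (.assign 10 (.add (.var 12) (.const 1)))
      (forLoop 11 (.add (.var 2) (.const 1)) (.seq ratioProg
        (.ite (.sub (.add (.var 8) (.var 9)) (.var 1))
          (.ite (.sub (.var 8) (.var 1)) .skip (.seq (.assign 6 (.var 10)) (.assign 7 (.var 11))))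
          .skip)))))
    (.seq (.assign 10 (.var 6)) (.seq (.assign 11 (.var 7)) ratioProg))))

theorem thresholdProg_spec {B n W M : ℕ} {s : State} (h0 : s.var 0 = n) (h1 : s.var 1 = W)
    (h2 : s.var 2 = M) (hM : 0 < M) (hn : n < B) (hWB : W < B) (hp : ∀ j < n, s.arr 0 j ≤ M)
    (hw : ∀ j < n, s.arr 1 j ≤ M) (hB : M * M < B) (hB' : M + 1 < B) (hB2 : 2 * (n * M) < B) :
    WP B thresholdProg s (fun t s' => t ≤ M * ((M + 1) * (60 * n + 70) + 50) + 60 * n + 100 ∧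
      s'.var 10 ≤ M ∧ s'.var 11 ≤ M ∧
      s'.var 8 = strictWeight (s.arr 0) (s.arr 1) n (s'.var 10) (s'.var 11) ∧
      (IsThreshold (s.arr 0) (s.arr 1) n W (s'.var 10) (s'.var 11) ∨
        s'.var 10 = 0 ∧ s'.var 11 = 1 ∧ ∀ v u, 0 < v → v ≤ M → u ≤ M →
          ¬ IsThreshold (s.arr 0) (s.arr 1) n W v u) ∧
      Frame [6, 7, 12, 10, 11, 8, 9, 3] [] s s') := by
  have hsum : ∑ j ∈ range n, s.arr 1 j ≤ n * M := by
    simpa using sum_le_card_nsmul (range n) _ M fun j hj => hw j (by simpa using hj)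
  have hS : ∀ v u, strictWeight (s.arr 0) (s.arr 1) n v u ≤ n * M := fun v u =>
    (sum_le_sum fun j _ => by split_ifs <;> omega).trans hsum
  have hE : ∀ v u, equalWeight (s.arr 0) (s.arr 1) n v u ≤ n * M := fun v u =>
    (sum_le_sum fun j _ => by split_ifs <;> omega).trans hsum
  have ratio : ∀ s' : State, Frame [6, 7, 12, 10, 11, 8, 9, 3] [] s s' → s'.var 10 ≤ M →
      s'.var 11 ≤ M → WP B ratioProg s' (fun t s'' => t ≤ 60 * n + 20 ∧
      s''.var 8 = strictWeight (s.arr 0) (s.arr 1) n (s'.var 10) (s'.var 11) ∧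
      s''.var 9 = equalWeight (s.arr 0) (s.arr 1) n (s'.var 10) (s'.var 11) ∧
      Frame [8, 9, 3] [] s' s'') := by
    intro s' hF hv hu
    have e0 := hF.arr 0 (by decide)
    have e1 := hF.arr 1 (by decide)
    have e2 := hF.var 0 (by decide)
    rw [← e0, ← e1]
    refine ratioProg_spec (by omega) rfl rfl hn (by omega) (by omega) ?_ ?_ ?_ ?_
    · intro j hj
      rw [e0]
      have := hp j hj
      omega
    · intro j hj
      rw [e0]
      exact (Nat.mul_le_mul (hp j hj) hu).trans_lt hB
    · intro j hj
      rw [e1]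
      exact (Nat.mul_le_mul hv (hw j hj)).trans_lt hB
    · rw [e1]
      omega
  let Inv : (ℕ → ℕ → Prop) → State → Prop := fun Pr s' => s'.var 6 ≤ M ∧ s'.var 7 ≤ M ∧
    (IsThreshold (s.arr 0) (s.arr 1) n W (s'.var 6) (s'.var 7) ∨
      s'.var 6 = 0 ∧ s'.var 7 = 1 ∧ ∀ v u, 0 < v → Pr v u →
        ¬ IsThreshold (s.arr 0) (s.arr 1) n W v u)
  rw [thresholdProg, wp_seq, wp_assign]
  refine ⟨by simp only [Expr.Fits]; omega, ?_⟩
  rw [wp_seq, wp_assign]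
  refine ⟨by simp only [Expr.Fits]; omega, ?_⟩
  rw [wp_seq]
  have hF0 : Frame [6, 7, 12, 10, 11, 8, 9, 3] []
      s ((s.setVar 6 (Expr.val s (.const 0))).setVar 7
        (Expr.val (s.setVar 6 (Expr.val s (.const 0))) (.const 1))) :=
    ⟨fun y hy => by simp at hy ⊢; simp [hy], fun a _ => rfl⟩
  refine (wp_forLoop (T := (M + 1) * (60 * n + 70) + 30) M
    (fun a s' => Inv (fun v u => v ≤ a ∧ u ≤ M) s') (by omega) (by decide) ?_ ?_ ?_).mono ?_
  · intro s' hF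
    have := (hF.var 2 (by decide)).trans (hF0.var 2 (by decide))
    simp only [Expr.val, Expr.Fits]
    omega
  · refine ⟨by simp [Expr.val], by simp [Expr.val]; omega, .inr ⟨by simp [Expr.val], by simp [Expr.val], ?_⟩⟩
    intro v u h h'
    omega
  · intro a ha s1 hF hx hI
    have hF1 : Frame [6, 7, 12, 10, 11, 8, 9, 3] [] s s1 :=
      hF0.trans (hF.mono (by decide) (by decide))
    rw [wp_seq, wp_assign]
    refine ⟨by simp only [Expr.Fits, Expr.val]; omega, ?_⟩
    have hFa : Frame [6, 7, 12, 10, 11, 8, 9, 3] [] s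
        (s1.setVar 10 (Expr.val s1 (.add (.var 12) (.const 1)))) :=
      hF1.trans ⟨fun y hy => by simp at hy ⊢; simp [hy], fun a _ => rfl⟩
    refine (wp_forLoop (T := 60 * n + 50) (M + 1)
      (fun b s' => Inv (fun v u => v ≤ a ∧ u ≤ M ∨ v = a + 1 ∧ u < b) s')
      (by omega) (by decide) ?_ ?_ ?_).mono ?_
    · intro s' hF
      have := (hF.var 2 (by decide)).trans (hFa.var 2 (by decide))
      simp only [Expr.val, Expr.Fits]
      omega
    · simpa [Inv] using hI
    · intro b hb s2 hF2 hx2 hI2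
      have hFb := hFa.trans (hF2.mono (V' := [6, 7, 12, 10, 11, 8, 9, 3]) (A' := [])
        (by decide) (by decide))
      have e10 : s2.var 10 = a + 1 := by
        rw [hF2.var 10 (by decide)]; simp [Expr.val, hx]
      rw [wp_seq]
      refine (ratio s2 hFb (by omega) (by omega)).mono ?_
      rintro t s3 ⟨ht, h8, h9, hF3⟩
      have e1 : s3.var 1 = W := by
        rw [hF3.var 1 (by decide), hFb.var 1 (by decide), h1]
      have e6 : s3.var 6 = s2.var 6 := hF3.var 6 (by decide)
      have e7 : s3.var 7 = s2.var 7 := hF3.var 7 (by decide)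
      have e10' : s3.var 10 = a + 1 := (hF3.var 10 (by decide)).trans e10
      have e11' : s3.var 11 = b := (hF3.var 11 (by decide)).trans hx2
      rw [e10, hx2] at h8 h9
      have b1 := hS (a + 1) b
      have b2 := hE (a + 1) b
      obtain ⟨i1, i2, i3⟩ := hI2
      have keep : ¬ IsThreshold (s.arr 0) (s.arr 1) n W (a + 1) b →
          Inv (fun v u => v ≤ a ∧ u ≤ M ∨ v = a + 1 ∧ u < b + 1) (s3.setVar 11 (b + 1)) := by
        intro hnt
        simp only [Inv, State.var_setVar, Nat.reduceEqDiff, if_false, e6, e7]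
        refine ⟨i1, i2, i3.imp_right ?_⟩
        rintro ⟨j1, j2, j3⟩
        refine ⟨j1, j2, fun v u hv0 h hth => ?_⟩
        by_cases hb' : v = a + 1 ∧ u = b
        · obtain ⟨rfl, rfl⟩ := hb'
          exact hnt hth
        · exact j3 v u hv0 (by omega) hth
      simp only [wp_ite, wp_assign, wp_skip, wp_seq, Expr.val, Expr.Fits, Expr.cost, State.var_setVar,
        h8, h9, e1, e10', e11', Nat.reduceEqDiff, if_false]
      refine ⟨by omega, fun c1 => ⟨by omega, fun c2 => ⟨by omega, keep ?_⟩,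
        fun c2 => ⟨by omega, by omega, by omega, ?_⟩⟩, fun c1 => ⟨by omega, keep ?_⟩⟩
      · rintro ⟨-, q, -⟩; omega
      · simp only [Inv, State.var_setVar, Nat.reduceEqDiff, if_false, if_true]
        exact ⟨by omega, by omega, .inl ⟨by omega, by omega, by omega⟩⟩
      · rintro ⟨-, -, q⟩; omega
    · rintro t s2 ⟨ht, hI2, hF2⟩
      simp only [Expr.cost] at ht ⊢
      refine ⟨?_, ?_⟩
      · have : (M + 1) * (60 * n + 50 + (1 + 1 + 1) + 9) ≤ (M + 1) * (60 * n + 70) :=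
          Nat.mul_le_mul_left _ (by omega)
        omega
      · obtain ⟨i1, i2, i3⟩ := hI2
        simp only [Inv, State.var_setVar, Nat.reduceEqDiff, if_false]
        refine ⟨i1, i2, i3.imp_right ?_⟩
        rintro ⟨j1, j2, j3⟩
        exact ⟨j1, j2, fun v u hv0 h => j3 v u hv0 (by omega)⟩
  · rintro t s1 ⟨ht, ⟨i1, i2, i3⟩, hF1⟩
    have hFb := hF0.trans (hF1.mono (V' := [6, 7, 12, 10, 11, 8, 9, 3]) (A' := [])
        (by decide) (by decide))
    rw [wp_seq, wp_assign]
    refine ⟨by simp only [Expr.Fits]; omega, ?_⟩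
    rw [wp_seq, wp_assign]
    refine ⟨by simp only [Expr.Fits, State.var_setVar, Nat.reduceEqDiff, if_false]; omega, ?_⟩
    simp only [Expr.val, State.var_setVar, Nat.reduceEqDiff, if_false]
    have hFc : Frame [6, 7, 12, 10, 11, 8, 9, 3] [] s
        ((s1.setVar 10 (s1.var 6)).setVar 11 (s1.var 7)) :=
      hFb.trans ⟨fun y hy => by simp at hy ⊢; simp [hy], fun a _ => rfl⟩
    refine (ratio _ hFc (by simpa using i1) (by simpa using i2)).mono ?_
    simp only [State.var_setVar, Nat.reduceEqDiff, if_false, if_true]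
    rintro t' s2 ⟨ht', h8, -, hF2⟩
    have e10 := hF2.var 10 (by decide)
    have e11 := hF2.var 11 (by decide)
    simp only [State.var_setVar, Nat.reduceEqDiff, if_false, if_true] at e10 e11
    rw [e10, e11]
    refine ⟨?_, i1, i2, h8, i3.imp_right ?_, hFc.trans (hF2.mono (by decide) (by decide))⟩
    · simp only [Expr.cost] at ht ⊢
      have : M * ((M + 1) * (60 * n + 70) + 30 + 1 + 9) ≤ M * ((M + 1) * (60 * n + 70) + 50) :=
        Nat.mul_le_mul_left _ (by omega)
      omega
    · rintro ⟨j1, j2, j3⟩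
      exact ⟨j1, j2, fun v u hv0 h h' => j3 v u hv0 ⟨h, h'⟩⟩

/-- If the jobs of positive size outweigh `W`, consider those jobs for which the total weight up to
and including their ratio exceeds `W`. One of smallest ratio gives a threshold: if the weight
strictly below it already exceeded `W`, a job of smaller ratio would qualify. -/
theorem strictWeight_le_of_no_threshold {p w : ℕ → ℕ} {n W M : ℕ} (hp : ∀ j < n, p j ≤ M)
    (hw : ∀ j < n, w j ≤ M)
    (h : ∀ v u, 0 < v → v ≤ M → u ≤ M → ¬ IsThreshold p w n W v u) :
    strictWeight p w n 0 1 ≤ W := by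
  classical
  by_contra! hlt
  let ρ : ℕ → ℚ := fun j => w j / p j
  have hle : ∀ j k, 0 < p j → 0 < p k → (ρ j ≤ ρ k ↔ p k * w j ≤ p j * w k) := by
    intro j k hj hk
    simp only [ρ]
    rw [div_le_div_iff₀ (by positivity) (by positivity)]
    constructor
    · intro h
      have : w j * p k ≤ w k * p j := by exact_mod_cast h
      linarith
    · intro h
      have : w j * p k ≤ w k * p j := by linarith
      exact_mod_cast this
  have htot : ∀ v u, strictWeight p w n v u + equalWeight p w n v u =
      ∑ j ∈ range n, if 0 < p j ∧ v * w j ≤ p j * u then w j else 0 := by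
    intro v u
    rw [strictWeight, equalWeight, ← sum_add_distrib]
    refine sum_congr rfl fun j _ => ?_
    split_ifs <;> omega
  let C := (range n).filter fun k => 0 < p k ∧
    W < strictWeight p w n (p k) (w k) + equalWeight p w n (p k) (w k)
  -- In a set heavier than `W`, the job of largest ratio belongs to `C`, since the whole set has
  -- ratio at most its own.
  have hC : ∀ D : Finset ℕ, (∀ j ∈ D, j < n ∧ 0 < p j) → W < ∑ j ∈ D, w j →
      ∃ k ∈ D, k ∈ C := by
    intro D hD hWD
    have hne : D.Nonempty := by
      rw [nonempty_iff_ne_empty]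
      rintro rfl
      simp at hWD
    obtain ⟨k, hk, hmax⟩ := exists_max_image D ρ hne
    refine ⟨k, hk, ?_⟩
    simp only [C, mem_filter, mem_range]
    refine ⟨(hD k hk).1, (hD k hk).2, lt_of_lt_of_le hWD ?_⟩
    rw [htot, ← sum_filter]
    refine sum_le_sum_of_subset fun j hj => ?_
    simp only [mem_filter, mem_range]
    exact ⟨(hD j hj).1, (hD j hj).2, (hle j k (hD j hj).2 (hD k hk).2).1 (hmax j hj)⟩
  obtain ⟨k0, -, hk0⟩ := hC ((range n).filter fun j => 0 < p j) (by simp) (by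
    refine lt_of_lt_of_le hlt ?_
    rw [strictWeight, ← sum_filter]
    refine sum_le_sum_of_subset fun j hj => ?_
    simp only [mem_filter, mem_range] at hj ⊢
    exact ⟨hj.1, hj.2.1⟩)
  obtain ⟨k, hk, hmin⟩ := exists_min_image C ρ ⟨k0, hk0⟩
  have hk' := hk
  simp only [C, mem_filter, mem_range] at hk
  refine h _ _ hk.2.1 (hp k hk.1) (hw k hk.1) ⟨hk.2.1, ?_, hk.2.2⟩
  by_contra! hs
  rw [strictWeight, ← sum_filter] at hs
  obtain ⟨k1, hk1, hk1C⟩ := hC _ (by simp; tauto) hs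
  have := hmin k1 hk1C
  simp only [mem_filter, mem_range] at hk1
  rw [hle k k1 hk.2.1 hk1.2.1] at this
  omega

/-! ### The guide -/

/-- Run job `j` on the machine on which it completes first. -/
def acceptProg (m : ℕ) : Program :=
  .seq (.assign 13 (.const 0)) (.seq
    (forLoop 4 (.const m) (.ite
      (.sub (.mul (.get 10 (.add (.var 13) (.const 1)))
          (.add (.get 6 (.add (.var 13) (.const 1))) (.get 0 (.var 3))))
        (.mul (.get 10 (.add (.var 4) (.const 1)))
          (.add (.get 6 (.add (.var 4) (.const 1))) (.get 0 (.var 3)))))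
      (.assign 13 (.var 4)) .skip))
    (.seq (.store 6 (.add (.var 13) (.const 1))
        (.add (.get 6 (.add (.var 13) (.const 1))) (.get 0 (.var 3))))
      (.store 5 (.var 3) (.add (.var 13) (.const 1)))))

theorem acceptProg_spec {B m j : ℕ} {s : State} (hm : 0 < m) (hmB : m + 1 < B)
    (hj : s.var 3 = j) (hjB : j < B) (hp : s.arr 0 j < B) (hc : ∀ i < m, s.arr 10 (i + 1) < B)
    (hL : ∀ i < m, s.arr 6 (i + 1) + s.arr 0 j < B)
    (hcL : ∀ i < m, s.arr 10 (i + 1) * (s.arr 6 (i + 1) + s.arr 0 j) < B) :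
    WP B (acceptProg m) s (fun t s' => t ≤ 40 * m + 40 ∧ (∃ k < m,
      (∀ i < m, s.arr 10 (k + 1) * (s.arr 6 (k + 1) + s.arr 0 j) ≤
        s.arr 10 (i + 1) * (s.arr 6 (i + 1) + s.arr 0 j)) ∧
      s'.arr 6 = Function.update (s.arr 6) (k + 1) (s.arr 6 (k + 1) + s.arr 0 j) ∧
      s'.arr 5 = Function.update (s.arr 5) j (k + 1)) ∧ Frame [13, 4] [6, 5] s s') := by
  rw [acceptProg, wp_seq, wp_assign]
  refine ⟨by simp only [Expr.Fits]; omega, ?_⟩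
  rw [wp_seq]
  have hF0 : Frame [13, 4] [6, 5] s (s.setVar 13 (Expr.val s (.const 0))) :=
    ⟨fun y hy => by simp at hy ⊢; simp [hy], fun a _ => rfl⟩
  refine (wp_forLoop (T := 30) m (fun i s' => s'.var 13 < m ∧
    ∀ k < i, s.arr 10 (s'.var 13 + 1) * (s.arr 6 (s'.var 13 + 1) + s.arr 0 j) ≤
      s.arr 10 (k + 1) * (s.arr 6 (k + 1) + s.arr 0 j)) (by omega) (by decide) ?_ ?_ ?_).mono ?_
  · intro s' hF
    simp only [Expr.val, Expr.Fits, true_and]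
    omega
  · simp [Expr.val, hm]
  · rintro i hi s' hF hx ⟨hI1, hI2⟩
    have e0 : s'.arr 0 = s.arr 0 := hF.arr 0 (by decide)
    have e6 : s'.arr 6 = s.arr 6 := hF.arr 6 (by decide)
    have e10 : s'.arr 10 = s.arr 10 := hF.arr 10 (by decide)
    have e3 : s'.var 3 = j := (hF.var 3 (by decide)).trans (by simpa using hj)
    generalize ek : s'.var 13 = k at *
    have a1 := hc i hi
    have a2 := hL i hi
    have a3 := hcL i hi
    have b1 := hc k hI1
    have b2 := hL k hI1
    have b3 := hcL k hI1
    simp only [wp_ite, wp_assign, wp_skip, Expr.val, Expr.Fits, Expr.cost, State.var_setVar, hx, e0, e6,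
      e10, e3, ek, Nat.reduceEqDiff, if_false, if_true]
    refine ⟨by omega, fun h => ⟨by omega, by omega, hi, fun l hl => ?_⟩,
      fun h => ⟨by omega, hI1, fun l hl => ?_⟩⟩
    · rcases Nat.lt_succ_iff_lt_or_eq.1 hl with hl | rfl
      · have := hI2 l hl
        omega
      · exact le_rfl
    · rcases Nat.lt_succ_iff_lt_or_eq.1 hl with hl | rfl
      · exact hI2 l hl
      · omega
  · rintro t s1 ⟨ht, ⟨hI1, hI2⟩, hF1⟩
    have hFb := hF0.trans (hF1.mono (V' := [13, 4]) (A' := [6, 5]) (by decide) (by decide))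
    have e0 : s1.arr 0 = s.arr 0 := hF1.arr 0 (by decide)
    have e6 : s1.arr 6 = s.arr 6 := hF1.arr 6 (by decide)
    have e5 : s1.arr 5 = s.arr 5 := hF1.arr 5 (by decide)
    have e3 : s1.var 3 = j := (hFb.var 3 (by decide)).trans hj
    generalize ek : s1.var 13 = k at *
    have b2 := hL k hI1
    simp only [wp_seq, wp_store, Expr.val, Expr.Fits, Expr.cost, e0, e6, e3, ek,
      State.var_setArr] at ht ⊢
    refine ⟨by omega, by omega, by omega, by omega, by omega, ⟨k, hI1, hI2, ?_, ?_⟩, ?_⟩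
    · rw [State.arr_setArr_of_ne _ _ _ (by decide), State.arr_setArr_same, e6]
    · rw [State.arr_setArr_same, State.arr_setArr_of_ne _ _ _ (by decide), e5]
    · refine hFb.trans ⟨fun y hy => by simp, fun a ha => ?_⟩
      simp only [List.mem_cons, List.not_mem_nil, or_false, not_or] at ha
      rw [State.arr_setArr_of_ne _ _ _ ha.2, State.arr_setArr_of_ne _ _ _ ha.1]

/-- Variable `8` starts with the weight of all jobs below the threshold, so their rejection is
reserved in advance. A job of exactly the threshold ratio is rejected only if it fits besides them,
and jobs of size zero are always accepted. -/
def guideProg (m : ℕ) : Program :=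
  forLoop 3 (.var 0) (.ite (.get 0 (.var 3))
    (.ite (.sub (.mul (.get 0 (.var 3)) (.var 11)) (.mul (.var 10) (.get 1 (.var 3))))
      (.store 5 (.var 3) (.const 0))
      (.ite (.add (.sub (.mul (.var 10) (.get 1 (.var 3))) (.mul (.get 0 (.var 3)) (.var 11)))
          (.sub (.add (.var 8) (.get 1 (.var 3))) (.var 1)))
        (acceptProg m)
        (.seq (.assign 8 (.add (.var 8) (.get 1 (.var 3)))) (.store 5 (.var 3) (.const 0)))))
    (acceptProg m))

/-- What the guide has achieved after the first `i` jobs, if the jobs of ratio below `u / v` have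
total weight `H`, and `acc` is the weight of the jobs selected for rejection. -/
structure GuideInv (m W M v u H : ℕ) (p w c : ℕ → ℕ) (i : ℕ) (g L : ℕ → ℕ) (acc : ℕ) :
    Prop where
  code_le : ∀ k < i, g k ≤ m
  strict : ∀ k < i, 0 < p k → v * w k < p k * u → g k = 0
  lax : ∀ k < i, g k = 0 → 0 < p k ∧ v * w k ≤ p k * u
  full : ∀ k < i, 0 < p k → p k * u = v * w k → g k ≠ 0 → W < acc + w k
  acc_eq : acc + ∑ k ∈ range i, (if 0 < p k ∧ v * w k < p k * u then w k else 0) =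
    H + pre w g 0 i
  acc_le : acc ≤ W
  load : ∀ k < m, L (k + 1) = pre p g (k + 1) i
  balanced : ∀ a < m, ∀ b < m, c (b + 1) * L (b + 1) ≤ c (a + 1) * (L (a + 1) + M)

theorem pre_congr {q f f' : ℕ → ℕ} {c i : ℕ} (h : ∀ k < i, f k = f' k) :
    pre q f c i = pre q f' c i :=
  sum_congr rfl fun k hk => by rw [h k (by simpa using hk)]

theorem pre_le_sum (q f : ℕ → ℕ) (c i : ℕ) : pre q f c i ≤ ∑ k ∈ range i, q k :=
  sum_le_sum fun k _ => by split_ifs <;> omega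

theorem GuideInv.reject {m W M v u H : ℕ} {p w c : ℕ → ℕ} {i : ℕ} {g L : ℕ → ℕ} {acc : ℕ}
    (h : GuideInv m W M v u H p w c i g L acc) (hp : 0 < p i) (acc' : ℕ)
    (hcase : v * w i < p i * u ∧ acc' = acc ∨
      p i * u = v * w i ∧ acc' = acc + w i ∧ acc + w i ≤ W) :
    GuideInv m W M v u H p w c (i + 1) (Function.update g i 0) L acc' := by
  have hne : ∀ k < i, Function.update g i 0 k = g k := fun k hk =>
    Function.update_of_ne (by omega) _ _
  have hsame : Function.update g i 0 i = 0 := Function.update_self _ _ _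
  constructor
  · intro k hk
    rcases Nat.lt_succ_iff_lt_or_eq.1 hk with hk | rfl
    · rw [hne k hk]; exact h.code_le k hk
    · simp
  · intro k hk h1 h2
    rcases Nat.lt_succ_iff_lt_or_eq.1 hk with hk | rfl
    · rw [hne k hk]; exact h.strict k hk h1 h2
    · simp
  · intro k hk h1
    rcases Nat.lt_succ_iff_lt_or_eq.1 hk with hk | rfl
    · rw [hne k hk] at h1; exact h.lax k hk h1
    · exact ⟨hp, by omega⟩
  · intro k hk h1 h2 h3
    rcases Nat.lt_succ_iff_lt_or_eq.1 hk with hk | rfl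
    · rw [hne k hk] at h3
      have := h.full k hk h1 h2 h3
      omega
    · simp at h3
  · rw [sum_range_succ, pre_succ, pre_congr hne, hsame]
    have := h.acc_eq
    rcases hcase with ⟨h1, h2⟩ | ⟨h1, h2, -⟩
    · rw [if_pos ⟨hp, h1⟩, if_pos rfl]
      omega
    · rw [if_neg (by omega), if_pos rfl]
      omega
  · have := h.acc_le
    omega
  · intro k hk
    rw [pre_succ, pre_congr hne, hsame, if_neg (by omega)]
    exact h.load k hk
  · exact h.balanced

/-- Balance survives because machine `k` minimizes the completion time: its new scaled load is at
most what machine `a` would get from job `i`, hence at most `c (a + 1) * (L (a + 1) + M)`. On the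
other side of the inequality loads only grow. -/
theorem GuideInv.accept {m W M v u H : ℕ} {p w c : ℕ → ℕ} {i : ℕ} {g L : ℕ → ℕ} {acc : ℕ}
    (h : GuideInv m W M v u H p w c i g L acc) (hM : p i ≤ M)
    (hcase : 0 < p i → p i * u ≤ v * w i ∧ (p i * u = v * w i → W < acc + w i)) {k : ℕ}
    (hk : k < m) (hmin : ∀ a < m, c (k + 1) * (L (k + 1) + p i) ≤ c (a + 1) * (L (a + 1) + p i)) :
    GuideInv m W M v u H p w c (i + 1) (Function.update g i (k + 1))
      (Function.update L (k + 1) (L (k + 1) + p i)) acc := by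
  have hne : ∀ l < i, Function.update g i (k + 1) l = g l := fun l hl =>
    Function.update_of_ne (by omega) _ _
  have hsame : Function.update g i (k + 1) i = k + 1 := Function.update_self _ _ _
  constructor
  · intro l hl
    rcases Nat.lt_succ_iff_lt_or_eq.1 hl with hl | rfl
    · rw [hne l hl]; exact h.code_le l hl
    · rw [hsame]; omega
  · intro l hl h1 h2
    rcases Nat.lt_succ_iff_lt_or_eq.1 hl with hl | rfl
    · rw [hne l hl]; exact h.strict l hl h1 h2
    · have := hcase h1
      omega
  · intro l hl h1
    rcases Nat.lt_succ_iff_lt_or_eq.1 hl with hl | rfl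
    · rw [hne l hl] at h1; exact h.lax l hl h1
    · rw [hsame] at h1; omega
  · intro l hl h1 h2 h3
    rcases Nat.lt_succ_iff_lt_or_eq.1 hl with hl | rfl
    · rw [hne l hl] at h3
      exact h.full l hl h1 h2 h3
    · exact (hcase h1).2 h2
  · rw [sum_range_succ, pre_succ, pre_congr hne, hsame, if_neg (by
      rintro ⟨h1, h2⟩
      have := hcase h1
      omega), if_neg (by omega)]
    have := h.acc_eq
    omega
  · exact h.acc_le
  · intro l hl
    rw [pre_succ, pre_congr hne, hsame, ← h.load l hl]
    by_cases hlk : l = k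
    · subst hlk
      simp
    · rw [Function.update_of_ne (by omega), if_neg (by omega), add_zero]
  · intro a ha b hb
    have mono : c (a + 1) * (L (a + 1) + M) ≤
        c (a + 1) * (Function.update L (k + 1) (L (k + 1) + p i) (a + 1) + M) := by
      by_cases hak : a = k
      · subst hak
        rw [Function.update_self]
        exact Nat.mul_le_mul_left _ (by omega)
      · rw [Function.update_of_ne (by omega)]
    refine le_trans ?_ mono
    by_cases hbk : b = k
    · subst hbk
      rw [Function.update_self]
      exact (hmin a ha).trans (Nat.mul_le_mul_left _ (by omega))
    · rw [Function.update_of_ne (by omega)]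
      exact h.balanced a ha b hb

theorem guideProg_spec {B n m W M C v u H : ℕ} {s : State} (h0 : s.var 0 = n) (h1 : s.var 1 = W)
    (hv : s.var 10 = v) (hu : s.var 11 = u) (h8 : s.var 8 = H) (h6 : s.arr 6 = fun _ => 0)
    (hm : 0 < m) (hHW : H ≤ W) (hp : ∀ j < n, s.arr 0 j ≤ M) (hw : ∀ j < n, s.arr 1 j ≤ M)
    (hc : ∀ i < m, s.arr 10 (i + 1) ≤ C) (hvM : v ≤ M) (huM : u ≤ M)
    (hmB : m + 1 < B) (hn : n < B) (hB1 : M * M + (W + M) < B) (hB2 : C * (n * M) < B)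
    (hB3 : C < B) (hB4 : n * M < B) :
    WP B (guideProg m) s (fun t s' => t ≤ n * (40 * m + 90) + 10 ∧
      (∃ acc, GuideInv m W M v u H (s.arr 0) (s.arr 1) (s.arr 10) n (s'.arr 5) (s'.arr 6) acc) ∧
      Frame [3, 8, 13, 4] [5, 6] s s') := by
  have hMM : M ≤ M * M := Nat.le_mul_self M
  have hsum : ∀ i ≤ n, ∑ j ∈ range i, s.arr 0 j ≤ i * M := fun i hi => by
    simpa using sum_le_card_nsmul (range i) _ M fun j hj => hp j (by simp at hj; omega)
  refine (wp_forLoop (T := 40 * m + 75) n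
    (fun i s' => GuideInv m W M v u H (s.arr 0) (s.arr 1) (s.arr 10) i (s'.arr 5) (s'.arr 6)
      (s'.var 8)) hn (by simp [Program.wv, acceptProg, forLoop]) ?_ ?_ ?_).mono ?_
  · intro s' hF
    have := hF.var 0 (by simp [Program.wv, acceptProg, forLoop])
    simp only [Expr.val, Expr.Fits]
    omega
  · constructor <;> simp [h8, h6, hHW]
  · rintro i hi s' hF hx hI
    have hF : Frame [3, 8, 13, 4] [5, 6] s s' := hF.mono (by
      simp [Program.wv, acceptProg, forLoop]) (by simp [Program.wa, acceptProg, forLoop])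
    have e0 : s'.arr 0 = s.arr 0 := hF.arr 0 (by decide)
    have e1 : s'.arr 1 = s.arr 1 := hF.arr 1 (by decide)
    have e10 : s'.arr 10 = s.arr 10 := hF.arr 10 (by decide)
    have v1 : s'.var 1 = W := (hF.var 1 (by decide)).trans h1
    have v10 : s'.var 10 = v := (hF.var 10 (by decide)).trans hv
    have v11 : s'.var 11 = u := (hF.var 11 (by decide)).trans hu
    have a1 := hp i hi
    have a2 := hw i hi
    have a3 : s.arr 0 i * u ≤ M * M := Nat.mul_le_mul a1 huM
    have a4 : v * s.arr 1 i ≤ M * M := Nat.mul_le_mul hvM a2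
    have hacc := hI.acc_le
    have hLb : ∀ k < m, s'.arr 6 (k + 1) + s.arr 0 i ≤ n * M := by
      intro k hk
      rw [hI.load k hk]
      have b1 := pre_le_sum (s.arr 0) (s'.arr 5) (k + 1) i
      have b2 := hsum (i + 1) hi
      rw [sum_range_succ] at b2
      have b3 : (i + 1) * M ≤ n * M := Nat.mul_le_mul_right _ hi
      omega
    have accept : (0 < s.arr 0 i → s.arr 0 i * u ≤ v * s.arr 1 i ∧
        (s.arr 0 i * u = v * s.arr 1 i → W < s'.var 8 + s.arr 1 i)) → ∀ d ≤ 30,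
        WP B (acceptProg m) s' (fun t s'' => d + t ≤ 40 * m + 75 ∧
          GuideInv m W M v u H (s.arr 0) (s.arr 1) (s.arr 10) (i + 1) (s''.arr 5) (s''.arr 6)
            (s''.var 8)) := by
      intro hcase d hd
      refine (acceptProg_spec hm hmB hx (by omega) ?_ ?_ ?_ ?_).mono ?_
      · rw [e0]; omega
      · intro k hk
        rw [e10]
        exact (hc k hk).trans_lt hB3
      · intro k hk
        rw [e0]
        exact (hLb k hk).trans_lt hB4
      · intro k hk
        rw [e0, e10]
        exact (Nat.mul_le_mul (hc k hk) (hLb k hk)).trans_lt hB2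
      · rintro t s'' ⟨ht, ⟨k, hk, hmin, h6, h5⟩, hF'⟩
        refine ⟨by omega, ?_⟩
        rw [h5, h6, hF'.var 8 (by decide), e0]
        rw [e0, e10] at hmin
        exact hI.accept a1 hcase hk hmin
    simp only [wp_ite, wp_assign, wp_store, wp_seq, Expr.val, Expr.Fits, Expr.cost,
      State.var_setVar, State.arr_setVar, State.var_setArr, State.arr_setArr_same, hx, e0, e1, v1,
      v10, v11, Nat.reduceEqDiff, if_false, if_true,
      State.arr_setArr_of_ne _ _ _ (show 6 ≠ 5 by decide)]
    refine ⟨by omega, fun c1 => ⟨by omega, fun c2 => ⟨by omega, by omega, by omega, ?_⟩,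
      fun c2 => ⟨by omega, fun c3 => ?_, fun c3 => ⟨by omega, by omega, by omega, by omega, ?_⟩⟩⟩,
      fun c1 => ?_⟩
    · exact hI.reject (by omega) _ (.inl ⟨by omega, rfl⟩)
    · refine (accept (fun _ => ⟨by omega, fun _ => by omega⟩) 30 le_rfl).mono ?_
      rintro t s'' ⟨ht, h⟩
      exact ⟨by omega, h⟩
    · exact hI.reject (by omega) _ (.inr ⟨by omega, rfl, by omega⟩)
    · refine (accept (fun h => by omega) 30 le_rfl).mono ?_
      rintro t s'' ⟨ht, h⟩
      exact ⟨by omega, h⟩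
  · rintro t s' ⟨ht, hI, hF⟩
    simp only [Expr.cost] at ht ⊢
    refine ⟨?_, ⟨_, hI⟩, hF.mono (by simp [Program.wv, acceptProg, forLoop])
      (by simp [Program.wa, acceptProg, forLoop])⟩
    have : n * (40 * m + 75 + 1 + 9) ≤ n * (40 * m + 90) := Nat.mul_le_mul_left _ (by omega)
    omega

/-! ### The window of the dynamic program -/

/-- The `k`-th power of an expression. -/
def powExpr (e : Expr) : ℕ → Expr
  | 0 => .const 1
  | k + 1 => .mul (powExpr e k) e

theorem powExpr_val (e : Expr) (s : State) (k : ℕ) : (powExpr e k).val s = e.val s ^ k := by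
  induction k with
  | zero => simp [powExpr, Expr.val]
  | succ k ih => simp [powExpr, Expr.val, ih, pow_succ]

theorem powExpr_cost (e : Expr) (k : ℕ) : (powExpr e k).cost = k * (e.cost + 1) + 1 := by
  induction k with
  | zero => simp [powExpr, Expr.cost]
  | succ k ih => simp only [powExpr, Expr.cost, ih]; ring

theorem powExpr_fits {B : ℕ} {e : Expr} {s : State} {k : ℕ} (he : e.Fits B s) (h0 : 0 < e.val s)
    (h : e.val s ^ k < B) (hB : 1 < B) : (powExpr e k).Fits B s := by
  induction k with
  | zero => simpa [powExpr, Expr.Fits] using hB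
  | succ k ih =>
    refine ⟨ih ((Nat.pow_le_pow_right h0 (Nat.le_succ k)).trans_lt h), he, ?_⟩
    rwa [powExpr_val, ← pow_succ]

/-- Half of the width of the window of loads that the dynamic program considers. -/
def radius (m M : ℕ) : ℕ := 181 * m ^ 5 * M ^ (m + 4)

/-- Variables `14`, `15`, `16` receive the radius, the base and the number of states, and variable
`20` the state with all differences zero, whose digits equal the radius. Array `7` receives the
powers of the base. -/
def windowProg (m : ℕ) : Program :=
  .seq (.assign 14 (.mul (.const (181 * m ^ 5)) (powExpr (.var 2) (m + 4)))) (.seq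
    (.assign 15 (.add (.mul (.const 2) (.var 14)) (.const 1))) (.seq
    (.assign 16 (.const 1)) (.seq (.assign 20 (.const 0))
    (forLoop 4 (.const (m + 1)) (.seq (.store 7 (.var 4) (.var 16))
      (.seq (.assign 20 (.add (.var 20) (.mul (.var 14) (.var 16))))
        (.assign 16 (.mul (.var 16) (.var 15)))))))))

theorem windowProg_spec {B m M h b : ℕ} {s : State} (hm : 0 < m) (hM : 0 < M) (h2 : s.var 2 = M)
    (hh : h = radius m M) (hb : b = 2 * h + 1) (hB : b ^ (m + 1) < B) (hmB : m + 1 < B) :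
    WP B (windowProg m) s (fun t s' => t ≤ 40 * m + 80 ∧ s'.var 14 = h ∧ s'.var 15 = b ∧
      s'.var 16 = b ^ (m + 1) ∧ s'.var 20 = enc b (m + 1) (fun _ => h) ∧
      (∀ i ≤ m, s'.arr 7 i = b ^ i) ∧ Frame [14, 15, 16, 20, 4] [7] s s') := by
  have hb1 : 0 < b := by omega
  have hpow : ∀ a ≤ m + 1, b ^ a < B := fun a ha => (Nat.pow_le_pow_right hb1 ha).trans_lt hB
  have hbB : b < B := by simpa using hpow 1 (by omega)
  have hMp : M ^ (m + 4) ≤ h := by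
    rw [hh, radius]
    exact Nat.le_mul_of_pos_left _ (by positivity)
  have hMle : M ≤ M ^ (m + 4) := Nat.le_self_pow (by omega) M
  have hcle : 181 * m ^ 5 ≤ h := by
    rw [hh, radius]
    exact Nat.le_mul_of_pos_right _ (by positivity)
  have hencle : ∀ i ≤ m + 1, enc b i (fun _ => h) < B := fun i hi =>
    (enc_lt fun _ _ => by omega).trans (hpow i hi)
  rw [windowProg, wp_seq, wp_assign]
  have hval : (Expr.mul (.const (181 * m ^ 5)) (powExpr (.var 2) (m + 4))).val s = h := by
    simp only [Expr.val, powExpr_val, h2]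
    exact hh.symm
  refine ⟨⟨by simp only [Expr.Fits]; omega, powExpr_fits (by simp only [Expr.Fits]; omega)
    (by simp only [Expr.val]; omega) (by simp only [Expr.val, h2]; omega) (by omega), ?_⟩, ?_⟩
  · simp only [Expr.val, powExpr_val, h2]
    rw [← radius, ← hh]
    omega
  rw [hval]
  simp only [wp_seq, wp_assign, Expr.val, Expr.Fits, State.var_setVar, if_true, Expr.cost,
    powExpr_cost]
  refine ⟨by omega, by omega, by omega, ?_⟩
  refine (wp_forLoop (T := 20) (m + 1) (fun i s' => s'.var 16 = b ^ i ∧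
    s'.var 20 = enc b i (fun _ => h) ∧ ∀ k < i, s'.arr 7 k = b ^ k) hmB (by decide) ?_ ?_ ?_).mono ?_
  · intro s' hF
    simp only [Expr.val, Expr.Fits, true_and]
    omega
  · simp [enc]
  · rintro i hi s' hF hx ⟨hI1, hI2, hI3⟩
    have v14 : s'.var 14 = h := (hF.var 14 (by decide)).trans (by simp)
    have v15 : s'.var 15 = b := (hF.var 15 (by decide)).trans (by simp [hb])
    have l1 := hpow i (by omega)
    have l2 := hpow (i + 1) (by omega)
    have l3 := hencle (i + 1) (by omega)
    have l4 := hencle i (by omega)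
    rw [enc, sum_range_succ, ← enc] at l3
    rw [pow_succ] at l2
    simp only [wp_seq, wp_assign, wp_store, Expr.val, Expr.Fits, State.var_setVar, State.var_setArr,
      Nat.reduceEqDiff, if_false, if_true, Expr.cost, hx, hI1, hI2, v14, v15, State.arr_setVar,
      State.arr_setArr_same]
    refine ⟨by omega, by omega, ⟨by omega, ⟨by omega, by omega, by omega⟩, by omega⟩,
      ⟨by omega, by omega, by omega⟩, by omega, by rw [pow_succ], ?_, ?_⟩
    · rw [enc, enc, sum_range_succ]
    · intro k hk
      rcases Nat.lt_succ_iff_lt_or_eq.1 hk with hk | rfl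
      · rw [Function.update_of_ne (by omega), hI3 k hk]
      · rw [Function.update_self]
  · rintro t s' ⟨ht, ⟨hI1, hI2, hI3⟩, hF⟩
    simp only [Expr.cost] at ht ⊢
    refine ⟨by omega, (hF.var 14 (by decide)).trans (by simp),
      (hF.var 15 (by decide)).trans (by simp [hb]), hI1, hI2, fun i hi => hI3 i (by omega), ?_⟩
    refine Frame.trans ?_ (hF.mono (by decide) (by decide))
    exact ⟨fun y hy => by simp at hy ⊢; simp [hy], fun a _ => rfl⟩

/-! ### Filling the table -/

/-- `Expr` has no remainder operation; digits are extracted by this identity. -/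
theorem sub_div_mul_eq_mod (a b : ℕ) : a - a / b * b = a % b := by
  have := Nat.div_add_mod a b
  rw [mul_comm] at this
  omega

/-- The digit of variable `17` at the position given by `e`. -/
def digitExpr (e : Expr) : Expr :=
  .sub (.div (.var 17) (.get 7 e)) (.mul (.div (.div (.var 17) (.get 7 e)) (.var 15)) (.var 15))

theorem digitExpr_val (e : Expr) (s : State) :
    (digitExpr e).val s = s.var 17 / s.arr 7 (e.val s) % s.var 15 :=
  sub_div_mul_eq_mod _ _

theorem digitExpr_cost (e : Expr) : (digitExpr e).cost = 2 * e.cost + 11 := by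
  simp only [digitExpr, Expr.cost]
  ring

theorem digitExpr_fits {B : ℕ} {e : Expr} {s : State} (he : e.Fits B s)
    (h7 : s.arr 7 (e.val s) < B) (hx : s.var 17 < B) (hb : s.var 15 < B) :
    (digitExpr e).Fits B s := by
  have h1 : (Expr.div (.var 17) (.get 7 e)).Fits B s := ⟨hx, he, h7⟩
  refine ⟨h1, ⟨h1, hb⟩, hb, ?_⟩
  exact ((Nat.div_mul_le_self _ _).trans (Nat.div_le_self _ _)).trans_lt hx

/-- Compute the entry of the table for the first `j + 1` jobs and position `x`, where `j` and `x`
are variables `3` and `17`. -/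
def cellProg (m : ℕ) : Program :=
  .seq (.assign 18 (.const 0)) (.seq (.assign 19 (.const 0)) (.seq
    (forLoop 4 (.const (m + 1))
      (.ite (.sub (.get 0 (.var 3)) (digitExpr (.var 4))) .skip
        (.ite (.sub (.add (.add (digitExpr (.get 5 (.var 3))) (.get 0 (.var 3))) (.const 1))
            (.var 15)) .skip
          (.seq (.assign 23 (.sub
              (.get 8 (.add (.mul (.var 3) (.var 16))
                (.sub (.add (.var 17) (.mul (.get 0 (.var 3)) (.get 7 (.get 5 (.var 3)))))
                  (.mul (.get 0 (.var 3)) (.get 7 (.var 4))))))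
              (.mul (.sub (.const 1) (.var 4)) (.get 1 (.var 3)))))
            (.ite (.sub (.var 23) (.var 18))
              (.seq (.assign 18 (.var 23)) (.assign 19 (.var 4))) .skip)))))
    (.seq (.store 8 (.add (.mul (.add (.var 3) (.const 1)) (.var 16)) (.var 17)) (.var 18))
      (.store 9 (.add (.mul (.add (.var 3) (.const 1)) (.var 16)) (.var 17)) (.var 19)))))

/-- Machine `c` is a possible choice for the current job, of size `v`, in the state `x`. -/
def CanUse (b v g x c : ℕ) : Prop := v ≤ x / b ^ c % b ∧ x / b ^ g % b + v < b

/-- `best` is the best value of a choice in `D`, and `ch` is a choice that attains it. -/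
def IsBest (b v u g x k : ℕ) (D : ℕ → ℕ) (best ch : ℕ) : Prop :=
  (∀ c < k, CanUse b v g x c → D (x + v * b ^ g - v * b ^ c) - (1 - c) * u ≤ best) ∧
    (best ≠ 0 → ch < k ∧ CanUse b v g x ch ∧
      best = D (x + v * b ^ g - v * b ^ ch) - (1 - ch) * u)

theorem cellProg_spec {B m M W b S j x n : ℕ} {s : State} (hb : 0 < b) (hS : S = b ^ (m + 1))
    (h3 : s.var 3 = j) (h15 : s.var 15 = b) (h16 : s.var 16 = S) (h17 : s.var 17 = x)
    (h7 : ∀ i ≤ m, s.arr 7 i = b ^ i) (hg : s.arr 5 j ≤ m) (hp : s.arr 0 j ≤ M)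
    (hw : s.arr 1 j ≤ M) (h8 : ∀ a, s.arr 8 a ≤ W + 1) (hx : x < S) (hj : j < n)
    (hmB : m + 1 < B) (hWB : W + 1 < B) (hB : (n + 1) * S < B) (hB2 : (M + 1) * S < B)
    (hB3 : b + M < B) :
    WP B (cellProg m) s (fun t s' => t ≤ 100 * m + 200 ∧ (∃ best ch,
      IsBest b (s.arr 0 j) (s.arr 1 j) (s.arr 5 j) x (m + 1) (fun y => s.arr 8 (j * S + y)) best ch ∧
      best ≤ W + 1 ∧
      s'.arr 8 = Function.update (s.arr 8) ((j + 1) * S + x) best ∧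
      s'.arr 9 = Function.update (s.arr 9) ((j + 1) * S + x) ch) ∧
      Frame [18, 19, 4, 23] [8, 9] s s') := by
  have hSpos : 0 < S := by omega
  have hpow : ∀ i ≤ m, b ^ i ≤ S := fun i hi => hS ▸ Nat.pow_le_pow_right hb (by omega)
  have hSB : S < B := by nlinarith
  have hnB : n + 1 < B := lt_of_le_of_lt (Nat.le_mul_of_pos_right _ hSpos) hB
  rw [cellProg, wp_seq, wp_assign]
  refine ⟨by simp only [Expr.Fits]; omega, ?_⟩
  rw [wp_seq, wp_assign]
  refine ⟨by simp only [Expr.Fits]; omega, ?_⟩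
  rw [wp_seq]
  set p := s.arr 0 j with hp'
  set w := s.arr 1 j with hw'
  set g := s.arr 5 j with hg'
  have hjS : (j + 2) * S ≤ (n + 1) * S := Nat.mul_le_mul_right _ (by omega)
  have hjS2 : (j + 2) * S = j * S + S + S := by ring
  have hjS1 : (j + 1) * S = j * S + S := by ring
  have hMS : (M + 1) * S = M * S + S := by ring
  refine (wp_forLoop (T := 85) (m + 1) (fun i s' =>
    IsBest b p w g x i (fun y => s.arr 8 (j * S + y)) (s'.var 18) (s'.var 19) ∧
      s'.var 18 ≤ W + 1 ∧ s'.var 19 ≤ m) hmB (by decide) ?_ ?_ ?_).mono ?_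
  · intro s' hF
    simp only [Expr.val, Expr.Fits, true_and]
    omega
  · simp [IsBest, Expr.val]
  · rintro i hi s' hF hxi ⟨⟨hI1, hI2⟩, hI3, hI4⟩
    have e0 : s'.arr 0 = s.arr 0 := hF.arr 0 (by decide)
    have e1 : s'.arr 1 = s.arr 1 := hF.arr 1 (by decide)
    have e5 : s'.arr 5 = s.arr 5 := hF.arr 5 (by decide)
    have e7 : s'.arr 7 = s.arr 7 := hF.arr 7 (by decide)
    have e8 : s'.arr 8 = s.arr 8 := hF.arr 8 (by decide)
    have v3 : s'.var 3 = j := (hF.var 3 (by decide)).trans (by simpa using h3)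
    have v15 : s'.var 15 = b := (hF.var 15 (by decide)).trans (by simpa using h15)
    have v16 : s'.var 16 = S := (hF.var 16 (by decide)).trans (by simpa using h16)
    have v17 : s'.var 17 = x := (hF.var 17 (by decide)).trans (by simpa using h17)
    have q1 : p * b ^ g ≤ M * S := Nat.mul_le_mul hp (hpow _ hg)
    have q2 : p * b ^ i ≤ M * S := Nat.mul_le_mul hp (hpow _ (by omega))
    have q3 := hpow _ hg
    have q4 := hpow i (by omega)
    have q5 := Nat.mod_lt (x / b ^ g) hb
    have q6 := h8 (j * S + (x + p * b ^ g - p * b ^ i))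
    have q7 : (1 - i) * w ≤ M := by
      calc (1 - i) * w ≤ 1 * M := Nat.mul_le_mul (by omega) hw
        _ = M := one_mul M
    have r7 : s.arr 7 i = b ^ i := h7 i (by omega)
    have r7' : s.arr 7 g = b ^ g := h7 g hg
    have d1 : (digitExpr (.var 4)).Fits B s' := by
      refine digitExpr_fits ?_ ?_ (by omega) (by omega)
      · simp only [Expr.Fits]; omega
      · simp only [Expr.val, hxi, e7, r7]; omega
    have d2 : (digitExpr (.get 5 (.var 3))).Fits B s' := by
      refine digitExpr_fits ?_ ?_ (by omega) (by omega)
      · simp only [Expr.Fits, Expr.val, v3, e5]; omega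
      · simp only [Expr.val, v3, e5, e7, ← hg', r7']; omega
    have nomove : ¬ CanUse b p g x i →
        IsBest b p w g x (i + 1) (fun y => s.arr 8 (j * S + y)) (s'.var 18) (s'.var 19) := by
      refine fun hno => ⟨fun c hc hcan => ?_, fun h => ?_⟩
      · rcases Nat.lt_succ_iff_lt_or_eq.1 hc with hc | rfl
        · exact hI1 c hc hcan
        · exact absurd hcan hno
      · obtain ⟨j1, j2⟩ := hI2 h
        exact ⟨by omega, j2⟩
    simp only [wp_seq, wp_assign, wp_ite, wp_skip, Expr.val, Expr.Fits, State.var_setVar,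
      Nat.reduceEqDiff, if_false, if_true, Expr.cost, digitExpr_val, digitExpr_cost, hxi, v3, v15,
      v16, v17, e0, e1, e5, e7, e8, ← hp', ← hw', ← hg', r7, r7']
    have can : p - x / b ^ i % b = 0 → x / b ^ g % b + p + 1 - b = 0 → CanUse b p g x i :=
      fun h h' => ⟨by omega, by omega⟩
    refine ⟨⟨by omega, d1⟩, fun c1 => ⟨by omega, nomove ?_, hI3, hI4⟩, fun c1 =>
      ⟨⟨⟨⟨d2, by omega, by omega⟩, by omega, by omega⟩, by omega⟩, fun c2 =>
        ⟨by omega, nomove ?_, hI3, hI4⟩, fun c2 => ?_⟩⟩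
    · rintro ⟨k1, -⟩; omega
    · rintro ⟨-, k2⟩; omega
    have hidx := (digit_step (hS ▸ hx) hb (Nat.lt_succ_of_le (show i ≤ m by omega))
      (Nat.lt_succ_of_le hg) (can c1 c2).1 (can c1 c2).2).1
    rw [← hS] at hidx
    refine ⟨by omega, by omega, ?_, ?_⟩
    · refine fun c3 => ⟨by omega, by omega, by omega, ⟨fun c hc hcan => ?_, fun _ =>
        ⟨by omega, can c1 c2, rfl⟩⟩, by omega, by omega⟩
      rcases Nat.lt_succ_iff_lt_or_eq.1 hc with hc | rfl
      · have := hI1 c hc hcan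
        simp only at this ⊢
        omega
      · exact le_rfl
    · refine fun c3 => ⟨by omega, ⟨fun c hc hcan => ?_, fun h => ?_⟩, hI3, hI4⟩
      · rcases Nat.lt_succ_iff_lt_or_eq.1 hc with hc | rfl
        · exact hI1 c hc hcan
        · simp only at c3 ⊢
          omega
      · obtain ⟨j1, j2⟩ := hI2 h
        exact ⟨by omega, j2⟩
  · rintro t s1 ⟨ht, ⟨hI, hI3, hI4⟩, hF1⟩
    have v3 : s1.var 3 = j := (hF1.var 3 (by decide)).trans (by simpa using h3)
    have v16 : s1.var 16 = S := (hF1.var 16 (by decide)).trans (by simpa using h16)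
    have v17 : s1.var 17 = x := (hF1.var 17 (by decide)).trans (by simpa using h17)
    have e8 : s1.arr 8 = s.arr 8 := hF1.arr 8 (by decide)
    have e9 : s1.arr 9 = s.arr 9 := hF1.arr 9 (by decide)
    simp only [wp_seq, wp_store, Expr.val, Expr.Fits, Expr.cost, v3, v16, v17,
      State.var_setArr] at ht ⊢
    refine ⟨⟨⟨⟨by omega, by omega, by omega⟩, by omega, by omega⟩, by omega, by omega⟩, by omega,
      ⟨⟨⟨by omega, by omega, by omega⟩, by omega, by omega⟩, by omega, by omega⟩, by omega,
      by omega, ⟨s1.var 18, s1.var 19, hI, hI3, ?_, ?_⟩, ?_⟩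
    · rw [State.arr_setArr_of_ne _ _ _ (by decide), State.arr_setArr_same, e8]
    · rw [State.arr_setArr_same, State.arr_setArr_of_ne _ _ _ (by decide), e9]
    · refine Frame.trans (Frame.trans ?_ (hF1.mono (V' := [18, 19, 4, 23]) (A' := [8, 9])
        (by decide) (by decide))) ⟨fun y hy => by simp, fun a ha => ?_⟩
      · exact ⟨fun y hy => by simp at hy ⊢; simp [hy], fun a _ => rfl⟩
      · simp only [List.mem_cons, List.not_mem_nil, or_false, not_or] at ha
        rw [State.arr_setArr_of_ne _ _ _ ha.2, State.arr_setArr_of_ne _ _ _ ha.1]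

/-! ### From single entries to the whole table. -/

/-- The choices considered lead only to states inside the window, by `digit_step`, so `D` matters
only there. This makes optimality of an entry robust against writes elsewhere in the array. -/
theorem IsBest.congr {b v u g x K best ch : ℕ} {D D' : ℕ → ℕ} (hb : 0 < b) (hg : g < K)
    (hx : x < b ^ K) (h : ∀ y < b ^ K, D' y = D y) (hD : IsBest b v u g x K D best ch) :
    IsBest b v u g x K D' best ch := by
  refine ⟨fun c hc hcan => ?_, fun hne => ?_⟩
  · rw [h _ (digit_step hx hb hc hg hcan.1 hcan.2).1]
    exact hD.1 c hc hcan
  · obtain ⟨h1, h2, h3⟩ := hD.2 hne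
    rw [h _ (digit_step hx hb h1 hg h2.1 h2.2).1]
    exact ⟨h1, h2, h3⟩

/-- The table is stored in `v` and `c`, layer by layer, and filled up to position `e`. -/
def Filled (K b x₀ W : ℕ) (p w g : ℕ → ℕ) (e : ℕ) (v c : ℕ → ℕ) : Prop :=
  (∀ x < b ^ K, v x = if x = x₀ then W + 1 else 0) ∧
    ∀ l x, x < b ^ K → (l + 1) * b ^ K + x < e →
      IsBest b (p l) (w l) (g l) x K (fun y => v (l * b ^ K + y)) (v ((l + 1) * b ^ K + x))
        (c ((l + 1) * b ^ K + x))

/-- The recursion for an entry reads only the layer below, and the new write hits neither that layer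
nor an entry that is already filled. -/
theorem Filled.extend {K b x₀ W n : ℕ} {p w g : ℕ → ℕ} {v c : ℕ → ℕ} {j x best ch : ℕ} (hb : 0 < b)
    (hg : ∀ l < n, g l < K) (hj : j < n)
    (hF : Filled K b x₀ W p w g ((j + 1) * b ^ K + x) v c) (hx : x < b ^ K)
    (hbest : IsBest b (p j) (w j) (g j) x K (fun y => v (j * b ^ K + y)) best ch) :
    Filled K b x₀ W p w g ((j + 1) * b ^ K + (x + 1))
      (Function.update v ((j + 1) * b ^ K + x) best)
      (Function.update c ((j + 1) * b ^ K + x) ch) := by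
  have hjs : (j + 1) * b ^ K = j * b ^ K + b ^ K := by ring
  refine ⟨fun y hy => ?_, fun l y hy hlt => ?_⟩
  · rw [Function.update_of_ne (by omega)]
    exact hF.1 y hy
  have hls : (l + 1) * b ^ K = l * b ^ K + b ^ K := by ring
  rcases Nat.lt_trichotomy l j with h | rfl | h
  · have h1 : (l + 1) * b ^ K ≤ j * b ^ K := Nat.mul_le_mul_right _ h
    rw [Function.update_of_ne (by omega), Function.update_of_ne (by omega)]
    refine (hF.2 l y hy (by omega)).congr hb (hg l (by omega)) hy fun z hz => ?_
    rw [Function.update_of_ne (by omega)]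
  · by_cases hyx : y = x
    · subst hyx
      rw [Function.update_self, Function.update_self]
      refine hbest.congr hb (hg l hj) hy fun z hz => ?_
      rw [Function.update_of_ne (by omega)]
    · rw [Function.update_of_ne (by omega), Function.update_of_ne (by omega)]
      refine (hF.2 l y hy (by omega)).congr hb (hg l hj) hy fun z hz => ?_
      rw [Function.update_of_ne (by omega)]
  · have h1 : (j + 1 + 1) * b ^ K ≤ (l + 1) * b ^ K := Nat.mul_le_mul_right _ (by omega)
    have h2 : (j + 1 + 1) * b ^ K = j * b ^ K + b ^ K + b ^ K := by ring
    omega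

theorem Filled.isTable {K b h W n : ℕ} {p w g : ℕ → ℕ} {v c : ℕ → ℕ}
    (hF : Filled K b (enc b K fun _ => h) W p w g ((n + 1) * b ^ K) v c) :
    IsTable n K b h W p w g (fun l x => v (l * b ^ K + x)) (fun l x => c (l * b ^ K + x)) := by
  have hlt : ∀ l < n, ∀ x < b ^ K, (l + 1) * b ^ K + x < (n + 1) * b ^ K := by
    intro l hl x hx
    have h1 : (l + 1 + 1) * b ^ K ≤ (n + 1) * b ^ K := Nat.mul_le_mul_right _ (by omega)
    have h2 : (l + 1 + 1) * b ^ K = (l + 1) * b ^ K + b ^ K := by ring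
    omega
  refine ⟨fun x hx => ?_, fun l hl x hx c' hc h1 h2 => ?_, fun l hl x hx hne => ?_⟩
  · simpa using hF.1 x hx
  · exact (hF.2 l x hx (hlt l hl x hx)).1 c' hc ⟨h1, h2⟩
  · obtain ⟨h1, h2, h3⟩ := (hF.2 l x hx (hlt l hl x hx)).2 hne
    exact ⟨h1, h2.1, h2.2, h3⟩

def fillProg (m : ℕ) : Program :=
  .seq (.store 8 (.var 20) (.add (.var 1) (.const 1)))
    (forLoop 3 (.var 0) (forLoop 17 (.var 16) (cellProg m)))

theorem cellProg_wv (m : ℕ) : (cellProg m).wv = [18, 19, 4, 23, 18, 19, 4] := rfl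

theorem cellProg_wa (m : ℕ) : (cellProg m).wa = [8, 9] := rfl

theorem fillProg_spec {B m M W b S n x₀ : ℕ} {s : State} (hb : 0 < b) (hS : S = b ^ (m + 1))
    (h0 : s.var 0 = n) (h1 : s.var 1 = W) (h15 : s.var 15 = b) (h16 : s.var 16 = S)
    (h20 : s.var 20 = x₀) (hx₀ : x₀ < S)
    (h7 : ∀ i ≤ m, s.arr 7 i = b ^ i) (hg : ∀ j < n, s.arr 5 j ≤ m) (hp : ∀ j < n, s.arr 0 j ≤ M)
    (hw : ∀ j < n, s.arr 1 j ≤ M) (h8 : s.arr 8 = fun _ => 0)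
    (hmB : m + 1 < B) (hWB : W + 1 < B) (hB : (n + 1) * S < B) (hB2 : (M + 1) * S < B)
    (hB3 : b + M < B) :
    WP B (fillProg m) s (fun t s' => t ≤ n * (S * (100 * m + 210) + 20) + 20 ∧
      Filled (m + 1) b x₀ W (s.arr 0) (s.arr 1) (s.arr 5) ((n + 1) * S) (s'.arr 8) (s'.arr 9) ∧
      (∀ a, s'.arr 8 a ≤ W + 1) ∧
      Frame [3, 17, 18, 19, 4, 23] [8, 9] s s') := by
  have hSB : S < B := by nlinarith
  have hnB : n + 1 < B := lt_of_le_of_lt (Nat.le_mul_of_pos_right _ (by omega)) hB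
  rw [fillProg, wp_seq, wp_store]
  simp only [Expr.val, Expr.Fits, h1, h20, Expr.cost]
  refine ⟨by omega, by omega, ?_⟩
  have hF0 : Frame [3, 17, 18, 19, 4, 23] [8, 9] s (s.setArr 8 x₀ (W + 1)) :=
    ⟨fun y hy => rfl, fun a ha => by
      simp only [List.mem_cons, List.not_mem_nil, or_false, not_or] at ha
      rw [State.arr_setArr_of_ne _ _ _ ha.1]⟩
  refine (wp_forLoop (T := S * (100 * m + 210) + 10) n (fun j s' =>
    Filled (m + 1) b x₀ W (s.arr 0) (s.arr 1) (s.arr 5) ((j + 1) * S) (s'.arr 8) (s'.arr 9) ∧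
      ∀ a, s'.arr 8 a ≤ W + 1) (by omega) (by simp [forLoop, Program.wv, cellProg_wv]) ?_ ?_ ?_).mono ?_
  · intro s' hF
    have := (hF.var 0 (by simp [forLoop, Program.wv, cellProg_wv])).trans h0
    simp only [Expr.val, Expr.Fits]
    omega
  · simp only [State.arr_setVar, State.arr_setArr_same, h8]
    refine ⟨⟨fun x hx => ?_, fun l x hx hlt => ?_⟩, fun a => ?_⟩
    · rw [Function.update_apply]
    · have : 1 * S ≤ (l + 1) * b ^ (m + 1) := hS ▸ Nat.mul_le_mul_right _ (by omega)
      omega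
    · rw [Function.update_apply]
      split_ifs <;> omega
  · rintro j hj s1 hF1 hx1 ⟨hI1, hI2⟩
    have hFa : Frame [3, 17, 18, 19, 4, 23] [8, 9] s s1 := hF0.trans (hF1.mono
      (by simp [forLoop, Program.wv, cellProg_wv])
      (by simp [forLoop, Program.wa, cellProg_wa]))
    refine (wp_forLoop (T := 100 * m + 200) S (fun x s' =>
      Filled (m + 1) b x₀ W (s.arr 0) (s.arr 1) (s.arr 5) ((j + 1) * S + x) (s'.arr 8) (s'.arr 9) ∧
      ∀ a, s'.arr 8 a ≤ W + 1) (by omega) (by simp [cellProg_wv]) ?_ ?_ ?_).mono ?_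
    · intro s' hF
      have e1 : s1.var 16 = S := (hFa.var 16 (by decide)).trans h16
      have := (hF.var 16 (by simp [cellProg_wv])).trans e1
      simp only [Expr.val, Expr.Fits]
      omega
    · exact ⟨hI1, hI2⟩
    · rintro x hx s2 hF2 hx2 ⟨hJ1, hJ2⟩
      have hFb : Frame [3, 17, 18, 19, 4, 23] [8, 9] s s2 := hFa.trans (hF2.mono
        (by simp [cellProg_wv]) (by simp [cellProg_wa]))
      have e0 : s2.arr 0 = s.arr 0 := hFb.arr 0 (by decide)
      have e1 : s2.arr 1 = s.arr 1 := hFb.arr 1 (by decide)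
      have e5 : s2.arr 5 = s.arr 5 := hFb.arr 5 (by decide)
      have e7 : s2.arr 7 = s.arr 7 := hFb.arr 7 (by decide)
      have v3 : s2.var 3 = j := (hF2.var 3 (by simp [cellProg_wv])).trans hx1
      refine (cellProg_spec (M := M) (W := W) (n := n) hb hS v3
        ((hFb.var 15 (by decide)).trans h15) ((hFb.var 16 (by decide)).trans h16) hx2
        (by rw [e7]; exact h7) (by rw [e5]; exact hg j hj) (by rw [e0]; exact hp j hj)
        (by rw [e1]; exact hw j hj) hJ2 hx hj hmB hWB hB hB2 hB3).mono ?_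
      rintro t s3 ⟨ht, ⟨best, ch, hbest, hle, e8, e9⟩, -⟩
      rw [e0, e1, e5] at hbest
      refine ⟨ht, ?_, ?_⟩
      · simp only [State.arr_setVar]
        rw [e8, e9, hS]
        rw [hS] at hJ1 hx hbest
        exact hJ1.extend hb (fun l hl => Nat.lt_succ_of_le (hg l hl)) hj hx hbest
      · intro a
        simp only [State.arr_setVar]
        rw [e8, Function.update_apply]
        split_ifs
        · exact hle
        · exact hJ2 a
    · rintro t s2 ⟨ht, ⟨hJ1, hJ2⟩, -⟩
      simp only [Expr.cost] at ht
      have : S * (100 * m + 200 + 1 + 9) = S * (100 * m + 210) := by ring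
      refine ⟨by omega, ?_, hJ2⟩
      simp only [State.arr_setVar]
      rw [show (j + 1 + 1) * S = (j + 1) * S + S by ring]
      exact hJ1
  · rintro t s' ⟨ht, ⟨hI1, hI2⟩, hF⟩
    simp only [Expr.cost] at ht
    refine ⟨?_, hI1, hI2, hF0.trans (hF.mono (by simp [forLoop, Program.wv, cellProg_wv])
      (by simp [forLoop, Program.wa, cellProg_wa]))⟩
    have : n * (S * (100 * m + 210) + 10 + 1 + 9) = n * (S * (100 * m + 210) + 20) := by ring
    omega

/-! ### Choosing the best final state -/

/-- The scaled makespan in the final state `x`. -/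
def finalCost (m b h : ℕ) (c L : ℕ → ℕ) (x : ℕ) : ℕ :=
  (range m).sup fun i => c (i + 1) * (L (i + 1) + x / b ^ (i + 1) % b - h)

/-- Variable `18` holds the best cost plus one, so that `0` means that no reachable final state has
been seen. The sum of two truncated differences implements a disjunction: nothing found yet, or a
strict improvement. -/
def finalProg (m : ℕ) : Program :=
  .seq (.assign 18 (.const 0)) (.seq (.assign 22 (.const 0))
    (forLoop 17 (.var 16) (.ite (.get 8 (.add (.mul (.var 0) (.var 16)) (.var 17)))
      (.seq (.assign 21 (.const 0)) (.seq
        (forLoop 4 (.const m) (.seq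
          (.assign 23 (.mul (.get 10 (.add (.var 4) (.const 1)))
            (.sub (.add (.get 6 (.add (.var 4) (.const 1)))
              (digitExpr (.add (.var 4) (.const 1)))) (.var 14))))
          (.ite (.sub (.var 23) (.var 21)) (.assign 21 (.var 23)) .skip)))
        (.ite (.add (.sub (.const 1) (.var 18)) (.sub (.var 18) (.add (.var 21) (.const 1))))
          (.seq (.assign 18 (.add (.var 21) (.const 1))) (.assign 22 (.var 17))) .skip)))
      .skip)))

theorem finalProg_spec {B m W b h S n C A : ℕ} {s : State} (hb : 0 < b) (hS : S = b ^ (m + 1))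
    (h0 : s.var 0 = n) (h14 : s.var 14 = h) (h15 : s.var 15 = b) (h16 : s.var 16 = S)
    (h7 : ∀ i ≤ m, s.arr 7 i = b ^ i) (h8 : ∀ a, s.arr 8 a ≤ W + 1)
    (hc : ∀ i < m, s.arr 10 (i + 1) ≤ C) (hL : ∀ i < m, s.arr 6 (i + 1) ≤ A)
    (hex : ∃ x < S, s.arr 8 (n * S + x) ≠ 0)
    (hmB : m + 1 < B) (hWB : W + 1 < B) (hhB : h < B) (hB : (n + 1) * S < B) (hAB : A + b < B)
    (hCB : C < B) (hCAB : C * (A + b) + 1 < B) :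
    WP B (finalProg m) s (fun t s' => t ≤ S * (80 * m + 80) + 20 ∧ s'.var 22 < S ∧
      s.arr 8 (n * S + s'.var 22) ≠ 0 ∧
      (∀ x < S, s.arr 8 (n * S + x) ≠ 0 →
        finalCost m b h (s.arr 10) (s.arr 6) (s'.var 22) ≤
          finalCost m b h (s.arr 10) (s.arr 6) x) ∧
      Frame [18, 22, 17, 21, 4, 23] [] s s') := by
  have hSpos : 0 < S := hS ▸ pow_pos hb _
  have hSB : S < B := by nlinarith
  have hnB : n + 1 < B := lt_of_le_of_lt (Nat.le_mul_of_pos_right _ hSpos) hB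
  have hpow : ∀ i ≤ m, b ^ i ≤ S := fun i hi => hS ▸ Nat.pow_le_pow_right hb (by omega)
  set F : ℕ → ℕ := finalCost m b h (s.arr 10) (s.arr 6) with hF'
  have hterm : ∀ x, ∀ i < m, s.arr 10 (i + 1) * (s.arr 6 (i + 1) + x / b ^ (i + 1) % b - h) ≤
      C * (A + b) := by
    intro x i hi
    have := Nat.mod_lt (x / b ^ (i + 1)) hb
    have := hL i hi
    exact Nat.mul_le_mul (hc i hi) (by omega)
  have hFle : ∀ x, F x ≤ C * (A + b) := fun x =>
    Finset.sup_le fun i hi => hterm x i (by simpa using hi)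
  rw [finalProg, wp_seq, wp_assign]
  refine ⟨by simp only [Expr.Fits]; omega, ?_⟩
  rw [wp_seq, wp_assign]
  refine ⟨by simp only [Expr.Fits]; omega, ?_⟩
  have hF0 : Frame [18, 22, 17, 21, 4, 23] [] s ((s.setVar 18 (Expr.val s (.const 0))).setVar 22
      (Expr.val (s.setVar 18 (Expr.val s (.const 0))) (.const 0))) :=
    ⟨fun y hy => by simp at hy ⊢; simp [hy], fun a ha => rfl⟩
  refine (wp_forLoop (T := 80 * m + 60) S (fun x s' =>
    (s'.var 18 = 0 → ∀ y < x, s.arr 8 (n * S + y) = 0) ∧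
    (s'.var 18 ≠ 0 → s'.var 22 < S ∧ s.arr 8 (n * S + s'.var 22) ≠ 0 ∧
      s'.var 18 = F (s'.var 22) + 1 ∧ ∀ y < x, s.arr 8 (n * S + y) ≠ 0 → F (s'.var 22) ≤ F y))
    hSB (by simp [forLoop, Program.wv]) ?_ ?_ ?_).mono ?_
  · intro s' hF
    have := (hF.var 16 (by simp [forLoop, Program.wv])).trans (hF0.var 16 (by decide))
    simp only [Expr.val, Expr.Fits]
    omega
  · simp [Expr.val]
  · rintro x hx s1 hF1 hx1 ⟨hI1, hI2⟩
    have hFa : Frame [18, 22, 17, 21, 4, 23] [] s s1 :=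
      hF0.trans (hF1.mono (by simp [forLoop, Program.wv]) (by simp [forLoop, Program.wa]))
    have v0 : s1.var 0 = n := (hFa.var 0 (by decide)).trans h0
    have v16 : s1.var 16 = S := (hFa.var 16 (by decide)).trans h16
    have e8 : s1.arr 8 = s.arr 8 := hFa.arr 8 (by decide)
    have q1 := h8 (n * S + x)
    have q2 : (n + 1) * S = n * S + S := by ring
    simp only [wp_ite, wp_skip, Expr.val, Expr.Fits, v0, v16, hx1, e8, Expr.cost]
    refine ⟨by omega, fun c1 => ?_, fun c1 => ⟨by omega, fun h18 y hy => ?_, fun h18 => ?_⟩⟩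
    · rw [wp_seq, wp_assign]
      refine ⟨by simp only [Expr.Fits]; omega, ?_⟩
      simp only [Expr.val, Expr.cost]
      have hFa' : Frame [18, 22, 17, 21, 4, 23] [] s (s1.setVar 21 0) :=
        hFa.trans ⟨fun y hy => by simp at hy ⊢; simp [hy], fun a ha => rfl⟩
      rw [wp_seq]
      refine (wp_forLoop (T := 45) m (fun i s' => s'.var 21 = (range i).sup fun i =>
        s.arr 10 (i + 1) * (s.arr 6 (i + 1) + x / b ^ (i + 1) % b - h)) (by omega) (by decide)
        ?_ ?_ ?_).mono ?_
      · intro s' hF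
        simp only [Expr.val, Expr.Fits, true_and]
        omega
      · simp
      · rintro i hi s2 hF2 hx2 hJ
        have hFb : Frame [18, 22, 17, 21, 4, 23] [] s s2 :=
          hFa'.trans (hF2.mono (by decide) (by decide))
        have e6 : s2.arr 6 = s.arr 6 := hFb.arr 6 (by decide)
        have e7 : s2.arr 7 = s.arr 7 := hFb.arr 7 (by decide)
        have e10 : s2.arr 10 = s.arr 10 := hFb.arr 10 (by decide)
        have v14 : s2.var 14 = h := (hFb.var 14 (by decide)).trans h14
        have v15 : s2.var 15 = b := (hFb.var 15 (by decide)).trans h15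
        have v17 : s2.var 17 = x := (hF2.var 17 (by decide)).trans (by simpa using hx1)
        have r1 := hc i hi
        have r2 := hL i hi
        have r3 := h7 (i + 1) hi
        have r4 := hpow (i + 1) hi
        have r5 := hterm x i hi
        have r6 := Nat.mod_lt (x / b ^ (i + 1)) hb
        have r7 : (range i).sup (fun i =>
          s.arr 10 (i + 1) * (s.arr 6 (i + 1) + x / b ^ (i + 1) % b - h)) ≤ C * (A + b) :=
          Finset.sup_le fun k hk => hterm x k (by simp at hk; omega)
        have d1 : (digitExpr (.add (.var 4) (.const 1))).Fits B s2 := by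
          refine digitExpr_fits ?_ ?_ (by omega) (by omega)
          · simp only [Expr.Fits, Expr.val, hx2]; omega
          · simp only [Expr.val, hx2, e7, r3]; omega
        simp only [wp_seq, wp_assign, wp_ite, wp_skip, Expr.val, Expr.Fits, State.var_setVar,
          Nat.reduceEqDiff, if_false, if_true, Expr.cost, digitExpr_val, digitExpr_cost, hx2, v14,
          v15, v17, e6, e7, e10, hJ, r3, range_add_one, sup_insert]
        refine ⟨⟨by omega, ⟨⟨by omega, d1, by omega⟩, by omega⟩, by omega⟩, by omega,
          fun c2 => ⟨by omega, by omega, ?_⟩, fun c2 => ⟨by omega, ?_⟩⟩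
        · exact (max_eq_left (by omega)).symm
        · exact (max_eq_right (by omega)).symm
      · rintro t s2 ⟨ht, hJ, hF2⟩
        have v18 : s2.var 18 = s1.var 18 := (hF2.var 18 (by decide)).trans (by simp)
        have v22 : s2.var 22 = s1.var 22 := (hF2.var 22 (by decide)).trans (by simp)
        have v17 : s2.var 17 = x := (hF2.var 17 (by decide)).trans (by simpa using hx1)
        have hJ : s2.var 21 = F x := hJ
        have r1 := hFle x
        have r2 : s1.var 18 ≤ C * (A + b) + 1 := by
          by_cases h18 : s1.var 18 = 0
          · omega
          · have := hFle (s1.var 22)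
            have := (hI2 h18).2.2.1
            omega
        simp only [wp_seq, wp_assign, wp_ite, wp_skip, Expr.val, Expr.Fits, State.var_setVar,
          Nat.reduceEqDiff, if_false, if_true, Expr.cost, hJ, v18, v22, v17] at ht ⊢
        refine ⟨by omega, fun c2 => ⟨by omega, by omega, by omega, fun h18 => h18.elim,
          fun _ => ⟨hx, c1, trivial, fun y hy hne => ?_⟩⟩, fun c2 => ⟨by omega, fun h18 => by omega,
          fun h18 => ?_⟩⟩
        · rcases Nat.lt_succ_iff_lt_or_eq.1 hy with hy | rfl
          · by_cases h18 : s1.var 18 = 0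
            · exact absurd (hI1 h18 y hy) hne
            · obtain ⟨-, -, j3, j4⟩ := hI2 h18
              have := j4 y hy hne
              omega
          · exact le_rfl
        · obtain ⟨j1, j2, j3, j4⟩ := hI2 h18
          refine ⟨j1, j2, j3, fun y hy hne => ?_⟩
          rcases Nat.lt_succ_iff_lt_or_eq.1 hy with hy | rfl
          · exact j4 y hy hne
          · omega
    · simp only [State.var_setVar, Nat.reduceEqDiff, if_false] at h18
      rcases Nat.lt_succ_iff_lt_or_eq.1 hy with hy | rfl
      · exact hI1 h18 y hy
      · exact c1
    · simp only [State.var_setVar, Nat.reduceEqDiff, if_false] at h18 ⊢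
      obtain ⟨j1, j2, j3, j4⟩ := hI2 h18
      refine ⟨j1, j2, j3, fun y hy hne => ?_⟩
      rcases Nat.lt_succ_iff_lt_or_eq.1 hy with hy | rfl
      · exact j4 y hy hne
      · exact absurd c1 hne
  · rintro t s' ⟨ht, ⟨hI1, hI2⟩, hF⟩
    simp only [Expr.cost] at ht ⊢
    obtain ⟨x, hx, hne⟩ := hex
    have h18 : s'.var 18 ≠ 0 := fun h => hne (hI1 h x hx)
    obtain ⟨j1, j2, -, j4⟩ := hI2 h18
    refine ⟨?_, j1, j2, j4, hF0.trans (hF.mono (by simp [forLoop, Program.wv])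
      (by simp [forLoop, Program.wa]))⟩
    have : S * (80 * m + 60 + 1 + 9) ≤ S * (80 * m + 80) := Nat.mul_le_mul_left _ (by omega)
    omega

/-! ### Reading off the schedule -/

theorem IsTable.pred {n K b h W : ℕ} {p w g : ℕ → ℕ} {val ch : ℕ → ℕ → ℕ}
    (hT : IsTable n K b h W p w g val ch) (hb : b = 2 * h + 1) (hg : ∀ l < n, g l < K) {l x : ℕ}
    (hl : l < n) (hx : x < b ^ K) (hv : val (l + 1) x ≠ 0) :
    ch (l + 1) x < K ∧ x + p l * b ^ g l - p l * b ^ ch (l + 1) x < b ^ K ∧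
      val l (x + p l * b ^ g l - p l * b ^ ch (l + 1) x) ≠ 0 := by
  obtain ⟨e1, e2, e3, e4⟩ := hT.eq l hl _ hx hv
  exact ⟨e1, (digit_step hx (by omega) e1 (hg l hl) e2 e3).1, by omega⟩

def backProg : Program :=
  forLoop 24 (.var 0)
    (.seq (.assign 3 (.sub (.sub (.var 0) (.var 24)) (.const 1)))
    (.seq (.assign 19 (.get 9 (.add (.mul (.add (.var 3) (.const 1)) (.var 16)) (.var 22))))
    (.seq (.store 4 (.var 3) (.var 19))
    (.assign 22 (.sub (.add (.var 22) (.mul (.get 0 (.var 3)) (.get 7 (.get 5 (.var 3)))))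
      (.mul (.get 0 (.var 3)) (.get 7 (.var 19))))))))

theorem backProg_spec {B m M W b h S n : ℕ} {w : ℕ → ℕ} {val ch : ℕ → ℕ → ℕ} {s : State}
    (hT : IsTable n (m + 1) b h W (s.arr 0) w (s.arr 5) val ch) (hb : b = 2 * h + 1)
    (hS : S = b ^ (m + 1)) (hch : ∀ l x, ch l x = s.arr 9 (l * S + x))
    (h0 : s.var 0 = n) (h16 : s.var 16 = S) (h7 : ∀ i ≤ m, s.arr 7 i = b ^ i)
    (hg : ∀ j < n, s.arr 5 j ≤ m) (hp : ∀ j < n, s.arr 0 j ≤ M)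
    (hx : s.var 22 < S) (hv : val n (s.var 22) ≠ 0)
    (hmB : m + 1 < B) (hB : (n + 1) * S < B) (hB2 : (M + 1) * S < B) :
    WP B backProg s (fun t s' => t ≤ 60 * n + 20 ∧ ∃ X : ℕ → ℕ, X n = s.var 22 ∧
      (∀ l < n, X l = X (l + 1) + s.arr 0 l * b ^ s.arr 5 l - s.arr 0 l * b ^ s'.arr 4 l) ∧
      ∀ l < n, s'.arr 4 l = ch (l + 1) (X (l + 1))) := by
  have hSpos : 0 < S := by omega
  have hSB : S < B := by nlinarith
  have hnB : n + 1 < B := lt_of_le_of_lt (Nat.le_mul_of_pos_right _ hSpos) hB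
  have hMB : M < B := lt_of_le_of_lt ((Nat.le_succ M).trans (Nat.le_mul_of_pos_right _ hSpos)) hB2
  have hpow : ∀ i ≤ m, b ^ i ≤ S := fun i hi => hS ▸ Nat.pow_le_pow_right (by omega) (by omega)
  have hg' : ∀ j < n, s.arr 5 j < m + 1 := fun j hj => Nat.lt_succ_of_le (hg j hj)
  let stp : ℕ → ℕ → ℕ := fun l x =>
    x + s.arr 0 l * b ^ s.arr 5 l - s.arr 0 l * b ^ ch (l + 1) x
  -- `Y k` is the state after `k` steps back from the last layer; the required sequence is `X l = Y
  -- (n - l)`.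
  let Y : ℕ → ℕ := fun k => Nat.rec (s.var 22) (fun k y => stp (n - k - 1) y) k
  have hY0 : Y 0 = s.var 22 := rfl
  have hYs : ∀ k, Y (k + 1) = stp (n - k - 1) (Y k) := fun k => rfl
  have hY : ∀ k ≤ n, Y k < S ∧ val (n - k) (Y k) ≠ 0 := by
    intro k
    induction k with
    | zero => exact fun _ => ⟨hx, hv⟩
    | succ k ih =>
      intro hk
      obtain ⟨i1, i2⟩ := ih (by omega)
      have e : n - k = n - k - 1 + 1 := by omega
      rw [e] at i2
      obtain ⟨-, j2, j3⟩ := hT.pred hb hg' (by omega) (hS ▸ i1) i2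
      rw [hYs, show n - (k + 1) = n - k - 1 by omega]
      exact ⟨hS ▸ j2, j3⟩
  refine (wp_forLoop (T := 45) n (fun i s' => s'.var 22 = Y i ∧
    ∀ l < n, n - i ≤ l → s'.arr 4 l = ch (l + 1) (Y (n - l - 1))) (by omega) (by decide)
    ?_ ?_ ?_).mono ?_
  · intro s' hF
    have := (hF.var 0 (by decide)).trans h0
    simp only [Expr.val, Expr.Fits]
    omega
  · refine ⟨by simp [hY0], fun l h1 h2 => by omega⟩
  · rintro i hi s' hF hxi ⟨hI1, hI2⟩
    have v0 : s'.var 0 = n := (hF.var 0 (by decide)).trans h0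
    have v16 : s'.var 16 = S := (hF.var 16 (by decide)).trans h16
    have e0 : s'.arr 0 = s.arr 0 := hF.arr 0 (by decide)
    have e5 : s'.arr 5 = s.arr 5 := hF.arr 5 (by decide)
    have e7 : s'.arr 7 = s.arr 7 := hF.arr 7 (by decide)
    have e9 : s'.arr 9 = s.arr 9 := hF.arr 9 (by decide)
    obtain ⟨i1, i2⟩ := hY i hi.le
    obtain ⟨l, hl⟩ : ∃ l, l = n - i - 1 := ⟨_, rfl⟩
    have hln : l < n := by omega
    rw [show n - i = l + 1 by omega] at i2
    have j1 := (hT.pred hb hg' hln (hS ▸ i1) i2).1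
    have q1 : s.arr 9 ((l + 1) * S + Y i) = ch (l + 1) (Y i) := (hch _ _).symm
    have q2 := hp l hln
    have q3 := hg l hln
    have q4 := h7 _ q3
    have q5 := h7 (ch (l + 1) (Y i)) (by omega)
    have q6 := hpow _ q3
    have q7 := hpow (ch (l + 1) (Y i)) (by omega)
    have q8 : s.arr 0 l * b ^ s.arr 5 l ≤ M * S := Nat.mul_le_mul q2 q6
    have q9 : s.arr 0 l * b ^ ch (l + 1) (Y i) ≤ M * S := Nat.mul_le_mul q2 q7
    have q10 : (M + 1) * S = M * S + S := by ring
    have q11 : (l + 2) * S ≤ (n + 1) * S := Nat.mul_le_mul_right _ (by omega)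
    have q12 : (l + 2) * S = (l + 1) * S + S := by ring
    simp only [wp_seq, wp_assign, wp_store, Expr.val, Expr.Fits, State.var_setVar,
      State.var_setArr, State.arr_setVar, Nat.reduceEqDiff, if_false, if_true, Expr.cost, hxi, hI1,
      v0, v16, e9, ← hl, q1, State.arr_setArr_of_ne _ _ _ (show 0 ≠ 4 by decide),
      State.arr_setArr_of_ne _ _ _ (show 5 ≠ 4 by decide),
      State.arr_setArr_of_ne _ _ _ (show 7 ≠ 4 by decide), e0, e5, e7, q4, q5,
      State.arr_setArr_same]
    refine ⟨by omega, by omega, by omega, by omega, by omega, by omega, ?_, ?_⟩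
    · rw [hYs, ← hl]
    · intro k hk hk'
      by_cases hkl : k = l
      · subst hkl
        rw [Function.update_self]
        congr 2
        omega
      · rw [Function.update_of_ne hkl]
        exact hI2 k hk (by omega)
  · rintro t s' ⟨ht, ⟨-, hI2⟩, -⟩
    simp only [Expr.cost] at ht
    have hcode : ∀ l < n, s'.arr 4 l = ch (l + 1) (Y (n - (l + 1))) := fun l hl =>
      hI2 l hl (by omega)
    refine ⟨by omega, fun l => Y (n - l), by simp [hY0], fun l hl => ?_, hcode⟩
    have := hYs (n - (l + 1))
    rw [show n - (l + 1) + 1 = n - l by omega, show n - (n - (l + 1)) - 1 = l by omega] at this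
    rw [hcode l hl]
    exact this

/-! ### The guide as a schedule -/

/-- The number that represents a machine or a rejection. -/
def code {m : ℕ} (o : Option (Fin m)) : ℕ := o.elim 0 (fun i => (i : ℕ) + 1)

theorem code_le {m : ℕ} (o : Option (Fin m)) : code o ≤ m := by
  cases o with
  | none => exact Nat.zero_le _
  | some i => exact i.2

theorem code_injective {m : ℕ} : Function.Injective (code (m := m)) := by
  intro o o' h
  cases o <;> cases o' <;> simp [code, Fin.ext_iff] at h ⊢
  exact h

theorem exists_code {m k : ℕ} (hk : k ≤ m) : ∃ o : Option (Fin m), code o = k := by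
  cases k with
  | zero => exact ⟨none, rfl⟩
  | succ k => exact ⟨some ⟨k, hk⟩, rfl⟩

theorem tot_eq_pre {n m : ℕ} (q f : ℕ → ℕ) (σ : Fin n → Option (Fin m))
    (h : ∀ j : Fin n, f j = code (σ j)) (o : Option (Fin m)) :
    tot (fun j : Fin n => q j) σ o = pre q f (code o) n := by
  rw [tot, pre, sum_filter, Finset.sum_range]
  refine sum_congr rfl fun j _ => ?_
  rw [h j]
  simp only [code_injective.eq_iff]

/-- Rejected jobs have ratio at most u / v and accepted jobs of positive size at least u / v, which
yields the ratio rule after cancelling `v`. The invariant counts reserved and actual rejections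
separately; after the last job they agree. -/
theorem GuideInv.isGuide {n m W M v u : ℕ} {p w c g L : ℕ → ℕ} {acc : ℕ}
    (h : GuideInv m W M v u (strictWeight p w n v u) p w c n g L acc)
    (hth : IsThreshold p w n W v u ∨ v = 0 ∧ u = 1) (hw : ∀ j < n, w j ≤ M)
    (G : Fin n → Option (Fin m)) (hG : ∀ j : Fin n, g j = code (G j)) :
    IsGuide (fun j : Fin n => p j) (fun j : Fin n => w j) W M (fun i : Fin m => c (i + 1)) G := by
  have hnone : ∀ j : Fin n, G j = none ↔ g j = 0 := fun j => by
    rw [hG j]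
    constructor
    · intro h; rw [h]; rfl
    · intro h; exact code_injective (h.trans rfl)
  have hacc : acc = pre w g 0 n := by
    have := h.acc_eq
    rw [← strictWeight] at this
    omega
  have hrej : tot (fun j : Fin n => w j) G none = acc := by
    rw [tot_eq_pre w g G hG, hacc]
    rfl
  have hload : ∀ i : Fin m, tot (fun j : Fin n => p j) G (some i) = L (i + 1) := fun i => by
    rw [tot_eq_pre p g G hG, h.load i i.2]
    rfl
  -- For `u = 0` no job lies below the ratio and the jobs at the ratio have weight zero, so it would
  -- not be a threshold.
  have hu : 0 < u := by
    rcases hth with ⟨h1, -, h3⟩ | ⟨-, rfl⟩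
    · by_contra h0
      have h0 : u = 0 := by omega
      subst h0
      have e1 : strictWeight p w n v 0 = 0 := sum_eq_zero fun j _ => by simp
      have e2 : equalWeight p w n v 0 = 0 := sum_eq_zero fun j _ => by
        simp only [mul_zero]
        split_ifs with hc
        · exact (Nat.mul_eq_zero.1 hc.2.symm).resolve_left h1.ne'
        · rfl
      omega
    · exact one_pos
  refine ⟨fun j hj => ?_, fun j hj hpj => ?_, fun j k hj hk hpk => ?_, ?_, fun j hj hpj => ?_,
    fun i k => ?_⟩
  · rw [Ne, hnone]
    intro h0
    have := (h.lax j j.2 h0).1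
    omega
  · rw [Ne, hnone] at hj
    by_contra h0
    refine hj (h.strict j j.2 hpj ?_)
    have h0 : w j = 0 := by omega
    rw [h0, mul_zero]
    exact Nat.mul_pos hpj hu
  · rw [hnone] at hj
    rw [Ne, hnone] at hk
    have h1 := (h.lax j j.2 hj).2
    have h2 : p k * u ≤ v * w k := by
      by_contra! hlt
      exact hk (h.strict k k.2 hpk hlt)
    have hv : 0 < v := by
      rcases Nat.eq_zero_or_pos v with rfl | hv
      · have := Nat.mul_pos hpk hu
        omega
      · exact hv
    refine Nat.le_of_mul_le_mul_left ?_ hv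
    calc v * (p k * w j) = p k * (v * w j) := by ring
      _ ≤ p k * (p j * u) := Nat.mul_le_mul_left _ h1
      _ = p j * (p k * u) := by ring
      _ ≤ p j * (v * w k) := Nat.mul_le_mul_left _ h2
      _ = v * (p j * w k) := by ring
  · rw [hrej]
    exact h.acc_le
  · rw [hrej]
    rw [Ne, hnone] at hj
    rcases hth with ⟨-, -, h3⟩ | ⟨rfl, rfl⟩
    -- If more than `M` of the budget were left, every job of the threshold ratio would have fitted;
    -- then all of them would be rejected, against the definition of a threshold.
    · by_contra! hlt
      have hall : ∀ k < n, 0 < p k → p k * u = v * w k → g k = 0 := by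
        intro k hk hpk hkeq
        by_contra hne
        have := h.full k hk hpk hkeq hne
        have := hw k hk
        omega
      have : strictWeight p w n v u + equalWeight p w n v u ≤ pre w g 0 n := by
        rw [strictWeight, equalWeight, pre, ← sum_add_distrib]
        refine sum_le_sum fun k hk => ?_
        have hk := mem_range.1 hk
        have a1 := h.strict k hk
        have a2 := hall k hk
        by_cases g0 : g k = 0
        · rw [if_pos g0]
          split_ifs <;> omega
        · rw [if_neg (fun hc => g0 (a1 hc.1 hc.2)), if_neg (fun hc => g0 (a2 hc.1 hc.2))]
          omega
      have := h.acc_le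
      omega
    -- For the infinite ratio all jobs of positive size are rejected, so no such `j` is accepted.
    · exact absurd (h.strict j j.2 hpj (by omega)) hj
  · rw [hload, hload]
    exact h.balanced i i.2 k k.2

/-! ### Optimality of the result -/

/-- The total size of all disagreements bounds the deviation after every prefix at once. Hence a
window around the prefix loads of the guide suffices, without reordering the jobs. -/
theorem pre_le_pre_add {n j : ℕ} (q f f' : ℕ → ℕ) (c : ℕ) (hj : j ≤ n) :
    pre q f c j ≤ pre q f' c j + ∑ k ∈ range n, if f k ≠ f' k then q k else 0 := by
  have h1 : pre q f c j ≤ pre q f' c j + ∑ k ∈ range j, if f k ≠ f' k then q k else 0 := by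
    rw [pre, pre, ← sum_add_distrib]
    refine sum_le_sum fun k _ => ?_
    split_ifs <;> omega
  refine h1.trans (Nat.add_le_add_left (sum_le_sum_of_subset ?_) _)
  simpa using hj

/-- The scaled makespan of an assignment. -/
def scaledMakespan (n m : ℕ) (p c f : ℕ → ℕ) : ℕ :=
  (range m).sup fun i => c (i + 1) * pre p f (i + 1) n

variable {n m b h W M : ℕ} {p w g c L : ℕ → ℕ} {val ch : ℕ → ℕ → ℕ}

/-- Assignments close to the guide are represented by final states of the table. -/
theorem IsTable.exists_of_near (hT : IsTable n (m + 1) b h W p w g val ch) (hb : b = 2 * h + 1)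
    (hg : ∀ l < n, g l ≤ m) (hp : ∀ l < n, p l ≤ M) (hL : ∀ i < m, L (i + 1) = pre p g (i + 1) n)
    {f : ℕ → ℕ} (hf : ∀ l < n, f l ≤ m) (hfW : pre w f 0 n ≤ W)
    (hnear : (∑ k ∈ range n, if f k ≠ g k then p k else 0) + M ≤ h) :
    ∃ x < b ^ (m + 1), val n x ≠ 0 ∧ finalCost m b h c L x = scaledMakespan n m p c f := by
  have h1 : ∀ j ≤ n, ∀ i < m + 1, pre p g i j + M ≤ h + pre p f i j := by
    intro j hj i _
    have := pre_le_pre_add p g f i hj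
    simp only [ne_comm (a := g _)] at this
    omega
  have h2 : ∀ j ≤ n, ∀ i < m + 1, pre p f i j + M ≤ h + pre p g i j := by
    intro j hj i _
    have := pre_le_pre_add p f g i hj
    omega
  have hlt : ∀ i < m + 1, h + pre p f i n - pre p g i n < b := by
    intro i hi
    have := h1 n le_rfl i hi
    have := h2 n le_rfl i hi
    omega
  have hcomp := hT.complete hb (fun l hl => Nat.lt_succ_of_le (hg l hl)) hp
    (fun l hl => Nat.lt_succ_of_le (hf l hl)) h1 h2 le_rfl
  refine ⟨_, enc_lt hlt, by omega, ?_⟩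
  refine Finset.sup_congr rfl fun i hi => ?_
  have hi := mem_range.1 hi
  have a1 := h1 n le_rfl (i + 1) (by omega)
  rw [digit_enc hlt (by omega), hL i hi]
  congr 1
  omega

/-- If the guide is at least as good as `τ`, the guide itself is a final state of the table.
Otherwise the loads of `τ` are below the makespan of the guide, hence by balance at most `M` above
its loads, and `exists_near_guide` moves `τ` into the window without raising a load. -/
theorem IsTable.optimal (hT : IsTable n (m + 1) b h W p w g val ch) (hb : b = 2 * h + 1)
    (hh : h = radius m M) (hm : 0 < m) (hM : 0 < M) (hc : ∀ i < m, 0 < c (i + 1))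
    (hg : ∀ l < n, g l ≤ m) (hp : ∀ l < n, p l ≤ M) (hw : ∀ l < n, w l ≤ M)
    (hL : ∀ i < m, L (i + 1) = pre p g (i + 1) n) (G : Fin n → Option (Fin m))
    (hgG : ∀ j : Fin n, g j = code (G j))
    (hG : IsGuide (fun j : Fin n => p j) (fun j : Fin n => w j) W M (fun i : Fin m => c (i + 1)) G)
    (τ : Fin n → Option (Fin m)) (hτ : tot (fun j : Fin n => w j) τ none ≤ W) :
    ∃ x < b ^ (m + 1), val n x ≠ 0 ∧ finalCost m b h c L x ≤
      univ.sup fun i : Fin m => c (i + 1) * tot (fun j : Fin n => p j) τ (some i) := by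
  have ext : ∀ σ : Fin n → Option (Fin m), ∃ f : ℕ → ℕ, ∀ j : Fin n, f j = code (σ j) := fun σ =>
    ⟨fun j => if hj : j < n then code (σ ⟨j, hj⟩) else 0, fun j => by simp⟩
  have key : ∀ σ : Fin n → Option (Fin m), tot (fun j : Fin n => w j) σ none ≤ W →
      (∑ j with σ j ≠ G j, p j) + M ≤ h → ∃ x < b ^ (m + 1), val n x ≠ 0 ∧
        finalCost m b h c L x =
          univ.sup fun i : Fin m => c (i + 1) * tot (fun j : Fin n => p j) σ (some i) := by
    intro σ hσ hd
    obtain ⟨f, hf⟩ := ext σ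
    obtain ⟨x, hx, hv, he⟩ := hT.exists_of_near (c := c) hb hg hp hL (f := f)
      (fun l hl => by rw [hf ⟨l, hl⟩]; exact code_le _)
      (by rw [tot_eq_pre w f σ hf] at hσ; exact hσ) (by
        rw [sum_filter] at hd
        rw [Finset.sum_range]
        refine le_trans (Nat.add_le_add_right (sum_le_sum fun j _ => ?_) _) hd
        rw [hf j, hgG j]
        simp only [Ne, code_injective.eq_iff]
        exact le_rfl)
    refine ⟨x, hx, hv, he.trans ?_⟩
    refine le_antisymm (Finset.sup_le fun i hi => ?_) (Finset.sup_le fun i _ => ?_)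
    · have := tot_eq_pre p f σ hf (some ⟨i, mem_range.1 hi⟩)
      refine le_trans (le_of_eq ?_)
        (Finset.le_sup (f := fun i : Fin m => c (i + 1) * tot (fun j : Fin n => p j) σ (some i))
          (mem_univ ⟨i, mem_range.1 hi⟩))
      simp only
      rw [this]
      rfl
    · rw [tot_eq_pre p f σ hf (some i)]
      exact Finset.le_sup (f := fun i => c (i + 1) * pre p f (i + 1) n) (mem_range.2 i.2)
  -- The radius has 181 in place of the proximity constant 180 in order to absorb the margin `M`.
  have hbig : 180 * m ^ 5 * M ^ (m + 4) + M ≤ h := by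
    rw [hh, radius]
    have h1 : M ≤ m ^ 5 * M ^ (m + 4) :=
      (Nat.le_self_pow (by omega) M).trans (Nat.le_mul_of_pos_left _ (by positivity))
    calc 180 * m ^ 5 * M ^ (m + 4) + M ≤ 180 * m ^ 5 * M ^ (m + 4) + m ^ 5 * M ^ (m + 4) := by
          omega
      _ = _ := by ring
  rcases le_total (univ.sup fun i : Fin m => c (i + 1) * tot (fun j : Fin n => p j) G (some i))
      (univ.sup fun i : Fin m => c (i + 1) * tot (fun j : Fin n => p j) τ (some i)) with hle | hle
  · obtain ⟨x, hx, hv, he⟩ := key G hG.feasible (by simp; omega)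
    exact ⟨x, hx, hv, he.trans_le hle⟩
  · have hload : ∀ i : Fin m, tot (fun j : Fin n => p j) τ (some i) ≤
        tot (fun j : Fin n => p j) G (some i) + M := by
      intro i
      obtain ⟨k, -, hk⟩ := Finset.exists_mem_eq_sup (univ : Finset (Fin m)) ⟨⟨0, hm⟩, mem_univ _⟩
        (fun i : Fin m => c (i + 1) * tot (fun j : Fin n => p j) G (some i))
      refine Nat.le_of_mul_le_mul_left ?_ (hc i i.2)
      calc _ ≤ _ := Finset.le_sup
            (f := fun i : Fin m => c (i + 1) * tot (fun j : Fin n => p j) τ (some i)) (mem_univ i)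
        _ ≤ _ := hle
        _ = _ := hk
        _ ≤ _ := hG.balanced i k
    obtain ⟨σ, h1, h2, h3⟩ := exists_near_guide hG hM (by simpa using hm) (fun j => hp j j.2)
      (fun j => hw j j.2) τ hτ hload
    rw [Fintype.card_fin] at h3
    obtain ⟨x, hx, hv, he⟩ := key σ h1 (by omega)
    refine ⟨x, hx, hv, he.trans_le (Finset.sup_mono_fun fun i _ => ?_)⟩
    exact Nat.mul_le_mul_left _ (h2 i)

/-! ### The whole algorithm -/

theorem toArr_coe {k : ℕ} (f : Fin k → ℕ) (j : Fin k) : toArr f j = f j := by simp [toArr]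

/-- Each integral scaled load is the true load times the product of the numerators of the speeds, a
positive factor common to all machines. -/
theorem Instance.makespan_le {m : ℕ} (I : Instance m) (c : ℕ → ℕ)
    (hc : ∀ i : Fin m, c (i + 1) = (∏ k, (I.q k).num) / (I.q i).num * (I.q i).den)
    (σ τ : I.Schedule)
    (h : (univ.sup fun i : Fin m => c (i + 1) * tot I.p σ (some i)) ≤
      univ.sup fun i : Fin m => c (i + 1) * tot I.p τ (some i)) :
    I.makespan σ ≤ I.makespan τ := by
  set Q : ℕ := ∏ k, (I.q k).num with hQ
  have hnum : ∀ i, 0 < (I.q i).num := fun i => NNRat.num_pos.2 (I.q_pos i)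
  have hQ0 : 0 < Q := prod_pos fun k _ => hnum k
  have hload : ∀ (ρ : I.Schedule) (i : Fin m),
      ((c (i + 1) * tot I.p ρ (some i) : ℕ) : ℚ≥0) = Q * I.machineLoad ρ i := by
    intro ρ i
    have h1 : ((I.q i).num : ℚ≥0) ≠ 0 := by exact_mod_cast (hnum i).ne'
    have h2 : ((I.q i).den : ℚ≥0) ≠ 0 := by exact_mod_cast (I.q i).den_ne_zero
    have h3 : ((I.q i).num : ℚ≥0) / (I.q i).den = I.q i := NNRat.num_div_den _
    have hdvd : (I.q i).num ∣ Q := dvd_prod_of_mem _ (mem_univ i)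
    have h4 : (c (i + 1) : ℚ≥0) = Q / I.q i := by
      have h5 : I.q i ≠ 0 := (I.q_pos i).ne'
      have h6 : ((I.q i).den : ℚ≥0) * I.q i = (I.q i).num := by
        rw [mul_comm]
        exact ((div_eq_iff h2).1 h3).symm
      rw [hc i, Nat.cast_mul, Nat.cast_div hdvd h1, eq_div_iff h5, mul_assoc, h6,
        div_mul_cancel₀ _ h1]
    rw [Nat.cast_mul, h4, Instance.machineLoad, ← sum_div, tot, Nat.cast_sum]
    ring
  refine Finset.sup_le fun i _ => ?_
  obtain ⟨k, -, hk⟩ := Finset.exists_mem_eq_sup (univ : Finset (Fin m)) ⟨i, mem_univ _⟩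
    (fun i : Fin m => c (i + 1) * tot I.p τ (some i))
  have h1 : c (i + 1) * tot I.p σ (some i) ≤ c (k + 1) * tot I.p τ (some k) :=
    (Finset.le_sup (f := fun i : Fin m => c (i + 1) * tot I.p σ (some i)) (mem_univ i)).trans
      (h.trans_eq hk)
  have h2 : (Q : ℚ≥0) * I.machineLoad σ i ≤ Q * I.machineLoad τ k := by
    rw [← hload, ← hload]
    exact_mod_cast h1
  exact (le_of_mul_le_mul_left h2 (by exact_mod_cast hQ0)).trans
    (Finset.le_sup (f := I.machineLoad τ) (mem_univ k))

def mainProg (m : ℕ) : Program :=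
  .seq maxProg (.seq (slowProg m) (.seq thresholdProg (.seq (guideProg m) (.seq (windowProg m)
    (.seq (fillProg m) (.seq (finalProg m) backProg))))))

theorem total_time_le {n m M S t1 t2 t3 t4 t5 t6 t7 t8 : ℕ} (hn : 0 < n) (hS : 0 < S)
    (hMS : M * (M + 1) ≤ S) (h1 : t1 ≤ 30 * n + 10) (h2 : t2 ≤ 50 * m + 50)
    (h3 : t3 ≤ M * ((M + 1) * (60 * n + 70) + 50) + 60 * n + 100)
    (h4 : t4 ≤ n * (40 * m + 90) + 10) (h5 : t5 ≤ 40 * m + 80)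
    (h6 : t6 ≤ n * (S * (100 * m + 210) + 20) + 20) (h7 : t7 ≤ S * (80 * m + 80) + 20)
    (h8 : t8 ≤ 60 * n + 20) :
    t1 + (t2 + (t3 + (t4 + (t5 + (t6 + (t7 + t8 + 1) + 1) + 1) + 1) + 1) + 1) + 1 ≤
      (400 * m + 1200) * (n * S) := by
  have a1 : n ≤ n * S := Nat.le_mul_of_pos_right _ hS
  have a2 : S ≤ n * S := Nat.le_mul_of_pos_left _ hn
  have a3 : 1 ≤ n * S := Nat.mul_pos hn hS
  have a4 : m ≤ m * (n * S) := Nat.le_mul_of_pos_right _ a3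
  have a5 : m * n ≤ m * (n * S) := Nat.mul_le_mul_left _ a1
  have a6 : m * S ≤ m * (n * S) := Nat.mul_le_mul_left _ a2
  have a7 : n * (M * (M + 1)) ≤ n * S := Nat.mul_le_mul_left _ hMS
  have a8 : M ≤ M * (M + 1) := Nat.le_mul_of_pos_right _ (Nat.succ_pos M)
  linarith

theorem mainProg_run {m : ℕ} (hm : 0 < m) (I : Instance m) (hn : 0 < I.n) {B N M b S : ℕ}
    (hM : M = (range I.n).sup fun j => toArr I.p j + toArr I.w j) (hM0 : 0 < M)
    (hb : b = 2 * radius m M + 1) (hS : S = b ^ (m + 1)) (hN : 2 ≤ N) (hnN : I.n ≤ N)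
    (hMN : M ≤ N) (hWN : I.W ≤ N) (hnum : ∀ i, (I.q i).num ≤ N) (hden : ∀ i, (I.q i).den ≤ N)
    (hB : N ^ (m + 4) * S < B) :
    WP B (mainProg m) I.init (fun t s => t ≤ (400 * m + 1200) * (I.n * S) ∧
      ∃ σ : I.Schedule, I.Outputs s σ ∧ I.IsOptimal σ) := by
  set n := I.n with hn'
  set W := I.W with hW'
  set p := toArr I.p with hp'
  set w := toArr I.w with hw'
  set h := radius m M with hh
  have hb0 : 0 < b := by omega
  have hpw : ∀ j < n, p j + w j ≤ M := fun j hj =>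
    hM ▸ Finset.le_sup (f := fun j => p j + w j) (mem_range.2 hj)
  have hp : ∀ j < n, p j ≤ M := fun j hj => (Nat.le_add_right _ _).trans (hpw j hj)
  have hw : ∀ j < n, w j ≤ M := fun j hj => (Nat.le_add_left _ _).trans (hpw j hj)
  -- numerical bounds
  have hS0 : 0 < S := hS ▸ pow_pos hb0 _
  have hbS : b ≤ S := hS ▸ Nat.le_self_pow (by omega) b
  have hMh : 2 * M ≤ h := by
    have h1 : 1 * M ≤ m ^ 5 * M ^ (m + 4) :=
      Nat.mul_le_mul (Nat.one_le_pow _ _ hm) (Nat.le_self_pow (by omega) M)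
    rw [hh, radius, mul_assoc]
    omega
  have hMS : M * (M + 1) ≤ S :=
    calc M * (M + 1) ≤ b * b := Nat.mul_le_mul (by omega) (by omega)
      _ = b ^ 2 := (sq b).symm
      _ ≤ S := hS ▸ Nat.pow_le_pow_right hb0 (by omega)
  have big : ∀ a ≤ m + 4, N ^ a * S < B := fun a ha =>
    (Nat.mul_le_mul_right _ (Nat.pow_le_pow_right (by omega) ha)).trans_lt hB
  have big' : ∀ a ≤ m + 4, N ^ a < B := fun a ha =>
    (Nat.le_mul_of_pos_right _ hS0).trans_lt (big a ha)
  have hN2 : 2 * N ≤ N ^ 2 := by nlinarith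
  have hN3 : 2 * N ^ 2 ≤ N ^ 3 := by rw [pow_succ N 2]; nlinarith
  have hB2 := big' 2 (by omega)
  have hB3 := big' 3 (by omega)
  have hSB2 : N ^ 2 * S < B := big 2 (by omega)
  have hmN : m + 1 < B :=
    calc m + 1 ≤ 2 ^ m := Nat.lt_two_pow_self
      _ ≤ N ^ m := Nat.pow_le_pow_left hN m
      _ < B := big' m (by omega)
  have hnM : n * M ≤ N ^ 2 := by rw [sq]; exact Nat.mul_le_mul hnN hMN
  have hMM : M * M ≤ N ^ 2 := by rw [sq]; exact Nat.mul_le_mul hMN hMN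
  have hCnM : N ^ (m + 1) * (n * M) < B := by
    refine lt_of_le_of_lt ?_ (big' (m + 3) (by omega))
    calc N ^ (m + 1) * (n * M) ≤ N ^ (m + 1) * N ^ 2 := Nat.mul_le_mul_left _ hnM
      _ = N ^ (m + 3) := by ring
  have hnS : (n + 1) * S < B := (Nat.mul_le_mul_right _ (by omega)).trans_lt hSB2
  have hMS' : (M + 1) * S < B := (Nat.mul_le_mul_right _ (by omega)).trans_lt hSB2
  have hSle : S ≤ N ^ 2 * S := Nat.le_mul_of_pos_left _ (by positivity)
  have hbM : b + M < B := by
    have : b + M ≤ (1 + M) * S := by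
      rw [add_mul, one_mul]
      exact Nat.add_le_add hbS (Nat.le_mul_of_pos_right _ hS0)
    rw [add_comm 1 M] at this
    omega
  -- This is where the full bound on `B` is used: a slowness is at most N^(m+1), and a load shifted
  -- inside the window, plus one, is at most N^3 S.
  have hCAB : N ^ (m + 1) * (n * M + b) + 1 < B := by
    refine lt_of_le_of_lt ?_ hB
    have e : n * M + b + 1 ≤ N ^ 3 * S := by
      have h1 : n * M + b + 1 ≤ N ^ 2 * S + S + S := by
        have : N ^ 2 ≤ N ^ 2 * S := Nat.le_mul_of_pos_right _ hS0
        omega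
      have h2 : 2 * N ^ 2 * S ≤ N ^ 3 * S := Nat.mul_le_mul_right _ hN3
      have h3 : 2 * S ≤ N ^ 2 * S := Nat.mul_le_mul_right _ (by omega)
      have h4 : 2 * N ^ 2 * S = N ^ 2 * S + N ^ 2 * S := by ring
      omega
    calc N ^ (m + 1) * (n * M + b) + 1 ≤ N ^ (m + 1) * (n * M + b) + N ^ (m + 1) :=
          Nat.add_le_add_left (Nat.one_le_pow _ _ (by omega)) _
      _ = N ^ (m + 1) * (n * M + b + 1) := by ring
      _ ≤ N ^ (m + 1) * (N ^ 3 * S) := Nat.mul_le_mul_left _ e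
      _ = N ^ (m + 4) * S := by ring
  have hAB : n * M + b < B :=
    (Nat.le_mul_of_pos_left _ (by positivity)).trans_lt (Nat.lt_of_succ_lt hCAB)
  -- the run
  rw [mainProg, wp_seq]
  refine (maxProg_spec (B := B) (n := n) (s := I.init) rfl rfl (by omega)
    (fun j hj => by have : p j + w j ≤ M := hpw j hj; exact lt_of_le_of_lt this (by omega))).mono ?_
  rintro t1 s1 ⟨ht1, v2, F1⟩
  replace v2 : s1.var 2 = M := v2.trans hM.symm
  have num1 : ∀ i : Fin m, s1.arr 2 i = (I.q i).num := fun i => by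
    rw [F1.arr 2 (by decide)]; exact toArr_coe (fun i => (I.q i).num) i
  have den1 : ∀ i : Fin m, s1.arr 3 i = (I.q i).den := fun i => by
    rw [F1.arr 3 (by decide)]; exact toArr_coe (fun i => (I.q i).den) i
  rw [wp_seq]
  refine (slowProg_spec (N := N) (by omega) (big' _ (by omega)) hmN
    (fun i hi => (num1 ⟨i, hi⟩).trans_le (hnum _))
    (fun i hi => (den1 ⟨i, hi⟩).trans_le (hden _))).mono ?_
  rintro t2 s2 ⟨ht2, c2, F2⟩
  obtain ⟨c, hcdef⟩ : ∃ c, c = s2.arr 10 := ⟨_, rfl⟩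
  have hprod : ∏ k ∈ range m, s1.arr 2 k = ∏ k, (I.q k).num := by
    rw [Finset.prod_range]
    exact prod_congr rfl fun i _ => num1 i
  have hc : ∀ i : Fin m, c (i + 1) = (∏ k, (I.q k).num) / (I.q i).num * (I.q i).den := by
    intro i
    rw [hcdef, c2 i i.2, hprod, num1, den1]
  have hc0 : ∀ i < m, 0 < c (i + 1) := by
    intro i hi
    rw [hc ⟨i, hi⟩]
    have hq : ∀ k, 0 < (I.q k).num := fun k => NNRat.num_pos.2 (I.q_pos k)
    exact Nat.mul_pos (Nat.div_pos (Nat.le_of_dvd (prod_pos fun k _ => hq k)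
      (dvd_prod_of_mem _ (mem_univ _))) (hq _)) (I.q _).den_pos
  have hcC : ∀ i < m, c (i + 1) ≤ N ^ (m + 1) := by
    intro i hi
    rw [hc ⟨i, hi⟩, pow_succ]
    refine Nat.mul_le_mul ((Nat.div_le_self _ _).trans ?_) (hden _)
    calc ∏ k, (I.q k).num ≤ ∏ _k : Fin m, N := prod_le_prod' fun k _ => hnum k
      _ = N ^ m := by simp
  have A0 : s2.arr 0 = p := (F2.arr 0 (by decide)).trans (F1.arr 0 (by decide))
  have A1 : s2.arr 1 = w := (F2.arr 1 (by decide)).trans (F1.arr 1 (by decide))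
  have V0 : s2.var 0 = n := (F2.var 0 (by decide)).trans (F1.var 0 (by decide))
  have V1 : s2.var 1 = W := (F2.var 1 (by decide)).trans (F1.var 1 (by decide))
  have V2 : s2.var 2 = M := (F2.var 2 (by decide)).trans v2
  have A6 : s2.arr 6 = fun _ => 0 := (F2.arr 6 (by decide)).trans (F1.arr 6 (by decide))
  have A8 : s2.arr 8 = fun _ => 0 := (F2.arr 8 (by decide)).trans (F1.arr 8 (by decide))
  rw [wp_seq]
  refine (thresholdProg_spec (n := n) (W := W) (M := M) V0 V1 V2 hM0 (by omega) (by omega)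
    (by rwa [A0]) (by rwa [A1]) (by omega) (by omega) (by omega)).mono ?_
  rintro t3 s3 ⟨ht3, v10, v11, v8, hth, F3⟩
  rw [A0, A1] at v8 hth
  obtain ⟨v, hv⟩ : ∃ v, v = s3.var 10 := ⟨_, rfl⟩
  obtain ⟨u, hu⟩ : ∃ u, u = s3.var 11 := ⟨_, rfl⟩
  rw [← hv] at v10 v8 hth
  rw [← hu] at v11 v8 hth
  have hHW : strictWeight p w n v u ≤ W := by
    rcases hth with ⟨-, h1, -⟩ | ⟨h1, h2, h3⟩
    · exact h1
    · rw [h1, h2]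
      exact strictWeight_le_of_no_threshold hp hw h3
  rw [wp_seq]
  have B0 : s3.arr 0 = p := (F3.arr 0 (by decide)).trans A0
  have B1 : s3.arr 1 = w := (F3.arr 1 (by decide)).trans A1
  have B10 : s3.arr 10 = c := (F3.arr 10 (by decide)).trans hcdef.symm
  have U0 : s3.var 0 = n := (F3.var 0 (by decide)).trans V0
  have U1 : s3.var 1 = W := (F3.var 1 (by decide)).trans V1
  have U2 : s3.var 2 = M := (F3.var 2 (by decide)).trans V2
  refine (guideProg_spec (n := n) (W := W) (M := M) (C := N ^ (m + 1)) U0 U1 hv.symm hu.symm v8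
    ((F3.arr 6 (by decide)).trans A6) hm hHW (by rwa [B0]) (by rwa [B1]) (by rwa [B10]) v10 v11
    hmN (by omega) (by omega) hCnM (big' _ (by omega)) (by omega)).mono ?_
  rintro t4 s4 ⟨ht4, ⟨acc, hinv⟩, F4⟩
  rw [B0, B1, B10] at hinv
  obtain ⟨g, hg⟩ : ∃ g, g = s4.arr 5 := ⟨_, rfl⟩
  obtain ⟨L, hL⟩ : ∃ L, L = s4.arr 6 := ⟨_, rfl⟩
  rw [← hg, ← hL] at hinv
  have hgm : ∀ j < n, g j ≤ m := hinv.code_le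
  choose G hG using fun j : Fin n => exists_code (hgm j j.2)
  have hguide := hinv.isGuide (hth.imp_right fun h => ⟨h.1, h.2.1⟩) hw G fun j => (hG j).symm
  have hLle : ∀ i < m, L (i + 1) ≤ n * M := by
    intro i hi
    rw [hinv.load i hi]
    refine (pre_le_sum _ _ _ _).trans ?_
    simpa using sum_le_card_nsmul (range n) p M fun j hj => hp j (by simpa using hj)
  rw [wp_seq]
  refine (windowProg_spec (b := b) hm hM0 ((F4.var 2 (by decide)).trans U2) hh hb
    (by rw [← hS]; omega) hmN).mono ?_
  rintro t5 s5 ⟨ht5, w14, w15, w16, w20, w7, F5⟩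
  rw [← hS] at w16
  have C0 : s5.arr 0 = p := (F5.arr 0 (by decide)).trans ((F4.arr 0 (by decide)).trans B0)
  have C1 : s5.arr 1 = w := (F5.arr 1 (by decide)).trans ((F4.arr 1 (by decide)).trans B1)
  have C5 : s5.arr 5 = g := (F5.arr 5 (by decide)).trans hg.symm
  have C6 : s5.arr 6 = L := (F5.arr 6 (by decide)).trans hL.symm
  have C8 : s5.arr 8 = fun _ => 0 := (F5.arr 8 (by decide)).trans ((F4.arr 8 (by decide)).trans
    ((F3.arr 8 (by decide)).trans A8))
  have C10 : s5.arr 10 = c := (F5.arr 10 (by decide)).trans ((F4.arr 10 (by decide)).trans B10)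
  have T0 : s5.var 0 = n := (F5.var 0 (by decide)).trans ((F4.var 0 (by decide)).trans U0)
  have T1 : s5.var 1 = W := (F5.var 1 (by decide)).trans ((F4.var 1 (by decide)).trans U1)
  rw [wp_seq]
  refine (fillProg_spec (m := m) (M := M) (W := W) (b := b) (S := S) (n := n)
    (x₀ := enc b (m + 1) fun _ => h) hb0 hS T0 T1 w15 w16 w20
    (by rw [hS]; exact enc_lt fun _ _ => by omega) w7 (by rwa [C5]) (by rwa [C0]) (by rwa [C1]) C8
    hmN (by omega) hnS hMS' hbM).mono ?_
  rintro t6 s6 ⟨ht6, hfill, h8, F6⟩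
  rw [C0, C1, C5, hS] at hfill
  have hT := hfill.isTable
  rw [← hS] at hT
  have D0 : s6.arr 0 = p := (F6.arr 0 (by decide)).trans C0
  have D5 : s6.arr 5 = g := (F6.arr 5 (by decide)).trans C5
  have D6 : s6.arr 6 = L := (F6.arr 6 (by decide)).trans C6
  have D7 : s6.arr 7 = s5.arr 7 := F6.arr 7 (by decide)
  have D10 : s6.arr 10 = c := (F6.arr 10 (by decide)).trans C10
  have R0 : s6.var 0 = n := (F6.var 0 (by decide)).trans T0
  have R16 : s6.var 16 = S := (F6.var 16 (by decide)).trans w16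
  have hopt : ∀ τ : I.Schedule, I.Feasible τ → ∃ x < S, s6.arr 8 (n * S + x) ≠ 0 ∧
      finalCost m b h c L x ≤ univ.sup fun i : Fin m => c (i + 1) * tot I.p τ (some i) := by
    intro τ hτ
    have ep : (fun j : Fin n => p j) = I.p := funext fun j => toArr_coe I.p j
    have ew : (fun j : Fin n => w j) = I.w := funext fun j => toArr_coe I.w j
    have := hT.optimal (c := c) hb hh hm hM0 hc0 hgm hp hw hinv.load G (fun j => (hG j).symm) hguide τ
      (by rw [ew]; exact hτ)
    rw [ep, ← hS] at this
    exact this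
  have hGfeas : I.Feasible G := by
    have := hguide.feasible
    have ew : (fun j : Fin n => w j) = I.w := funext fun j => toArr_coe I.w j
    rw [ew] at this
    exact this
  rw [wp_seq]
  refine (finalProg_spec (n := n) (C := N ^ (m + 1)) (A := n * M) hb0 hS R0
    ((F6.var 14 (by decide)).trans w14) ((F6.var 15 (by decide)).trans w15) R16
    (by rwa [D7]) h8 (by rwa [D10]) (by rwa [D6])
    (by obtain ⟨x, hx, hv, -⟩ := hopt G hGfeas; exact ⟨x, hx, hv⟩)
    hmN (by omega) (by omega) hnS hAB (big' _ (by omega)) hCAB).mono ?_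
  rintro t7 s7 ⟨ht7, hx, hvx, hmin, F7⟩
  rw [D10, D6] at hmin
  have E0 : s7.arr 0 = p := (F7.arr 0 (by decide)).trans D0
  have E5 : s7.arr 5 = g := (F7.arr 5 (by decide)).trans D5
  have E7 : s7.arr 7 = s5.arr 7 := (F7.arr 7 (by decide)).trans D7
  have E9 : s7.arr 9 = s6.arr 9 := F7.arr 9 (by decide)
  refine (backProg_spec (m := m) (M := M) (W := W) (b := b) (h := h) (S := S) (n := n) (w := w)
    (val := fun l x => s6.arr 8 (l * S + x)) (ch := fun l x => s6.arr 9 (l * S + x))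
    (by rw [E0, E5]; exact hT) hb hS (fun l x => by rw [E9]) ((F7.var 0 (by decide)).trans R0)
    ((F7.var 16 (by decide)).trans R16) (by rwa [E7]) (by rwa [E5]) (by rwa [E0]) hx hvx hmN hnS
    hMS').mono ?_
  rintro t8 s8 ⟨ht8, X, hXn, hX, hf⟩
  rw [E0, E5] at hX
  obtain ⟨hfm, hfW, hfdig⟩ := hT.sound hb (fun l hl => Nat.lt_succ_of_le (hgm l hl)) hX hf
    (by rw [hXn, ← hS]; exact hx) (by rw [hXn]; exact hvx)
  rw [hXn] at hfW hfdig
  refine ⟨total_time_le hn hS0 hMS ht1 ht2 ht3 ht4 ht5 ht6 ht7 ht8, ?_⟩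
  choose σ hσ using fun j : Fin n => exists_code (Nat.lt_succ_iff.1 (hfm j j.2))
  have hp_tot : ∀ o, tot I.p σ o = pre p (s8.arr 4) (code o) n := fun o => by
    rw [← tot_eq_pre p (s8.arr 4) σ (fun j => (hσ j).symm)]
    exact congrArg (fun q => tot q σ o) (funext fun j => (toArr_coe I.p j).symm)
  have hw_tot : tot I.w σ none = pre w (s8.arr 4) 0 n := by
    have := tot_eq_pre w (s8.arr 4) σ (fun j => (hσ j).symm) none
    refine Eq.trans ?_ this
    exact congrArg (fun q => tot q σ none) (funext fun j => (toArr_coe I.w j).symm)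
  refine ⟨σ, fun j => (hσ j).symm, ?_, fun τ hτ => ?_⟩
  · change tot I.w σ none ≤ W
    omega
  -- The scaled makespan of the traced schedule is the cost of the chosen final state, which is at
  -- most that of `x` and thus at most that of `τ`.
  · obtain ⟨x, hx', hv', hle⟩ := hopt τ hτ
    refine I.makespan_le c hc σ τ (le_trans (Finset.sup_le fun i _ => ?_)
      ((hmin x hx' hv').trans hle))
    have hd := hfdig (i + 1) (by omega)
    rw [hp_tot]
    refine le_trans (le_of_eq ?_) (Finset.le_sup (f := fun i => c (i + 1) *
      (L (i + 1) + s7.var 22 / b ^ (i + 1) % b - h)) (mem_range.2 i.2))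
    rw [hinv.load i i.2]
    congr 1
    change pre p (s8.arr 4) (i + 1) n = _
    omega

/-! ### Word length and running time in terms of the input. -/

theorem solves_mainProg {m : ℕ} (hm : 0 < m) (I : Instance m) (hn : 0 < I.n)
    (hD : 0 < I.pmax + I.wmax) :
    Solves (mainProg m) I (I.magnitude ^ ((6 * m + 14) * (m + 1) + m + 5))
      ((400 * m + 1200) * (543 * m ^ 5) ^ (m + 1) *
        ((I.pmax + I.wmax) ^ ((m + 2) * (m + 3)) * I.n)) := by
  set D := I.pmax + I.wmax with hD'
  set N := I.magnitude with hN'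
  obtain ⟨M, hM⟩ : ∃ M, M = (range I.n).sup fun j => toArr I.p j + toArr I.w j := ⟨_, rfl⟩
  have hpD : ∀ j : Fin I.n, I.p j ≤ I.pmax := fun j => Finset.le_sup (f := I.p) (mem_univ j)
  have hwD : ∀ j : Fin I.n, I.w j ≤ I.wmax := fun j => Finset.le_sup (f := I.w) (mem_univ j)
  have hMD : M ≤ D := by
    rw [hM]
    refine Finset.sup_le fun j hj => ?_
    have hj := mem_range.1 hj
    have h1 := hpD ⟨j, hj⟩
    have h2 := hwD ⟨j, hj⟩
    rw [← toArr_coe I.p] at h1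
    rw [← toArr_coe I.w] at h2
    exact Nat.add_le_add h1 h2
  have hMle : ∀ j : Fin I.n, I.p j + I.w j ≤ M := fun j => by
    rw [← toArr_coe I.p, ← toArr_coe I.w, hM]
    exact Finset.le_sup (f := fun j => toArr I.p j + toArr I.w j) (mem_range.2 j.2)
  have hM0 : 0 < M := by
    by_contra h0
    have h1 : I.pmax ≤ 0 := Finset.sup_le fun j _ => by have := hMle j; omega
    have h2 : I.wmax ≤ 0 := Finset.sup_le fun j _ => by have := hMle j; omega
    omega
  have hq : ∀ i, (I.q i).num + (I.q i).den ≤ ∑ i, ((I.q i).num + (I.q i).den) := fun i =>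
    single_le_sum (f := fun i => (I.q i).num + (I.q i).den) (fun _ _ => Nat.zero_le _) (mem_univ i)
  have hNdef : N = 2 + I.n + I.pmax + I.wmax + I.W + ∑ i, ((I.q i).num + (I.q i).den) := rfl
  have hN2 : 2 ≤ N := by omega
  set b := 2 * radius m M + 1 with hb
  have hr0 : 1 ≤ radius m M := by
    rw [radius]
    have : 0 < m ^ 5 * M ^ (m + 4) := by positivity
    rw [mul_assoc]
    omega
  -- As the radius is at least 1, `b` is at most three times the radius, and 543 = 3 * 181.
  have hb3 : b ≤ 543 * m ^ 5 * M ^ (m + 4) := by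
    have : 543 * m ^ 5 * M ^ (m + 4) = 3 * radius m M := by rw [radius]; ring
    omega
  have hmN : m ≤ N ^ m := Nat.lt_two_pow_self.le.trans (Nat.pow_le_pow_left hN2 m)
  -- The exponent is 10 + 5m + (m + 4), using 543 ≤ 2^10 and m ≤ N^m.
  have hbN : b ≤ N ^ (6 * m + 14) :=
    calc b ≤ 543 * m ^ 5 * M ^ (m + 4) := hb3
      _ ≤ N ^ 10 * (N ^ m) ^ 5 * N ^ (m + 4) := by
        refine Nat.mul_le_mul (Nat.mul_le_mul ?_ (Nat.pow_le_pow_left hmN 5))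
          (Nat.pow_le_pow_left (by omega) _)
        exact le_trans (by norm_num) (Nat.pow_le_pow_left hN2 10)
      _ = N ^ (6 * m + 14) := by rw [← pow_mul, ← pow_add, ← pow_add]; congr 1; ring
  have hB : N ^ (m + 4) * b ^ (m + 1) < N ^ ((6 * m + 14) * (m + 1) + m + 5) :=
    calc N ^ (m + 4) * b ^ (m + 1) ≤ N ^ (m + 4) * (N ^ (6 * m + 14)) ^ (m + 1) :=
          Nat.mul_le_mul_left _ (Nat.pow_le_pow_left hbN _)
      _ = N ^ ((6 * m + 14) * (m + 1) + m + 4) := by rw [← pow_mul, ← pow_add]; congr 1; ring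
      _ < _ := Nat.pow_lt_pow_right (by omega) (by omega)
  obtain ⟨t, s, hrun, ht, σ, hout, hopt⟩ := mainProg_run hm I hn hM hM0 hb rfl hN2 (by omega)
    (by omega) (by omega) (fun i => by have := hq i; omega) (fun i => by have := hq i; omega) hB
  refine ⟨t, s, σ, hrun, ht.trans ?_, hout, hopt⟩
  -- The number of states has degree (m + 4)(m + 1) = m^2 + 5m + 4 in M, two less than (m + 2)(m +
  -- 3).
  have hS : b ^ (m + 1) ≤ (543 * m ^ 5) ^ (m + 1) * D ^ ((m + 2) * (m + 3)) :=
    calc b ^ (m + 1) ≤ (543 * m ^ 5 * M ^ (m + 4)) ^ (m + 1) := Nat.pow_le_pow_left hb3 _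
      _ = (543 * m ^ 5) ^ (m + 1) * M ^ ((m + 4) * (m + 1)) := by rw [mul_pow, ← pow_mul]
      _ ≤ (543 * m ^ 5) ^ (m + 1) * D ^ ((m + 2) * (m + 3)) := by
        refine Nat.mul_le_mul_left _ ((Nat.pow_le_pow_left hMD _).trans
          (Nat.pow_le_pow_right hD ?_))
        nlinarith
  calc (400 * m + 1200) * (I.n * b ^ (m + 1)) ≤
        (400 * m + 1200) * (I.n * ((543 * m ^ 5) ^ (m + 1) * D ^ ((m + 2) * (m + 3)))) :=
        Nat.mul_le_mul_left _ (Nat.mul_le_mul_left _ hS)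
    _ = _ := by ring

end SchedRej

theorem mainTheorem3 (m : ℕ) (hm : 0 < m) :
    ∃ (P : SchedRej.Program) (κ c k : ℕ), ∀ I : SchedRej.Instance m,
      0 < I.n → 0 < I.pmax + I.wmax →
        SchedRej.Solves P I (I.magnitude ^ κ)
          (c * ((I.pmax + I.wmax) ^ ((m + 2) * (m + 3)) * I.n) *
            Nat.log 2 (I.n + I.pmax + I.wmax) ^ k) := by
  -- The exponent of the logarithm is `0`: no polylogarithmic factor is needed.
  refine ⟨SchedRej.mainProg m, (6 * m + 14) * (m + 1) + m + 5,
    (400 * m + 1200) * (543 * m ^ 5) ^ (m + 1), 0, fun I hn hD => ?_⟩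
  rw [pow_zero, mul_one]
  exact SchedRej.solves_mainProg hm I hn hD
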